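/- **Local existence of adjoint transforms of Willmore surfaces.** *Setting.* Let $n\ge 3$, let $\Omega\subseteq\mathbb{C}$ be open (a coordinate domain of a Riemann surface, with coordinate $z=u+iv$) and let $f:\Omega\to S^n\subset\mathbb{R}^{n+1}$ be a smooth conformal immersion. Let $\langle\cdot,\cdot\rangle$ be the complex bilinear extension to $\mathbb{C}^{n+2}$ of the Minkowski form $-x_0y_0+\sum_{i=1}^{n+1}x_iy_i$. Let $Y$ be the canonical lift of $f$, i.e. the positive multiple of $(1,f)$ with $\langle Y_z,Y_{\bar z}\rangle=\frac12$; let $V_{\mathbb{C}}$ be spanned by $Y,Y_z,Y_{\bar z},Y_{z\bar z}$, and let $N$ be the real light-like section of $V_{\mathbb{C}}$ with $\langle N,Y\rangle=-1$ and $\langle N,Y_z\rangle=0$. The Schwarzian $s$ and the Hopf differential $\kappa$ are determined by $Y_{zz}+\frac s2Y=\kappa\perp V_{\mathbb{C}}$; $D$ is the normal connection on $V_{\mathbb{C}}^\perp$ (the orthogonal projection of the derivative). Suppose that $f$ is a Willmore surface: it is critical, under all compactly supported smooth variations through maps $\Omega\to S^n$, for the area of the Möbius metric, i.e. for $\frac14\int(|H|^2-K_{\mathrm{ext}})\,dA$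 (which is $\int\langle\kappa,\bar\kappa\rangle\,du\,dv$ for $f$ itself), where $H$ is the mean curvature vector in $S^n$ and $K_{\mathrm{ext}}=K-1$ with $K$ the Gauss curvature. For a function $\mu$ put $\eta=D_{\bar z}\kappa+\frac{\bar\mu}2\kappa$. An *adjoint transform* of $f$ on an open set $U\subseteq\Omega$ is given by a smooth function $\mu:U\to\mathbb{C}$ with $$\mu_z-\tfrac12\mu^2-s=0\quad\text{(co-touching)},\qquad \langle\eta,\eta\rangle=0\quad\text{(conformality)};$$ it is the map $U\to S^n$ represented by the light-like vector $\frac12|\mu|^2Y+\bar\mu Y_z+\mu Y_{\bar z}+N$. Let $\Delta=\langle\kappa,D_{\bar z}\kappa\rangle^2-\langle\kappa,\kappa\rangle\langle D_{\bar z}\kappa,D_{\bar z}\kappa\rangle$. *Statement.* 1. There is an open dense subset of $\Omega$ each point of which has a neighbourhood on which $f$ admits an adjoint transform. 2. If $U\subseteq\Omega$ is open and $\langle\kappa,\kappa\rangle\ne0$ everywhere on $U$, then every smooth $\mu:U\to\mathbb{C}$ that solves the conformality equation (quadratic in $\bar\mu$) also solves the co-touching equation, and so defines an adjoint transform on $U$.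 3. $\Delta$ is holomorphic on $\Omega$. If $p\in\Omega$, $\langle\kappa,\kappa\rangle(p)\neq0$ and $p$ is not a zero of odd order of $\Delta$ (so $\Delta(p)\ne0$, or $\Delta$ has a zero of even order at $p$, or $\Delta\equiv0$ near $p$), then for every root $m\in\mathbb{C}$ of the conformality equation at $p$ there are a neighbourhood $U$ of $p$ and an adjoint transform on $U$ with $\mu(p)=m$. 4. If $U\subseteq\Omega$ is open and $\langle\kappa,\kappa\rangle\equiv0$ on $U$, then every smooth solution $\mu$ on $U$ of the Riccati equation $\mu_z-\frac12\mu^2-s=0$ defines an adjoint transform on $U$, and every $p\in U$ has a neighbourhood $V\subseteq U$ on which there are infinitely many adjoint transforms; indeed the values $\mu(p)$ of the corresponding functions $\mu$ on $V$ form an infinite set. -/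

import Mathlib

open scoped ContDiff ComplexConjugate

namespace WillmoreAdjoint

noncomputable section

/-! ### Wirtinger derivatives and the complexified Minkowski space -/

/-- The Wirtinger derivative `F_z = (F_u - i F_v) / 2`, where `z = u + i v`. -/
def dz {E : Type*} [NormedAddCommGroup E] [NormedSpace ℂ E] (F : ℂ → E) (z : ℂ) : E :=
  (1 / 2 : ℂ) • (fderiv ℝ F z 1 - Complex.I • fderiv ℝ F z Complex.I)

/-- The Wirtinger derivative `F_{z̄} = (F_u + i F_v) / 2`, where `z = u + i v`. -/
def dzbar {E : Type*} [NormedAddCommGroup E] [NormedSpace ℂ E] (F : ℂ → E) (z : ℂ) : E :=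
  (1 / 2 : ℂ) • (fderiv ℝ F z 1 + Complex.I • fderiv ℝ F z Complex.I)

/-- The complexification `ℂ^{n+2}` of the Minkowski space `ℝ^{n+1,1}`. -/
abbrev Mink (n : ℕ) : Type := Fin (n + 2) → ℂ

/-- The complex bilinear extension of the Minkowski form
`⟨x, y⟩ = - x₀ y₀ + ∑_{i=1}^{n+1} xᵢ yᵢ`. -/
def mink {n : ℕ} (x y : Mink n) : ℂ :=
  -(x 0 * y 0) + ∑ i : Fin (n + 1), x i.succ * y i.succ

/-- The light-like vector `(1, x)` that represents a point `x` of the unit sphere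
`Sⁿ ⊆ ℝ^{n+1}`. -/
def lightVec {n : ℕ} (x : EuclideanSpace ℝ (Fin (n + 1))) : Mink n :=
  Fin.cons 1 fun i => ((x i : ℝ) : ℂ)

/-! ### Conformal immersions and their Möbius invariants -/

/-- `f : Ω → Sⁿ` is a smooth conformal immersion of the coordinate domain `Ω`:
the lift `F = (1, f)` satisfies `⟨F_z, F_z⟩ = 0` and `⟨F_z, F_{z̄}⟩ > 0`. -/
structure IsConformalImmersion {n : ℕ} (Ω : Set ℂ)
    (f : ℂ → EuclideanSpace ℝ (Fin (n + 1))) : Prop where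
  smooth : ContDiffOn ℝ ∞ f Ω
  norm_eq_one : ∀ z ∈ Ω, ‖f z‖ = 1
  conformal : ∀ z ∈ Ω,
    mink (dz (fun w => lightVec (f w)) z) (dz (fun w => lightVec (f w)) z) = 0
  immersion : ∀ z ∈ Ω,
    0 < (mink (dz (fun w => lightVec (f w)) z) (dzbar (fun w => lightVec (f w)) z)).re

section Invariants

variable {n : ℕ} (f : ℂ → EuclideanSpace ℝ (Fin (n + 1)))

/-- The canonical lift `Y` of `f`: the multiple of `F = (1, f)` by the positive real factor
that makes `⟨Y_z, Y_{z̄}⟩ = 1/2`, that is `|dY|² = |dz|²`. -/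
def lift (z : ℂ) : Mink n :=
  (((Real.sqrt (2 * (mink (dz (fun w => lightVec (f w)) z)
    (dzbar (fun w => lightVec (f w)) z)).re))⁻¹ : ℝ) : ℂ) • lightVec (f z)

/-- The light-like section `N` of the span of `Y, Y_z, Y_{z̄}, Y_{z z̄}` with
`⟨N, Y⟩ = -1` and `⟨N, Y_z⟩ = ⟨N, Y_{z̄}⟩ = 0`, which is
`N = 2 Y_{z z̄} + 2 ⟨Y_{z z̄}, Y_{z z̄}⟩ Y`. -/
def frameN (z : ℂ) : Mink n :=
  (2 : ℂ) • dzbar (dz (lift f)) z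
    + (2 * mink (dzbar (dz (lift f)) z) (dzbar (dz (lift f)) z)) • lift f z

/-- The Schwarzian `s`. In `Y_{zz} + (s/2) Y = κ` the right-hand side is orthogonal to `N`, and
`⟨Y, N⟩ = -1`, so that `s = 2 ⟨Y_{zz}, N⟩`. -/
def schwarzian (z : ℂ) : ℂ :=
  2 * mink (dz (dz (lift f)) z) (frameN f z)

/-- The Hopf differential `κ = Y_{zz} + (s/2) Y`. -/
def hopf (z : ℂ) : Mink n :=
  dz (dz (lift f)) z + (schwarzian f z / 2) • lift f z

/-- The orthogonal projection of `x` to `V_ℂ^⊥` at the point `z`, where `V_ℂ` is spanned by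
`Y, Y_z, Y_{z̄}, N`, whose only non-zero products are `⟨Y_z, Y_{z̄}⟩ = 1/2` and
`⟨Y, N⟩ = -1`. -/
def normalProj (z : ℂ) (x : Mink n) : Mink n :=
  x + mink x (frameN f z) • lift f z + mink x (lift f z) • frameN f z
    - (2 * mink x (dzbar (lift f) z)) • dz (lift f) z
    - (2 * mink x (dz (lift f) z)) • dzbar (lift f) z

/-- `D_{z̄} κ`, where `D` is the normal connection. -/
def dbarHopf (z : ℂ) : Mink n :=
  normalProj f z (dzbar (hopf f) z)

/-- `η = D_{z̄} κ + (μ̄/2) κ` for the value `m` of `μ` at the point `z`. -/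
def eta (m : ℂ) (z : ℂ) : Mink n :=
  dbarHopf f z + (conj m / 2) • hopf f z

/-- `⟨κ, D_{z̄} κ⟩² - ⟨κ, κ⟩ ⟨D_{z̄} κ, D_{z̄} κ⟩`, the discriminant of `⟨η, η⟩` as a quadratic
polynomial in `μ̄`. -/
def discr (z : ℂ) : ℂ :=
  mink (hopf f z) (dbarHopf f z) ^ 2
    - mink (hopf f z) (hopf f z) * mink (dbarHopf f z) (dbarHopf f z)

/-- The vector `(1/2) |μ|² Y + μ̄ Y_z + μ Y_{z̄} + N`, for the value `m` of `μ` at `z`. -/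
def adjointVec (m : ℂ) (z : ℂ) : Mink n :=
  (((‖m‖ ^ 2 / 2 : ℝ)) : ℂ) • lift f z + conj m • dz (lift f) z
    + m • dzbar (lift f) z + frameN f z

/-- `μ` is a smooth solution on `U` of the co-touching equation `μ_z - μ²/2 - s = 0` and of the
conformality equation `⟨η, η⟩ = 0`, and `g : U → Sⁿ` is the map that is represented by
`(1/2) |μ|² Y + μ̄ Y_z + μ Y_{z̄} + N`, that is, the adjoint transform of `f` given by `μ`. -/
structure IsAdjointTransform (U : Set ℂ) (μ : ℂ → ℂ)
    (g : ℂ → EuclideanSpace ℝ (Fin (n + 1))) : Prop where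
  smooth : ContDiffOn ℝ ∞ μ U
  cotouching : ∀ z ∈ U, dz μ z - μ z ^ 2 / 2 - schwarzian f z = 0
  conformality : ∀ z ∈ U, mink (eta f (μ z) z) (eta f (μ z) z) = 0
  norm_eq_one : ∀ z ∈ U, ‖g z‖ = 1
  represents : ∀ z ∈ U, ∃ c : ℝ, c ≠ 0 ∧ adjointVec f (μ z) z = (c : ℂ) • lightVec (g z)

end Invariants

/-! ### The Willmore functional and Willmore surfaces -/

section Functional

variable {n : ℕ} (f : ℂ → EuclideanSpace ℝ (Fin (n + 1)))

/-- `f_u`, where `z = u + i v`. -/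
def du (z : ℂ) : EuclideanSpace ℝ (Fin (n + 1)) := fderiv ℝ f z 1

/-- `f_v`, where `z = u + i v`. -/
def dv (z : ℂ) : EuclideanSpace ℝ (Fin (n + 1)) := fderiv ℝ f z Complex.I

/-- The coefficient `⟨f_u, f_u⟩` of the first fundamental form. -/
def gE (z : ℂ) : ℝ := inner ℝ (du f z) (du f z)

/-- The coefficient `⟨f_u, f_v⟩` of the first fundamental form. -/
def gF (z : ℂ) : ℝ := inner ℝ (du f z) (dv f z)

/-- The coefficient `⟨f_v, f_v⟩` of the first fundamental form. -/
def gG (z : ℂ) : ℝ := inner ℝ (dv f z) (dv f z)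

/-- The determinant of the first fundamental form. -/
def gDet (z : ℂ) : ℝ := gE f z * gG f z - gF f z ^ 2

/-- The component of `x` orthogonal to `f`, `f_u` and `f_v`, that is, in the normal space in `Sⁿ`
of the immersion `f : Ω → Sⁿ` (not necessarily conformal). -/
def normalPart (z : ℂ) (x : EuclideanSpace ℝ (Fin (n + 1))) : EuclideanSpace ℝ (Fin (n + 1)) :=
  x - (inner ℝ x (f z) : ℝ) • f z
    - ((gG f z * inner ℝ x (du f z) - gF f z * inner ℝ x (dv f z)) / gDet f z) • du f z
    - ((gE f z * inner ℝ x (dv f z) - gF f z * inner ℝ x (du f z)) / gDet f z) • dv f z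

/-- The value `II(∂_u, ∂_u)` of the second fundamental form of `f` in `Sⁿ`. -/
def secUU (z : ℂ) : EuclideanSpace ℝ (Fin (n + 1)) := normalPart f z (du (du f) z)

/-- The value `II(∂_u, ∂_v)` of the second fundamental form of `f` in `Sⁿ`. -/
def secUV (z : ℂ) : EuclideanSpace ℝ (Fin (n + 1)) := normalPart f z (du (dv f) z)

/-- The value `II(∂_v, ∂_v)` of the second fundamental form of `f` in `Sⁿ`. -/
def secVV (z : ℂ) : EuclideanSpace ℝ (Fin (n + 1)) := normalPart f z (dv (dv f) z)

/-- The mean curvature vector of `f` in `Sⁿ`. -/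
def meanCurv (z : ℂ) : EuclideanSpace ℝ (Fin (n + 1)) :=
  (1 / (2 * gDet f z)) •
    (gG f z • secUU f z - (2 * gF f z) • secUV f z + gE f z • secVV f z)

/-- The extrinsic curvature `(⟨II(∂_u, ∂_u), II(∂_v, ∂_v)⟩ - |II(∂_u, ∂_v)|²) / det`, which is
`K - 1` for the Gauss curvature `K` of the metric induced from `Sⁿ`. -/
def extCurv (z : ℂ) : ℝ :=
  (inner ℝ (secUU f z) (secVV f z) - inner ℝ (secUV f z) (secUV f z)) / gDet f z

/-- The density with respect to `du dv` of the area form of the Möbius metric of an immersion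
`f : Ω → Sⁿ`, in an arbitrary (not necessarily conformal) coordinate: one quarter of
`(|H|² - K_ext) dA`. In a conformal coordinate it is `⟨κ, κ̄⟩ du dv`. -/
def willmoreDensity (z : ℂ) : ℝ :=
  (‖meanCurv f z‖ ^ 2 - extCurv f z) * Real.sqrt (gDet f z) / 4

/-- The Willmore functional: the area of `K` in the Möbius metric of `f`. -/
def willmoreFunctional (K : Set ℂ) : ℝ := ∫ z in K, willmoreDensity f z

end Functional

/-- `F` is a smooth variation, through maps `F t : Ω → Sⁿ` with `|t| < ε`, of `f : Ω → Sⁿ`,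
supported in the compact set `K ⊆ Ω`. -/
structure IsVariation {n : ℕ} (Ω : Set ℂ) (f : ℂ → EuclideanSpace ℝ (Fin (n + 1)))
    (ε : ℝ) (K : Set ℂ) (F : ℝ → ℂ → EuclideanSpace ℝ (Fin (n + 1))) : Prop where
  eps_pos : 0 < ε
  compact : IsCompact K
  subset : K ⊆ Ω
  smooth : ContDiffOn ℝ ∞ (fun q : ℝ × ℂ => F q.1 q.2) (Set.Ioo (-ε) ε ×ˢ Ω)
  norm_eq_one : ∀ t ∈ Set.Ioo (-ε) ε, ∀ z ∈ Ω, ‖F t z‖ = 1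
  initial : ∀ z ∈ Ω, F 0 z = f z
  support : ∀ t ∈ Set.Ioo (-ε) ε, ∀ z ∈ Ω \ K, F t z = f z

/-- A Willmore surface: a conformal immersion that is a critical point of the Willmore
functional with respect to all compactly supported variations (through maps that need not be
conformal in the coordinate `z`). -/
structure IsWillmore {n : ℕ} (Ω : Set ℂ) (f : ℂ → EuclideanSpace ℝ (Fin (n + 1))) : Prop where
  immersion : IsConformalImmersion Ω f
  critical : ∀ (ε : ℝ) (K : Set ℂ) (F : ℝ → ℂ → EuclideanSpace ℝ (Fin (n + 1))),
    IsVariation Ω f ε K F → HasDerivAt (fun t => willmoreFunctional (F t) K) 0 0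

end

end WillmoreAdjoint

/-! Write a = ⟨κ, κ⟩, b = ⟨κ, D_z̄ κ⟩, c = ⟨D_z̄ κ, D_z̄ κ⟩. For a Willmore surface D_z̄ D_z̄ κ +
(s̄/2) κ = 0 (`IsWillmore.mink_willmoreVec`), so these functions satisfy a closed linear system:
a_z̄ = 2b, b_z̄ = c - (s̄/2) a, c_z̄ = -s̄ b. The discriminant Δ = b² - ac is an invariant of this
system, hence holomorphic (`dzbar_discr`).

Conformality reads P = c + μ̄ b + (μ̄²/4) a = 0. Let w = b + (μ̄/2) a and let e = μ̄_z̄ - μ̄²/2 -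
s̄, the conjugate of the co-touching expression. The system gives P_z̄ = w e + μ̄ P and w_z̄ = P +
(a/2) e. If P vanishes identically and e ≠ 0 at a point, then w = 0 nearby, hence a e = 0 there,
which is impossible where a ≠ 0 (`cotouching_of_conformality`). Since w² = Δ + a P, smooth roots of
the conformality equation come from smooth square roots of Δ, and these exist locally unless Δ has a
zero of odd order (`exists_sq_eq_of_not_odd`). If a vanishes identically, so do b and c, and only
the Riccati equation is left. The substitution μ = -2ψ/φ linearises it to φ_z = ψ, ψ_z = -(s/2) φ,
which is solved on a small disc by a Neumann series built from the Cauchy kernel of ∂_z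
(`exists_dz_eq_clm`, `exists_riccati`). Density follows because near every point either a vanishes
identically, or there are points with a ≠ 0 where Δ is non-zero or locally zero.

The Euler-Lagrange equation is derived from criticality with the variations represented by Y + tψ +
(t²/2)⟨ψ, ψ⟩N, where ψ is a real normal field of compact support. The Möbius density can be computed
from any light-like lift (`willmoreDensity_eq`), and its derivative at t = 0 is 2 Re(⟨κ, ψ_z̄z̄⟩ +
(s̄/2)⟨κ, ψ⟩) (`hasDerivAt_quadDensity`). Two integrations by parts turn this into 2 Re⟨W, ψ⟩ with W
= κ_z̄z̄ + (s̄/2) κ. The Codazzi equation says that the normal part of W is real, so a cutoff times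
this normal part is an admissible ψ. Its square then vanishes, and a real null normal vector is zero
(`IsNormal.eq_zero`). -/

open scoped ContDiff ComplexConjugate

namespace WillmoreAdjoint

noncomputable section

/-! ### Wirtinger calculus -/

section Wirtinger

variable {E F G : Type*} [NormedAddCommGroup E] [NormedSpace ℂ E] [NormedAddCommGroup F]
  [NormedSpace ℂ F] [NormedAddCommGroup G] [NormedSpace ℂ G]

/-- The operator `(∂_u + c ∂_v) / 2`, which is `∂_z` for `c = -i` and `∂_{z̄}` for `c = i`. -/
def wirt (c : ℂ) (f : ℂ → E) (z : ℂ) : E :=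
  (1 / 2 : ℂ) • (fderiv ℝ f z 1 + c • fderiv ℝ f z Complex.I)

theorem dz_eq_wirt : (dz : (ℂ → E) → ℂ → E) = wirt (-Complex.I) := by
  funext f z
  simp [dz, wirt, sub_eq_add_neg]

theorem fderiv_one_eq (f : ℂ → E) (z : ℂ) : fderiv ℝ f z 1 = dz f z + dzbar f z := by
  simp only [dz, dzbar]
  module

theorem fderiv_I_eq (f : ℂ → E) (z : ℂ) :
    fderiv ℝ f z Complex.I = Complex.I • (dz f z - dzbar f z) := by
  simp only [dz, dzbar]
  have : Complex.I • ((1 / 2 : ℂ) • (fderiv ℝ f z 1 - Complex.I • fderiv ℝ f z Complex.I)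
      - (1 / 2 : ℂ) • (fderiv ℝ f z 1 + Complex.I • fderiv ℝ f z Complex.I))
      = (-(Complex.I * Complex.I)) • fderiv ℝ f z Complex.I := by module
  rw [this]
  simp

variable {Ω : Set ℂ}

theorem ContDiffOn.wirt {f : ℂ → E} (hΩ : IsOpen Ω) (hf : ContDiffOn ℝ ∞ f Ω) (c : ℂ) :
    ContDiffOn ℝ ∞ (wirt c f) Ω := by
  have h : ContDiffOn ℝ ∞ (fun z => fderiv ℝ f z) Ω :=
    hf.fderiv_of_isOpen hΩ (by norm_num)
  have h1 : ∀ v : ℂ, ContDiffOn ℝ ∞ (fun z => fderiv ℝ f z v) Ω := fun v =>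
    h.clm_apply contDiffOn_const
  exact ((h1 1).add ((h1 Complex.I).const_smul c)).const_smul (1 / 2 : ℂ)

theorem contDiffOn_dz {f : ℂ → E} (hΩ : IsOpen Ω) (hf : ContDiffOn ℝ ∞ f Ω) :
    ContDiffOn ℝ ∞ (dz f) Ω := by
  rw [dz_eq_wirt]; exact ContDiffOn.wirt hΩ hf _

theorem contDiffOn_dzbar {f : ℂ → E} (hΩ : IsOpen Ω) (hf : ContDiffOn ℝ ∞ f Ω) :
    ContDiffOn ℝ ∞ (dzbar f) Ω := ContDiffOn.wirt hΩ hf _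

theorem wirt_congr {f g : ℂ → E} (hΩ : IsOpen Ω) (h : ∀ z ∈ Ω, f z = g z) (c : ℂ) {z : ℂ}
    (hz : z ∈ Ω) : wirt c f z = wirt c g z := by
  have : f =ᶠ[nhds z] g := Filter.eventuallyEq_of_mem (hΩ.mem_nhds hz) h
  simp only [wirt, this.fderiv_eq]

theorem dz_congr {f g : ℂ → E} (hΩ : IsOpen Ω) (h : ∀ z ∈ Ω, f z = g z) {z : ℂ}
    (hz : z ∈ Ω) : dz f z = dz g z := by
  rw [dz_eq_wirt]; exact wirt_congr hΩ h _ hz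

theorem dzbar_congr {f g : ℂ → E} (hΩ : IsOpen Ω) (h : ∀ z ∈ Ω, f z = g z) {z : ℂ}
    (hz : z ∈ Ω) : dzbar f z = dzbar g z := wirt_congr hΩ h _ hz

theorem dz_const (x : E) (z : ℂ) : dz (fun _ => x) z = 0 := by simp [dz]

theorem dzbar_const (x : E) (z : ℂ) : dzbar (fun _ => x) z = 0 := by simp [dzbar]

theorem differentiableAt_of_contDiffOn {f : ℂ → E} (hΩ : IsOpen Ω) (hf : ContDiffOn ℝ ∞ f Ω)
    {z : ℂ} (hz : z ∈ Ω) : DifferentiableAt ℝ f z :=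
  (hf.contDiffAt (hΩ.mem_nhds hz)).differentiableAt (by simp)

theorem dz_add {f g : ℂ → E} {z : ℂ} (hf : DifferentiableAt ℝ f z)
    (hg : DifferentiableAt ℝ g z) : dz (fun w => f w + g w) z = dz f z + dz g z := by
  simp only [dz, fderiv_fun_add hf hg, add_apply]
  module

theorem dzbar_add {f g : ℂ → E} {z : ℂ} (hf : DifferentiableAt ℝ f z)
    (hg : DifferentiableAt ℝ g z) : dzbar (fun w => f w + g w) z = dzbar f z + dzbar g z := by
  simp only [dzbar, fderiv_fun_add hf hg, add_apply]
  module

theorem dzbar_sub {f g : ℂ → E} {z : ℂ} (hf : DifferentiableAt ℝ f z)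
    (hg : DifferentiableAt ℝ g z) : dzbar (fun w => f w - g w) z = dzbar f z - dzbar g z := by
  simp only [dzbar, fderiv_fun_sub hf hg, sub_apply]
  module

theorem fderiv_clm_bilin (B : E →L[ℂ] F →L[ℂ] G) {f : ℂ → E} {g : ℂ → F} {z : ℂ}
    (hf : DifferentiableAt ℝ f z) (hg : DifferentiableAt ℝ g z) (v : ℂ) :
    fderiv ℝ (fun w => B (f w) (g w)) z v
      = B (f z) (fderiv ℝ g z v) + B (fderiv ℝ f z v) (g z) := by
  have h := (B.bilinearRestrictScalars ℝ).hasFDerivAt_of_bilinear hf.hasFDerivAt hg.hasFDerivAt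
  have h2 := h.fderiv
  simp only [ContinuousLinearMap.bilinearRestrictScalars_apply_apply] at h2
  rw [h2]
  rfl

theorem wirt_bilin (c : ℂ) (B : E →L[ℂ] F →L[ℂ] G) {f : ℂ → E} {g : ℂ → F} {z : ℂ}
    (hf : DifferentiableAt ℝ f z) (hg : DifferentiableAt ℝ g z) :
    wirt c (fun w => B (f w) (g w)) z = B (wirt c f z) (g z) + B (f z) (wirt c g z) := by
  simp only [wirt, fderiv_clm_bilin B hf hg, map_add, map_smul, add_apply,
    smul_apply]
  module

theorem wirt_smul (c : ℂ) {f : ℂ → ℂ} {g : ℂ → F} {z : ℂ}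
    (hf : DifferentiableAt ℝ f z) (hg : DifferentiableAt ℝ g z) :
    wirt c (fun w => f w • g w) z = wirt c f z • g z + f z • wirt c g z :=
  wirt_bilin c (ContinuousLinearMap.lsmul ℂ ℂ) hf hg

theorem dz_smul {f : ℂ → ℂ} {g : ℂ → F} {z : ℂ}
    (hf : DifferentiableAt ℝ f z) (hg : DifferentiableAt ℝ g z) :
    dz (fun w => f w • g w) z = dz f z • g z + f z • dz g z := by
  simpa only [dz_eq_wirt] using wirt_smul _ hf hg

theorem dzbar_smul {f : ℂ → ℂ} {g : ℂ → F} {z : ℂ}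
    (hf : DifferentiableAt ℝ f z) (hg : DifferentiableAt ℝ g z) :
    dzbar (fun w => f w • g w) z = dzbar f z • g z + f z • dzbar g z := wirt_smul _ hf hg

theorem dz_mul {f g : ℂ → ℂ} {z : ℂ}
    (hf : DifferentiableAt ℝ f z) (hg : DifferentiableAt ℝ g z) :
    dz (fun w => f w * g w) z = dz f z * g z + f z * dz g z := dz_smul hf hg

theorem dzbar_mul {f g : ℂ → ℂ} {z : ℂ}
    (hf : DifferentiableAt ℝ f z) (hg : DifferentiableAt ℝ g z) :
    dzbar (fun w => f w * g w) z = dzbar f z * g z + f z * dzbar g z := dzbar_smul hf hg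

theorem dz_const_smul (a : ℂ) {g : ℂ → F} {z : ℂ} (hg : DifferentiableAt ℝ g z) :
    dz (fun w => a • g w) z = a • dz g z := by
  simpa [dz_const] using dz_smul (differentiableAt_const a) hg

theorem dzbar_const_smul (a : ℂ) {g : ℂ → F} {z : ℂ} (hg : DifferentiableAt ℝ g z) :
    dzbar (fun w => a • g w) z = a • dzbar g z := by
  simpa [dzbar_const] using dzbar_smul (differentiableAt_const a) hg

theorem fderiv_fderiv_apply {f : ℂ → E} {z : ℂ} (hf : ContDiffAt ℝ 2 f z) (v w : ℂ) :
    fderiv ℝ (fun x => fderiv ℝ f x v) z w = fderiv ℝ (fderiv ℝ f) z w v := by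
  have h : DifferentiableAt ℝ (fderiv ℝ f) z :=
    (hf.fderiv_right (m := 1) (by norm_num)).differentiableAt (by norm_num)
  rw [fderiv_clm_apply h (differentiableAt_const v)]
  simp

theorem fderiv_wirt {f : ℂ → E} {z : ℂ} (hf : ContDiffAt ℝ 2 f z) (c v : ℂ) :
    fderiv ℝ (wirt c f) z v = (1 / 2 : ℂ) • (fderiv ℝ (fderiv ℝ f) z v 1
      + c • fderiv ℝ (fderiv ℝ f) z v Complex.I) := by
  have h : DifferentiableAt ℝ (fderiv ℝ f) z :=
    (hf.fderiv_right (m := 1) (by norm_num)).differentiableAt (by norm_num)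
  have h1 : ∀ v : ℂ, DifferentiableAt ℝ (fun x => fderiv ℝ f x v) z := fun v =>
    h.clm_apply (differentiableAt_const v)
  have : wirt c f = fun x => (1 / 2 : ℂ) • (fderiv ℝ f x 1 + c • fderiv ℝ f x Complex.I) := rfl
  have h2 : DifferentiableAt ℝ (fun x => c • fderiv ℝ f x Complex.I) z :=
    (h1 Complex.I).const_smul c
  have h3 : DifferentiableAt ℝ (fun x => fderiv ℝ f x 1 + c • fderiv ℝ f x Complex.I) z :=
    (h1 1).add h2
  rw [this, fderiv_fun_const_smul h3, smul_apply, fderiv_fun_add (h1 1) h2,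
    add_apply, fderiv_fun_const_smul (h1 Complex.I),
    smul_apply, fderiv_fderiv_apply hf, fderiv_fderiv_apply hf]

theorem wirt_comm {f : ℂ → E} {z : ℂ} (hf : ContDiffAt ℝ 2 f z) (c d : ℂ) :
    wirt c (wirt d f) z = wirt d (wirt c f) z := by
  have hs : fderiv ℝ (fderiv ℝ f) z Complex.I 1 = fderiv ℝ (fderiv ℝ f) z 1 Complex.I :=
    (hf.isSymmSndFDerivAt (by simp)) _ _
  rw [wirt, wirt, fderiv_wirt hf, fderiv_wirt hf, fderiv_wirt hf, fderiv_wirt hf, hs]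
  module

theorem dz_dzbar_comm {f : ℂ → E} (hΩ : IsOpen Ω) (hf : ContDiffOn ℝ ∞ f Ω) {z : ℂ}
    (hz : z ∈ Ω) : dz (dzbar f) z = dzbar (dz f) z := by
  rw [dz_eq_wirt]
  exact wirt_comm ((hf.contDiffAt (hΩ.mem_nhds hz)).of_le (by norm_cast)) _ _

/-- `∂_{z̄} f = 0` is complex differentiability. -/
theorem differentiableAt_complex_of_dzbar_eq_zero {f : ℂ → E} {z : ℂ}
    (hf : DifferentiableAt ℝ f z) (h : dzbar f z = 0) : DifferentiableAt ℂ f z := by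
  rw [differentiableAt_complex_iff_differentiableAt_real]
  refine ⟨hf, ?_⟩
  have h1 : fderiv ℝ f z 1 + Complex.I • fderiv ℝ f z Complex.I = 0 := by
    rw [dzbar] at h
    exact (smul_eq_zero.1 h).resolve_left (by norm_num)
  have h2 : Complex.I • (fderiv ℝ f z 1 + Complex.I • fderiv ℝ f z Complex.I) = 0 := by
    rw [h1, smul_zero]
  rw [smul_add, smul_smul, Complex.I_mul_I] at h2
  rw [eq_comm, ← sub_eq_zero]
  rw [← h2]
  module

theorem fderiv_conj (f : ℂ → ℂ) (z v : ℂ) :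
    fderiv ℝ (fun w => conj (f w)) z v = conj (fderiv ℝ f z v) := by
  have h2 := congrArg (fun L => L v) ((Complex.conjCLE).comp_fderiv (f := f) (x := z))
  exact h2

@[simp] theorem conj_two : (starRingEnd ℂ) 2 = 2 := Complex.conj_ofNat 2

theorem dzbar_conj (f : ℂ → ℂ) (z : ℂ) : dzbar (fun w => conj (f w)) z = conj (dz f z) := by
  simp [dz, dzbar, fderiv_conj]

end Wirtinger

/-! ### The Minkowski form -/

section Minkowski

variable {n : ℕ}

@[simp] theorem mink_add_left (x y w : Mink n) : mink (x + y) w = mink x w + mink y w := by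
  simp only [mink, Pi.add_apply, add_mul, Finset.sum_add_distrib]
  ring

@[simp] theorem mink_smul_left (a : ℂ) (x w : Mink n) : mink (a • x) w = a * mink x w := by
  simp only [mink, Pi.smul_apply, smul_eq_mul, mul_add, Finset.mul_sum, mul_assoc]
  ring

theorem mink_comm (x y : Mink n) : mink x y = mink y x := by
  simp only [mink, mul_comm]

@[simp] theorem mink_add_right (x y w : Mink n) : mink w (x + y) = mink w x + mink w y := by
  rw [mink_comm, mink_add_left, mink_comm x, mink_comm y]

@[simp] theorem mink_smul_right (a : ℂ) (x w : Mink n) : mink w (a • x) = a * mink w x := by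
  rw [mink_comm, mink_smul_left, mink_comm x]

@[simp] theorem mink_sub_left (x y w : Mink n) : mink (x - y) w = mink x w - mink y w := by
  rw [sub_eq_add_neg, ← neg_one_smul ℂ y, mink_add_left, mink_smul_left]; ring

@[simp] theorem mink_sub_right (x y w : Mink n) : mink w (x - y) = mink w x - mink w y := by
  rw [mink_comm, mink_sub_left, mink_comm x, mink_comm y]

@[simp] theorem mink_zero_left (w : Mink n) : mink 0 w = 0 := by simp [mink]

@[simp] theorem mink_zero_right (w : Mink n) : mink w 0 = 0 := by simp [mink]

/-- The Minkowski form as a continuous bilinear map. -/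
def minkL (n : ℕ) : Mink n →L[ℂ] Mink n →L[ℂ] ℂ :=
  LinearMap.toContinuousLinearMap
    ((LinearMap.toContinuousLinearMap : (Mink n →ₗ[ℂ] ℂ) ≃ₗ[ℂ] _).toLinearMap.comp
      (LinearMap.mk₂ ℂ mink mink_add_left (by simp) (by simp) (by simp)))

theorem minkL_apply (x y : Mink n) : minkL n x y = mink x y := rfl

theorem dz_mink {f g : ℂ → Mink n} {z : ℂ}
    (hf : DifferentiableAt ℝ f z) (hg : DifferentiableAt ℝ g z) :
    dz (fun w => mink (f w) (g w)) z = mink (dz f z) (g z) + mink (f z) (dz g z) := by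
  simpa only [dz_eq_wirt, minkL_apply] using wirt_bilin (-Complex.I) (minkL n) hf hg

theorem dzbar_mink {f g : ℂ → Mink n} {z : ℂ}
    (hf : DifferentiableAt ℝ f z) (hg : DifferentiableAt ℝ g z) :
    dzbar (fun w => mink (f w) (g w)) z = mink (dzbar f z) (g z) + mink (f z) (dzbar g z) :=
  wirt_bilin Complex.I (minkL n) hf hg

theorem contDiffOn_mink {X : Type*} [NormedAddCommGroup X] [NormedSpace ℝ X] {Ω : Set X}
    {f g : X → Mink n} (hf : ContDiffOn ℝ ∞ f Ω)
    (hg : ContDiffOn ℝ ∞ g Ω) : ContDiffOn ℝ ∞ (fun w => mink (f w) (g w)) Ω :=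
  ((minkL n).bilinearRestrictScalars ℝ).isBoundedBilinearMap.contDiff.comp_contDiffOn
    (hf.prodMk hg)

/-- Complex conjugation on `ℂ^{n+2}`. -/
def cconj (x : Mink n) : Mink n := fun i => conj (x i)

@[simp] theorem cconj_add (x y : Mink n) : cconj (x + y) = cconj x + cconj y := by
  ext i; simp [cconj]

@[simp] theorem cconj_sub (x y : Mink n) : cconj (x - y) = cconj x - cconj y := by
  ext i; simp [cconj]

@[simp] theorem cconj_smul (a : ℂ) (x : Mink n) : cconj (a • x) = conj a • cconj x := by
  ext i; simp [cconj]

@[simp] theorem cconj_cconj (x : Mink n) : cconj (cconj x) = x := by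
  ext i; simp [cconj]

theorem mink_cconj (x y : Mink n) : mink (cconj x) (cconj y) = conj (mink x y) := by
  simp [mink, cconj]

theorem fderiv_cconj {f : ℂ → Mink n} {z : ℂ} (hf : DifferentiableAt ℝ f z) (v : ℂ) :
    fderiv ℝ (fun w => cconj (f w)) z v = cconj (fderiv ℝ f z v) := by
  have h1 : ∀ i, DifferentiableAt ℝ (fun w => f w i) z := differentiableAt_pi.1 hf
  have h2 : ∀ i, DifferentiableAt ℝ (fun w => conj (f w i)) z := fun i =>
    Complex.conjCLE.differentiableAt.comp z (h1 i)
  ext i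
  have e1 : fderiv ℝ (fun w => cconj (f w)) z v i = fderiv ℝ (fun w => conj (f w i)) z v := by
    have : (fun w => cconj (f w)) = fun w i => conj (f w i) := rfl
    rw [this, fderiv_pi (φ := fun i w => conj (f w i)) h2]; rfl
  have e2 : fderiv ℝ f z v i = fderiv ℝ (fun w => f w i) z v := by
    rw [fderiv_pi (φ := fun i w => f w i) h1]; rfl
  rw [e1, fderiv_conj, ← e2]
  rfl

theorem dzbar_cconj {f : ℂ → Mink n} {z : ℂ} (hf : DifferentiableAt ℝ f z) :
    dzbar (fun w => cconj (f w)) z = cconj (dz f z) := by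
  simp [dz, dzbar, fderiv_cconj hf]

theorem dz_cconj {f : ℂ → Mink n} {z : ℂ} (hf : DifferentiableAt ℝ f z) :
    dz (fun w => cconj (f w)) z = cconj (dzbar f z) := by
  simp [dz, dzbar, fderiv_cconj hf, sub_eq_add_neg]

theorem contDiffOn_cconj {Ω : Set ℂ} {f : ℂ → Mink n} (hf : ContDiffOn ℝ ∞ f Ω) :
    ContDiffOn ℝ ∞ (fun w => cconj (f w)) Ω :=
  contDiffOn_pi.2 fun i => Complex.conjCLE.contDiff.comp_contDiffOn (contDiffOn_pi.1 hf i)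

end Minkowski

/-! ### The canonical lift -/

section Frame

variable {n : ℕ} {f : ℂ → EuclideanSpace ℝ (Fin (n + 1))} {Ω : Set ℂ} {z : ℂ}

theorem cconj_lightVec (x : EuclideanSpace ℝ (Fin (n + 1))) :
    cconj (lightVec x) = lightVec x := by
  ext i
  refine Fin.cases ?_ (fun j => ?_) i <;> simp [cconj, lightVec]

theorem mink_lightVec_self {x : EuclideanSpace ℝ (Fin (n + 1))} (hx : ‖x‖ = 1) :
    mink (lightVec x) (lightVec x) = 0 := by
  have h : ∑ i, x i * x i = 1 := by
    have h2 := EuclideanSpace.real_norm_sq_eq x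
    rw [hx] at h2
    simpa [sq] using h2.symm
  have h3 : ∑ i, (x i : ℂ) * (x i : ℂ) = 1 := by exact_mod_cast h
  simp [mink, lightVec, h3]

theorem contDiffOn_lightVec {X : Type*} [NormedAddCommGroup X] [NormedSpace ℝ X] {s : Set X}
    {g : X → EuclideanSpace ℝ (Fin (n + 1))}
    (hg : ContDiffOn ℝ ∞ g s) : ContDiffOn ℝ ∞ (fun w => lightVec (g w)) s := by
  refine contDiffOn_pi.2 fun i => ?_
  refine Fin.cases ?_ (fun j => ?_) i
  · exact contDiffOn_const
  · have h1 : ContDiffOn ℝ ∞ (fun w => g w j) s :=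
      (EuclideanSpace.proj (𝕜 := ℝ) j).contDiff.comp_contDiffOn hg
    exact Complex.ofRealCLM.contDiff.comp_contDiffOn h1

theorem contDiffOn_fun_smul {a : ℂ → ℂ} {g : ℂ → Mink n} (ha : ContDiffOn ℝ ∞ a Ω)
    (hg : ContDiffOn ℝ ∞ g Ω) : ContDiffOn ℝ ∞ (fun w => a w • g w) Ω := ha.smul hg

theorem contDiffOn_fun_add {g h : ℂ → Mink n} (hg : ContDiffOn ℝ ∞ g Ω)
    (hh : ContDiffOn ℝ ∞ h Ω) : ContDiffOn ℝ ∞ (fun w => g w + h w) Ω := hg.add hh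

/-- Leibniz rule for a constant product. Most products of the moving frame are found by
differentiating an earlier one in this way. -/
theorem mink_dz_add_eq_zero (hΩ : IsOpen Ω) {A B : ℂ → Mink n} (hA : ContDiffOn ℝ ∞ A Ω)
    (hB : ContDiffOn ℝ ∞ B Ω) (c : ℂ) (h : ∀ w ∈ Ω, mink (A w) (B w) = c) (hz : z ∈ Ω) :
    mink (dz A z) (B z) + mink (A z) (dz B z) = 0 := by
  rw [← dz_mink (differentiableAt_of_contDiffOn hΩ hA hz) (differentiableAt_of_contDiffOn hΩ hB hz),
    dz_congr hΩ h hz, dz_const]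

theorem mink_dzbar_add_eq_zero (hΩ : IsOpen Ω) {A B : ℂ → Mink n} (hA : ContDiffOn ℝ ∞ A Ω)
    (hB : ContDiffOn ℝ ∞ B Ω) (c : ℂ) (h : ∀ w ∈ Ω, mink (A w) (B w) = c) (hz : z ∈ Ω) :
    mink (dzbar A z) (B z) + mink (A z) (dzbar B z) = 0 := by
  rw [← dzbar_mink (differentiableAt_of_contDiffOn hΩ hA hz)
    (differentiableAt_of_contDiffOn hΩ hB hz), dzbar_congr hΩ h hz, dzbar_const]

/-- The square of the factor of `(1, f)` to the canonical lift, inverted. -/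
def confFactor (f : ℂ → EuclideanSpace ℝ (Fin (n + 1))) (z : ℂ) : ℝ :=
  2 * (mink (dz (fun w => lightVec (f w)) z) (dzbar (fun w => lightVec (f w)) z)).re

theorem cconj_dz_lightVec (hΩ : IsOpen Ω) (hf : ContDiffOn ℝ ∞ f Ω) (hz : z ∈ Ω) :
    cconj (dz (fun w => lightVec (f w)) z) = dzbar (fun w => lightVec (f w)) z := by
  rw [← dzbar_cconj (differentiableAt_of_contDiffOn hΩ (contDiffOn_lightVec hf) hz)]
  simp only [cconj_lightVec]

/-- The product is real because F_z̄ is the conjugate of F_z, so taking the real part in the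
normalising factor loses nothing. -/
theorem two_mul_mink_dz_dzbar_lightVec (hΩ : IsOpen Ω) (hf : IsConformalImmersion Ω f)
    (hz : z ∈ Ω) :
    2 * mink (dz (fun w => lightVec (f w)) z) (dzbar (fun w => lightVec (f w)) z)
      = (confFactor f z : ℂ) := by
  have h : conj (mink (dz (fun w => lightVec (f w)) z) (dzbar (fun w => lightVec (f w)) z))
      = mink (dz (fun w => lightVec (f w)) z) (dzbar (fun w => lightVec (f w)) z) := by
    have h1 := cconj_dz_lightVec hΩ hf.smooth hz
    rw [← mink_cconj, ← h1, cconj_cconj, mink_comm]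
  rw [confFactor]
  push_cast
  rw [Complex.conj_eq_iff_re.1 h]

theorem contDiffOn_confFactor (hΩ : IsOpen Ω) (hf : IsConformalImmersion Ω f) :
    ContDiffOn ℝ ∞ (confFactor f) Ω := by
  have hF := contDiffOn_lightVec hf.smooth
  have h := contDiffOn_mink (contDiffOn_dz hΩ hF) (contDiffOn_dzbar hΩ hF)
  exact contDiffOn_const.mul (Complex.reCLM.contDiff.comp_contDiffOn h)

theorem confFactor_pos (hf : IsConformalImmersion Ω f) (hz : z ∈ Ω) : 0 < confFactor f z :=
  mul_pos two_pos (hf.immersion z hz)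

/-- The factor of `(1, f)` to the canonical lift. -/
def liftFactor (f : ℂ → EuclideanSpace ℝ (Fin (n + 1))) (z : ℂ) : ℝ :=
  (Real.sqrt (confFactor f z))⁻¹

theorem lift_eq (f : ℂ → EuclideanSpace ℝ (Fin (n + 1))) (z : ℂ) :
    lift f z = (liftFactor f z : ℂ) • lightVec (f z) := rfl

theorem liftFactor_pos (hf : IsConformalImmersion Ω f) (hz : z ∈ Ω) : 0 < liftFactor f z :=
  inv_pos.2 (Real.sqrt_pos.2 (confFactor_pos hf hz))

theorem contDiffOn_liftFactor (hΩ : IsOpen Ω) (hf : IsConformalImmersion Ω f) :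
    ContDiffOn ℝ ∞ (liftFactor f) Ω :=
  ((contDiffOn_confFactor hΩ hf).sqrt fun _ hz => (confFactor_pos hf hz).ne').inv
    fun _ hz => (Real.sqrt_pos.2 (confFactor_pos hf hz)).ne'

theorem contDiffOn_lift (hΩ : IsOpen Ω) (hf : IsConformalImmersion Ω f) :
    ContDiffOn ℝ ∞ (lift f) Ω :=
  (Complex.ofRealCLM.contDiff.comp_contDiffOn (contDiffOn_liftFactor hΩ hf)).smul
    (contDiffOn_lightVec hf.smooth)

theorem cconj_lift (f : ℂ → EuclideanSpace ℝ (Fin (n + 1))) (z : ℂ) :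
    cconj (lift f z) = lift f z := by
  rw [lift_eq, cconj_smul, cconj_lightVec, Complex.conj_ofReal]

theorem mink_lift_lift (hf : IsConformalImmersion Ω f) (hz : z ∈ Ω) :
    mink (lift f z) (lift f z) = 0 := by
  rw [lift_eq, mink_smul_left, mink_smul_right, mink_lightVec_self (hf.norm_eq_one z hz)]
  ring

/-- F = (1, f) is null and orthogonal to F_z and F_z̄, so the terms from differentiating the factor
drop out and products only scale by its square. -/
theorem wirt_lift_products (hΩ : IsOpen Ω) (hf : IsConformalImmersion Ω f) (hz : z ∈ Ω) :
    mink (dz (lift f) z) (dz (lift f) z) = 0 ∧ mink (dz (lift f) z) (dzbar (lift f) z) = 1 / 2 := by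
  have hF := contDiffOn_lightVec hf.smooth
  have hFd := differentiableAt_of_contDiffOn hΩ hF hz
  have hc : ContDiffOn ℝ ∞ (fun w => (liftFactor f w : ℂ)) Ω :=
    Complex.ofRealCLM.contDiff.comp_contDiffOn (contDiffOn_liftFactor hΩ hf)
  have hcd := differentiableAt_of_contDiffOn hΩ hc hz
  have h0 : mink (lightVec (f z)) (lightVec (f z)) = 0 := mink_lightVec_self (hf.norm_eq_one z hz)
  have hFF : ∀ w ∈ Ω, mink (lightVec (f w)) (lightVec (f w)) = 0 := fun w hw =>
    mink_lightVec_self (hf.norm_eq_one w hw)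
  have h1 := mink_dz_add_eq_zero hΩ hF hF 0 hFF hz
  have h2 := mink_dzbar_add_eq_zero hΩ hF hF 0 hFF hz
  rw [mink_comm (lightVec (f z))] at h1 h2
  have h1' : mink (dz (fun w => lightVec (f w)) z) (lightVec (f z)) = 0 := by
    linear_combination (1 / 2) * h1
  have h2' : mink (dzbar (fun w => lightVec (f w)) z) (lightVec (f z)) = 0 := by
    linear_combination (1 / 2) * h2
  have h1'' : mink (lightVec (f z)) (dz (fun w => lightVec (f w)) z) = 0 := by
    rw [mink_comm, h1']
  have h2'' : mink (lightVec (f z)) (dzbar (fun w => lightVec (f w)) z) = 0 := by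
    rw [mink_comm, h2']
  have e1 : dz (lift f) z = dz (fun w => (liftFactor f w : ℂ)) z • lightVec (f z)
      + (liftFactor f z : ℂ) • dz (fun w => lightVec (f w)) z := dz_smul hcd hFd
  have e2 : dzbar (lift f) z = dzbar (fun w => (liftFactor f w : ℂ)) z • lightVec (f z)
      + (liftFactor f z : ℂ) • dzbar (fun w => lightVec (f w)) z := dzbar_smul hcd hFd
  have e3 := two_mul_mink_dz_dzbar_lightVec hΩ hf hz
  have hpos := confFactor_pos hf hz
  have e4 : (liftFactor f z : ℂ) * (liftFactor f z : ℂ) * (confFactor f z : ℂ) = 1 := by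
    have : liftFactor f z * liftFactor f z * confFactor f z = 1 := by
      rw [liftFactor]
      have := Real.mul_self_sqrt hpos.le
      have h3 := (Real.sqrt_pos.2 hpos).ne'
      field_simp
      nlinarith
    exact_mod_cast this
  constructor
  · rw [e1]
    simp only [mink_add_left, mink_add_right, mink_smul_left, mink_smul_right, h0, h1', h1'',
      hf.conformal z hz]
    ring
  · rw [e1, e2]
    simp only [mink_add_left, mink_add_right, mink_smul_left, mink_smul_right, h0, h1', h2'']
    linear_combination (1 / 2 : ℂ) * e4
      + (1 / 2 : ℂ) * (liftFactor f z : ℂ) * (liftFactor f z : ℂ) * e3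

/-- The definition of N solved for Y_zz̄. It shows that vectors orthogonal to Y and N are orthogonal
to Y_zz̄. -/
theorem lapl_eq (z : ℂ) : dzbar (dz (lift f)) z = (1 / 2 : ℂ) • frameN f z
    - mink (dzbar (dz (lift f)) z) (dzbar (dz (lift f)) z) • lift f z := by
  rw [frameN]
  module

/-- `x` is orthogonal to `V_ℂ` at the point `z`. -/
structure IsNormal (f : ℂ → EuclideanSpace ℝ (Fin (n + 1))) (z : ℂ) (x : Mink n) : Prop where
  lift : mink x (lift f z) = 0
  dz : mink x (dz (WillmoreAdjoint.lift f) z) = 0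
  dzbar : mink x (dzbar (WillmoreAdjoint.lift f) z) = 0
  frameN : mink x (frameN f z) = 0

theorem IsNormal.lapl {x : Mink n} (hx : IsNormal f z x) :
    mink x (WillmoreAdjoint.dzbar (WillmoreAdjoint.dz (WillmoreAdjoint.lift f)) z) = 0 := by
  rw [lapl_eq]
  simp [hx.lift, hx.frameN]

theorem IsNormal.smul {x : Mink n} (hx : IsNormal f z x) (c : ℂ) : IsNormal f z (c • x) := by
  constructor <;> simp [hx.lift, hx.dz, hx.dzbar, hx.frameN]

/-- Allows D_z̄ to be replaced by ∂_z̄ in every product with a normal vector. -/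
theorem IsNormal.mink_normalProj {x : Mink n} (hx : IsNormal f z x) (y : Mink n) :
    mink (normalProj f z y) x = mink y x := by
  have h1 := hx.lift
  have h2 := hx.dz
  have h3 := hx.dzbar
  have h4 := hx.frameN
  rw [mink_comm] at h1 h2 h3 h4
  simp [normalProj, h1, h2, h3, h4]

/-! ### Products and reality of the moving frame Y, Y_z, Y_z̄, N and of κ. -/

section Products

variable (hΩ : IsOpen Ω) (hf : IsConformalImmersion Ω f)

include hΩ hf

theorem mink_dz_dz (hz : z ∈ Ω) : mink (dz (lift f) z) (dz (lift f) z) = 0 :=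
  (wirt_lift_products hΩ hf hz).1

theorem mink_dz_dzbar (hz : z ∈ Ω) : mink (dz (lift f) z) (dzbar (lift f) z) = 1 / 2 :=
  (wirt_lift_products hΩ hf hz).2

theorem mink_dzbar_dz (hz : z ∈ Ω) : mink (dzbar (lift f) z) (dz (lift f) z) = 1 / 2 := by
  rw [mink_comm, mink_dz_dzbar hΩ hf hz]

theorem cconj_dz_lift (hz : z ∈ Ω) : cconj (dz (lift f) z) = dzbar (lift f) z := by
  rw [← dzbar_cconj (differentiableAt_of_contDiffOn hΩ (contDiffOn_lift hΩ hf) hz)]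
  simp only [cconj_lift]

theorem cconj_dzbar_lift (hz : z ∈ Ω) : cconj (dzbar (lift f) z) = dz (lift f) z := by
  rw [← cconj_dz_lift hΩ hf hz, cconj_cconj]

theorem mink_dzbar_dzbar (hz : z ∈ Ω) : mink (dzbar (lift f) z) (dzbar (lift f) z) = 0 := by
  rw [← cconj_dz_lift hΩ hf hz, mink_cconj, mink_dz_dz hΩ hf hz, map_zero]

theorem mink_dz_lift (hz : z ∈ Ω) : mink (dz (lift f) z) (lift f z) = 0 := by
  have h := mink_dz_add_eq_zero hΩ (contDiffOn_lift hΩ hf) (contDiffOn_lift hΩ hf) 0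
    (fun w hw => mink_lift_lift hf hw) hz
  rw [mink_comm (lift f z)] at h
  linear_combination (1 / 2) * h

theorem mink_dzbar_lift (hz : z ∈ Ω) : mink (dzbar (lift f) z) (lift f z) = 0 := by
  have h := mink_dzbar_add_eq_zero hΩ (contDiffOn_lift hΩ hf) (contDiffOn_lift hΩ hf) 0
    (fun w hw => mink_lift_lift hf hw) hz
  rw [mink_comm (lift f z)] at h
  linear_combination (1 / 2) * h

theorem contDiffOn_dz_lift : ContDiffOn ℝ ∞ (dz (lift f)) Ω :=
  contDiffOn_dz hΩ (contDiffOn_lift hΩ hf)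

theorem contDiffOn_dzbar_lift : ContDiffOn ℝ ∞ (dzbar (lift f)) Ω :=
  contDiffOn_dzbar hΩ (contDiffOn_lift hΩ hf)

theorem contDiffOn_lapl_lift : ContDiffOn ℝ ∞ (dzbar (dz (lift f))) Ω :=
  contDiffOn_dzbar hΩ (contDiffOn_dz_lift hΩ hf)

theorem mink_lapl_lift (hz : z ∈ Ω) : mink (dzbar (dz (lift f)) z) (lift f z) = -1 / 2 := by
  have h := mink_dzbar_add_eq_zero hΩ (contDiffOn_dz_lift hΩ hf) (contDiffOn_lift hΩ hf) 0
    (fun w hw => mink_dz_lift hΩ hf hw) hz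
  rw [mink_dz_dzbar hΩ hf hz] at h
  linear_combination h

theorem mink_lapl_dz (hz : z ∈ Ω) : mink (dzbar (dz (lift f)) z) (dz (lift f) z) = 0 := by
  have h := mink_dzbar_add_eq_zero hΩ (contDiffOn_dz_lift hΩ hf) (contDiffOn_dz_lift hΩ hf) 0
    (fun w hw => mink_dz_dz hΩ hf hw) hz
  rw [mink_comm (dz (lift f) z)] at h
  linear_combination (1 / 2) * h

theorem dz_dzbar_lift (hz : z ∈ Ω) : dz (dzbar (lift f)) z = dzbar (dz (lift f)) z :=
  dz_dzbar_comm hΩ (contDiffOn_lift hΩ hf) hz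

theorem cconj_lapl (hz : z ∈ Ω) : cconj (dzbar (dz (lift f)) z) = dzbar (dz (lift f)) z := by
  rw [← dz_cconj (differentiableAt_of_contDiffOn hΩ (contDiffOn_dz_lift hΩ hf) hz),
    dz_congr hΩ (fun w hw => cconj_dz_lift hΩ hf hw) hz]
  exact dz_dzbar_lift hΩ hf hz

theorem mink_lapl_dzbar (hz : z ∈ Ω) : mink (dzbar (dz (lift f)) z) (dzbar (lift f) z) = 0 := by
  rw [← cconj_lapl hΩ hf hz, ← cconj_dz_lift hΩ hf hz, mink_cconj, mink_lapl_dz hΩ hf hz,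
    map_zero]

theorem contDiffOn_frameN : ContDiffOn ℝ ∞ (frameN f) Ω :=
  ((contDiffOn_lapl_lift hΩ hf).const_smul (2 : ℂ)).add
    ((contDiffOn_const.mul (contDiffOn_mink (contDiffOn_lapl_lift hΩ hf)
      (contDiffOn_lapl_lift hΩ hf))).smul (contDiffOn_lift hΩ hf))

theorem mink_frameN_lift (hz : z ∈ Ω) : mink (frameN f z) (lift f z) = -1 := by
  simp only [frameN, mink_add_left, mink_smul_left, mink_lapl_lift hΩ hf hz, mink_lift_lift hf hz]
  ring

theorem mink_frameN_dz (hz : z ∈ Ω) : mink (frameN f z) (dz (lift f) z) = 0 := by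
  have h := mink_dz_lift hΩ hf hz
  rw [mink_comm] at h
  simp only [frameN, mink_add_left, mink_smul_left, mink_lapl_dz hΩ hf hz, h]
  ring

theorem mink_frameN_dzbar (hz : z ∈ Ω) : mink (frameN f z) (dzbar (lift f) z) = 0 := by
  have h := mink_dzbar_lift hΩ hf hz
  rw [mink_comm] at h
  simp only [frameN, mink_add_left, mink_smul_left, mink_lapl_dzbar hΩ hf hz, h]
  ring

theorem mink_frameN_frameN (hz : z ∈ Ω) : mink (frameN f z) (frameN f z) = 0 := by
  have h := mink_lapl_lift hΩ hf hz
  rw [mink_comm] at h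
  simp only [frameN, mink_add_left, mink_smul_left, mink_add_right, mink_smul_right,
    mink_lapl_lift hΩ hf hz, mink_lift_lift hf hz, h]
  ring

theorem cconj_frameN (hz : z ∈ Ω) : cconj (frameN f z) = frameN f z := by
  have h : conj (mink (dzbar (dz (lift f)) z) (dzbar (dz (lift f)) z))
      = mink (dzbar (dz (lift f)) z) (dzbar (dz (lift f)) z) := by
    rw [← mink_cconj, cconj_lapl hΩ hf hz]
  simp [frameN, cconj_lapl hΩ hf hz, cconj_lift, h]

theorem mink_dzdz_lift (hz : z ∈ Ω) : mink (dz (dz (lift f)) z) (lift f z) = 0 := by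
  have h := mink_dz_add_eq_zero hΩ (contDiffOn_dz_lift hΩ hf) (contDiffOn_lift hΩ hf) 0
    (fun w hw => mink_dz_lift hΩ hf hw) hz
  rw [mink_dz_dz hΩ hf hz] at h
  linear_combination h

theorem mink_dzdz_dz (hz : z ∈ Ω) : mink (dz (dz (lift f)) z) (dz (lift f) z) = 0 := by
  have h := mink_dz_add_eq_zero hΩ (contDiffOn_dz_lift hΩ hf) (contDiffOn_dz_lift hΩ hf) 0
    (fun w hw => mink_dz_dz hΩ hf hw) hz
  rw [mink_comm (dz (lift f) z)] at h
  linear_combination (1 / 2) * h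

theorem mink_dzdz_dzbar (hz : z ∈ Ω) : mink (dz (dz (lift f)) z) (dzbar (lift f) z) = 0 := by
  have h := mink_dz_add_eq_zero hΩ (contDiffOn_dz_lift hΩ hf) (contDiffOn_dzbar_lift hΩ hf) (1 / 2)
    (fun w hw => mink_dz_dzbar hΩ hf hw) hz
  rw [dz_dzbar_lift hΩ hf hz, mink_comm (dz (lift f) z), mink_lapl_dz hΩ hf hz] at h
  linear_combination h

theorem IsNormal.cconj {x : Mink n} (hz : z ∈ Ω) (hx : IsNormal f z x) :
    IsNormal f z (cconj x) where
  lift := by rw [← cconj_lift, mink_cconj, hx.lift, map_zero]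
  dz := by rw [← cconj_dzbar_lift hΩ hf hz, mink_cconj, hx.dzbar, map_zero]
  dzbar := by rw [← cconj_dz_lift hΩ hf hz, mink_cconj, hx.dz, map_zero]
  frameN := by rw [← cconj_frameN hΩ hf hz, mink_cconj, hx.frameN, map_zero]

theorem isNormal_normalProj (hz : z ∈ Ω) (x : Mink n) : IsNormal f z (normalProj f z x) := by
  have a1 := mink_lift_lift hf hz
  have a2 := mink_dz_lift hΩ hf hz
  have a2' := a2
  have a3 := mink_dzbar_lift hΩ hf hz
  have a3' := a3
  have a4 := mink_frameN_lift hΩ hf hz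
  have a4' := a4
  have a5 := mink_frameN_dz hΩ hf hz
  have a5' := a5
  have a6 := mink_frameN_dzbar hΩ hf hz
  have a6' := a6
  rw [mink_comm] at a2' a3' a4' a5' a6'
  have b1 := mink_dz_dz hΩ hf hz
  have b2 := mink_dz_dzbar hΩ hf hz
  have b3 := mink_dzbar_dz hΩ hf hz
  have b4 := mink_dzbar_dzbar hΩ hf hz
  have b5 := mink_frameN_frameN hΩ hf hz
  constructor <;>
  simp only [normalProj, mink_add_left, mink_sub_left, mink_smul_left, a1, a2, a3, a4, a5, a6, a2',
    a3', a4', a5', a6', b1, b2, b3, b4, b5] <;> ring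

theorem contDiffOn_schwarzian : ContDiffOn ℝ ∞ (schwarzian f) Ω :=
  contDiffOn_const.mul (contDiffOn_mink (contDiffOn_dz hΩ (contDiffOn_dz_lift hΩ hf))
    (contDiffOn_frameN hΩ hf))

theorem contDiffOn_hopf : ContDiffOn ℝ ∞ (hopf f) Ω :=
  (contDiffOn_dz hΩ (contDiffOn_dz_lift hΩ hf)).add
    (((contDiffOn_schwarzian hΩ hf).div_const 2).smul (contDiffOn_lift hΩ hf))

theorem contDiffOn_normalProj {x : ℂ → Mink n} (hx : ContDiffOn ℝ ∞ x Ω) :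
    ContDiffOn ℝ ∞ (fun z => normalProj f z (x z)) Ω := by
  have hY := contDiffOn_lift hΩ hf
  have hY1 := contDiffOn_dz_lift hΩ hf
  have hY2 := contDiffOn_dzbar_lift hΩ hf
  have hN := contDiffOn_frameN hΩ hf
  exact (((hx.add ((contDiffOn_mink hx hN).smul hY)).add ((contDiffOn_mink hx hY).smul hN)).sub
    ((contDiffOn_const.mul (contDiffOn_mink hx hY2)).smul hY1)).sub
    ((contDiffOn_const.mul (contDiffOn_mink hx hY1)).smul hY2)

theorem contDiffOn_dbarHopf : ContDiffOn ℝ ∞ (dbarHopf f) Ω :=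
  contDiffOn_normalProj hΩ hf (contDiffOn_dzbar hΩ (contDiffOn_hopf hΩ hf))

/-- Y_zz is already orthogonal to Y, Y_z and Y_z̄, and so is Y. The coefficient s/2 is the one that
removes the product with N, as ⟨Y, N⟩ = -1. -/
theorem isNormal_hopf (hz : z ∈ Ω) : IsNormal f z (hopf f z) := by
  have a2 := mink_dz_lift hΩ hf hz
  have a3 := mink_dzbar_lift hΩ hf hz
  have a4 := mink_frameN_lift hΩ hf hz
  rw [mink_comm] at a2 a3 a4
  constructor
  · simp [hopf, mink_dzdz_lift hΩ hf hz, mink_lift_lift hf hz]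
  · simp [hopf, mink_dzdz_dz hΩ hf hz, a2]
  · simp [hopf, mink_dzdz_dzbar hΩ hf hz, a3]
  · simp only [hopf, mink_add_left, mink_smul_left, a4, schwarzian]
    ring

theorem isNormal_dbarHopf (hz : z ∈ Ω) : IsNormal f z (dbarHopf f z) :=
  isNormal_normalProj hΩ hf hz _

theorem cconj_normalProj (hz : z ∈ Ω) (x : Mink n) :
    cconj (normalProj f z x) = normalProj f z (cconj x) := by
  have h1 : conj (mink x (frameN f z)) = mink (cconj x) (frameN f z) := by
    rw [← mink_cconj, cconj_frameN hΩ hf hz]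
  have h2 : conj (mink x (lift f z)) = mink (cconj x) (lift f z) := by
    rw [← mink_cconj, cconj_lift]
  have h3 : conj (mink x (dz (lift f) z)) = mink (cconj x) (dzbar (lift f) z) := by
    rw [← mink_cconj, cconj_dz_lift hΩ hf hz]
  have h4 : conj (mink x (dzbar (lift f) z)) = mink (cconj x) (dz (lift f) z) := by
    rw [← mink_cconj, cconj_dzbar_lift hΩ hf hz]
  simp only [normalProj, cconj_add, cconj_sub, cconj_smul, map_mul, h1, h2, h3, h4, conj_two,
    cconj_lift, cconj_frameN hΩ hf hz, cconj_dz_lift hΩ hf hz, cconj_dzbar_lift hΩ hf hz]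
  module

/-- Differentiating ⟨κ, Y⟩ = ⟨κ, Y_z⟩ = 0 shows that κ_z̄ is orthogonal to Y and Y_z. Hence D_z̄ κ -
κ_z̄ is a combination of Y and Y_z alone, and its z̄-derivative involves only Y, Y_z, Y_z̄ and
Y_zz̄, all invisible to a normal x. -/
theorem mink_dzbar_dbarHopf {x : Mink n} (hz : z ∈ Ω) (hx : IsNormal f z x) :
    mink (dzbar (dbarHopf f) z) x = mink (dzbar (dzbar (hopf f)) z) x := by
  have hk := contDiffOn_hopf hΩ hf
  have hk1 := contDiffOn_dzbar hΩ hk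
  have hY := contDiffOn_lift hΩ hf
  have hY1 := contDiffOn_dz_lift hΩ hf
  have hY2 := contDiffOn_dzbar_lift hΩ hf
  have hN := contDiffOn_frameN hΩ hf
  have e : ∀ w ∈ Ω, dbarHopf f w = dzbar (hopf f) w
      + (mink (dzbar (hopf f) w) (frameN f w) • lift f w
      + (-2 * mink (dzbar (hopf f) w) (dzbar (lift f) w)) • dz (lift f) w) := by
    intro w hw
    have h1 := mink_dzbar_add_eq_zero hΩ hk hY 0 (fun w hw => (isNormal_hopf hΩ hf hw).lift) hw
    have h2 := mink_dzbar_add_eq_zero hΩ hk hY1 0 (fun w hw => (isNormal_hopf hΩ hf hw).dz) hw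
    rw [(isNormal_hopf hΩ hf hw).dzbar, add_zero] at h1
    rw [(isNormal_hopf hΩ hf hw).lapl, add_zero] at h2
    rw [dbarHopf, normalProj, h1, h2]
    module
  have s1 := contDiffOn_mink hk1 hN
  have s2 : ContDiffOn ℝ ∞ (fun w => -2 * mink (dzbar (hopf f) w) (dzbar (lift f) w)) Ω :=
    contDiffOn_const.mul (contDiffOn_mink hk1 hY2)
  rw [dzbar_congr hΩ e hz, dzbar_add (differentiableAt_of_contDiffOn hΩ hk1 hz)
    (differentiableAt_of_contDiffOn hΩ (contDiffOn_fun_add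
      (contDiffOn_fun_smul s1 hY) (contDiffOn_fun_smul s2 hY1)) hz),
    dzbar_add (differentiableAt_of_contDiffOn hΩ (contDiffOn_fun_smul s1 hY) hz)
    (differentiableAt_of_contDiffOn hΩ (contDiffOn_fun_smul s2 hY1) hz),
    dzbar_smul (differentiableAt_of_contDiffOn hΩ s1 hz) (differentiableAt_of_contDiffOn hΩ hY hz),
    dzbar_smul (differentiableAt_of_contDiffOn hΩ s2 hz) (differentiableAt_of_contDiffOn hΩ hY1 hz)]
  have h1 := hx.lift
  have h2 := hx.dz
  have h3 := hx.dzbar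
  have h4 := hx.lapl
  rw [mink_comm] at h1 h2 h3 h4
  simp only [mink_add_left, mink_smul_left, h1, h2, h3, h4]
  ring

/-- Modulo Y and Y_z̄, κ_z̄z̄ is Y_zzz̄z̄ + (s/2) Y_z̄z̄, and Y_z̄z̄ differs from κ̄ by a multiple
of Y. This isolates a fourth-order term that is real. -/
theorem mink_dzbar_dzbar_hopf {x : Mink n} (hz : z ∈ Ω) (hx : IsNormal f z x) :
    mink (dzbar (dzbar (hopf f)) z) x = mink (dzbar (dzbar (dz (dz (lift f)))) z) x
      + schwarzian f z / 2 * mink (cconj (hopf f z)) x := by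
  have hY := contDiffOn_lift hΩ hf
  have hY2 := contDiffOn_dzbar_lift hΩ hf
  have hzz := contDiffOn_dz hΩ (contDiffOn_dz_lift hΩ hf)
  have hs : ContDiffOn ℝ ∞ (fun w => schwarzian f w / 2) Ω :=
    (contDiffOn_schwarzian hΩ hf).div_const 2
  have hs1 := contDiffOn_dzbar hΩ hs
  have e1 : ∀ w ∈ Ω, dzbar (hopf f) w = dzbar (dz (dz (lift f))) w
      + (dzbar (fun w => schwarzian f w / 2) w • lift f w
        + (schwarzian f w / 2) • dzbar (lift f) w) := by
    intro w hw
    rw [← dzbar_smul (differentiableAt_of_contDiffOn hΩ hs hw)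
      (differentiableAt_of_contDiffOn hΩ hY hw),
      ← dzbar_add (differentiableAt_of_contDiffOn hΩ hzz hw)
      (differentiableAt_of_contDiffOn hΩ (contDiffOn_fun_smul hs hY) hw)]
    rfl
  rw [dzbar_congr hΩ e1 hz, dzbar_add
    (differentiableAt_of_contDiffOn hΩ (contDiffOn_dzbar hΩ hzz) hz)
    (differentiableAt_of_contDiffOn hΩ (contDiffOn_fun_add
      (contDiffOn_fun_smul hs1 hY) (contDiffOn_fun_smul hs hY2)) hz),
    dzbar_add (differentiableAt_of_contDiffOn hΩ (contDiffOn_fun_smul hs1 hY) hz)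
    (differentiableAt_of_contDiffOn hΩ (contDiffOn_fun_smul hs hY2) hz),
    dzbar_smul (differentiableAt_of_contDiffOn hΩ hs1 hz) (differentiableAt_of_contDiffOn hΩ hY hz),
    dzbar_smul (differentiableAt_of_contDiffOn hΩ hs hz) (differentiableAt_of_contDiffOn hΩ hY2 hz)]
  have e2 : cconj (dz (dz (lift f)) z) = dzbar (dzbar (lift f)) z := by
    rw [← dzbar_cconj (differentiableAt_of_contDiffOn hΩ (contDiffOn_dz_lift hΩ hf) hz)]
    exact dzbar_congr hΩ (fun w hw => cconj_dz_lift hΩ hf hw) hz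
  have h1 := hx.lift
  have h3 := hx.dzbar
  rw [mink_comm] at h1 h3
  have e3 : mink (cconj (hopf f z)) x = mink (dzbar (dzbar (lift f)) z) x := by
    rw [hopf, cconj_add, cconj_smul, cconj_lift, e2]
    simp [h1]
  simp [h1, h3, e3]

/-- Conjugation exchanges the two kinds of derivative of the real map Y, and partial derivatives
commute. -/
theorem cconj_bilaplacian (hz : z ∈ Ω) : cconj (dzbar (dzbar (dz (dz (lift f)))) z)
    = dzbar (dzbar (dz (dz (lift f)))) z := by
  have hY := contDiffOn_lift hΩ hf
  have h1 := contDiffOn_dz_lift hΩ hf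
  have h2 := contDiffOn_dz hΩ h1
  have h3 := contDiffOn_dzbar hΩ h2
  have c3 : ∀ w ∈ Ω, cconj (dz (dz (lift f)) w) = dzbar (dzbar (lift f)) w := by
    intro w hw
    rw [← dzbar_cconj (differentiableAt_of_contDiffOn hΩ h1 hw)]
    exact dzbar_congr hΩ (fun w hw => cconj_dz_lift hΩ hf hw) hw
  have c2 : ∀ w ∈ Ω, cconj (dzbar (dz (dz (lift f))) w) = dzbar (dzbar (dz (lift f))) w := by
    intro w hw
    rw [← dz_cconj (differentiableAt_of_contDiffOn hΩ h2 hw), dz_congr hΩ c3 hw,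
      dz_dzbar_comm hΩ (contDiffOn_dzbar_lift hΩ hf) hw]
    exact dzbar_congr hΩ (fun x hx => dz_dzbar_lift hΩ hf hx) hw
  rw [← dz_cconj (differentiableAt_of_contDiffOn hΩ h3 hz), dz_congr hΩ c2 hz,
    dz_dzbar_comm hΩ (contDiffOn_lapl_lift hΩ hf) hz]
  exact dzbar_congr hΩ (fun x hx => dz_dzbar_comm hΩ h1 hx) hz

end Products

/-- `∂_{z̄}² κ + (s̄/2) κ`, whose normal part is `D_{z̄} D_{z̄} κ + (s̄/2) κ`. -/
def willmoreVec (f : ℂ → EuclideanSpace ℝ (Fin (n + 1))) (z : ℂ) : Mink n :=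
  dzbar (dzbar (hopf f)) z + (conj (schwarzian f z) / 2) • hopf f z

theorem contDiffOn_willmoreVec (hΩ : IsOpen Ω) (hf : IsConformalImmersion Ω f) :
    ContDiffOn ℝ ∞ (willmoreVec f) Ω :=
  (contDiffOn_dzbar hΩ (contDiffOn_dzbar hΩ (contDiffOn_hopf hΩ hf))).add
    (((Complex.conjCLE.contDiff.comp_contDiffOn (contDiffOn_schwarzian hΩ hf)).div_const 2).smul
      (contDiffOn_hopf hΩ hf))

/-- The Codazzi equation: the normal part of `∂_{z̄}² κ + (s̄/2) κ` is real. -/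
theorem mink_cconj_willmoreVec (hΩ : IsOpen Ω) (hf : IsConformalImmersion Ω f) (hz : z ∈ Ω)
    {x : Mink n} (hx : IsNormal f z x) :
    mink (cconj (willmoreVec f z)) x = mink (willmoreVec f z) x := by
  have h : mink (cconj (willmoreVec f z)) x = conj (mink (willmoreVec f z) (cconj x)) := by
    rw [← mink_cconj, cconj_cconj]
  have h2 : mink (dzbar (dzbar (dz (dz (lift f)))) z) (cconj x)
      = conj (mink (dzbar (dzbar (dz (dz (lift f)))) z) x) := by
    rw [← mink_cconj, cconj_bilaplacian hΩ hf hz]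
  have h3 : mink (hopf f z) (cconj x) = conj (mink (cconj (hopf f z)) x) := by
    rw [← mink_cconj, cconj_cconj]
  rw [h]
  -- Tested against normal vectors, the field is Y_zzz̄z̄ + (s/2) κ̄ + (s̄/2) κ: a real vector plus
  -- a sum of two conjugates.
  simp only [willmoreVec, mink_add_left, mink_smul_left,
    mink_dzbar_dzbar_hopf hΩ hf hz (hx.cconj hΩ hf hz), mink_dzbar_dzbar_hopf hΩ hf hz hx, h2, h3,
    mink_cconj, map_add, map_mul, map_div₀, Complex.conj_conj, conj_two]
  ring

/-! ### Consequences of the Willmore equation -/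

section Willmore

variable (hΩ : IsOpen Ω) (hf : IsConformalImmersion Ω f)
  (hW : ∀ z ∈ Ω, ∀ x, IsNormal f z x → mink (willmoreVec f z) x = 0)

include hΩ hf

/-- First equation, a_z̄ = 2b, of the linear system for a, b, c. It is the only one of the three
that holds without the Willmore condition. -/
theorem dzbar_mink_hopf_hopf (hz : z ∈ Ω) :
    dzbar (fun w => mink (hopf f w) (hopf f w)) z = 2 * mink (hopf f z) (dbarHopf f z) := by
  have hd := differentiableAt_of_contDiffOn hΩ (contDiffOn_hopf hΩ hf) hz
  rw [dzbar_mink hd hd, mink_comm _ (dbarHopf f z), dbarHopf,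
    (isNormal_hopf hΩ hf hz).mink_normalProj, mink_comm (hopf f z)]
  ring

include hW

/-- The equation D_z̄ D_z̄ κ = -(s̄/2) κ in weak form, which suffices since it is only ever paired
with κ and D_z̄ κ. -/
theorem mink_dzbar_dbarHopf_of_willmore (hz : z ∈ Ω) {x : Mink n} (hx : IsNormal f z x) :
    mink (dzbar (dbarHopf f) z) x = -(conj (schwarzian f z) / 2) * mink (hopf f z) x := by
  have h := hW z hz x hx
  rw [mink_dzbar_dbarHopf hΩ hf hz hx]
  simp only [willmoreVec, mink_add_left, mink_smul_left] at h
  linear_combination h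

theorem dzbar_mink_hopf_dbarHopf (hz : z ∈ Ω) :
    dzbar (fun w => mink (hopf f w) (dbarHopf f w)) z = mink (dbarHopf f z) (dbarHopf f z)
      - conj (schwarzian f z) / 2 * mink (hopf f z) (hopf f z) := by
  rw [dzbar_mink (differentiableAt_of_contDiffOn hΩ (contDiffOn_hopf hΩ hf) hz)
    (differentiableAt_of_contDiffOn hΩ (contDiffOn_dbarHopf hΩ hf) hz),
    mink_comm (hopf f z),
    mink_dzbar_dbarHopf_of_willmore hΩ hf hW hz (isNormal_hopf hΩ hf hz)]
  have : mink (dbarHopf f z) (dbarHopf f z) = mink (dzbar (hopf f) z) (dbarHopf f z) :=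
    (isNormal_dbarHopf hΩ hf hz).mink_normalProj _
  rw [this]
  ring

theorem dzbar_mink_dbarHopf_dbarHopf (hz : z ∈ Ω) :
    dzbar (fun w => mink (dbarHopf f w) (dbarHopf f w)) z
      = -conj (schwarzian f z) * mink (hopf f z) (dbarHopf f z) := by
  have hd := differentiableAt_of_contDiffOn hΩ (contDiffOn_dbarHopf hΩ hf) hz
  rw [dzbar_mink hd hd, mink_comm (dbarHopf f z),
    mink_dzbar_dbarHopf_of_willmore hΩ hf hW hz (isNormal_dbarHopf hΩ hf hz)]
  ring

omit hW in
theorem contDiffOn_discr : ContDiffOn ℝ ∞ (discr f) Ω := by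
  have h1 := contDiffOn_hopf hΩ hf
  have h2 := contDiffOn_dbarHopf hΩ hf
  exact ((contDiffOn_mink h1 h2).pow 2).sub ((contDiffOn_mink h1 h1).mul (contDiffOn_mink h2 h2))

/-- With the system for a, b, c the derivative is 2b(c - (s̄/2) a) - 2bc + s̄ ab, in which
everything cancels. -/
theorem dzbar_discr (hz : z ∈ Ω) : dzbar (discr f) z = 0 := by
  have h1 := contDiffOn_hopf hΩ hf
  have h2 := contDiffOn_dbarHopf hΩ hf
  have d : ∀ {g : ℂ → ℂ}, ContDiffOn ℝ ∞ g Ω → DifferentiableAt ℝ g z := fun hg =>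
    differentiableAt_of_contDiffOn hΩ hg hz
  have e : discr f = fun w => mink (hopf f w) (dbarHopf f w) * mink (hopf f w) (dbarHopf f w)
      - mink (hopf f w) (hopf f w) * mink (dbarHopf f w) (dbarHopf f w) := by
    funext w; rw [discr, sq]
  have m1 := contDiffOn_mink h1 h1
  have m2 := contDiffOn_mink h1 h2
  have m3 := contDiffOn_mink h2 h2
  rw [e, dzbar_sub (d (m2.mul m2)) (d (m1.mul m3)), dzbar_mul (d m2) (d m2),
    dzbar_mul (d m1) (d m3), dzbar_mink_hopf_hopf hΩ hf hz,
    dzbar_mink_hopf_dbarHopf hΩ hf hW hz, dzbar_mink_dbarHopf_dbarHopf hΩ hf hW hz]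
  ring

theorem differentiableOn_discr : DifferentiableOn ℂ (discr f) Ω := fun _ hz =>
  (differentiableAt_complex_of_dzbar_eq_zero
    (differentiableAt_of_contDiffOn hΩ (contDiffOn_discr hΩ hf) hz)
    (dzbar_discr hΩ hf hW hz)).differentiableWithinAt

end Willmore

end Frame

/-! ### The truncated Cauchy kernel of `∂_z` -/

section CauchyKernel

open MeasureTheory Set Metric

/-- The kernel `1 / (π w̄)`, a fundamental solution of `∂_z`, truncated to the disc of radius `R`. -/
def dzKernel (R : ℝ) (w : ℂ) : ℂ := if ‖w‖ < R then ((Real.pi : ℂ) * conj w)⁻¹ else 0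

theorem norm_dzKernel (R : ℝ) (w : ℂ) :
    ‖dzKernel R w‖ = (fun y : ℝ => if y < R then (Real.pi * y)⁻¹ else 0) ‖w‖ := by
  by_cases h : ‖w‖ < R
  · simp [dzKernel, h, abs_of_pos Real.pi_pos]
  · simp [dzKernel, h]

theorem measurable_dzKernel (R : ℝ) : Measurable (dzKernel R) := by
  refine Measurable.ite (measurableSet_lt measurable_norm measurable_const) ?_ measurable_const
  exact (measurable_const.mul (Complex.continuous_conj.measurable)).inv

theorem mul_dzKernel_radial {R y : ℝ} (hy : 0 < y) :
    y * (if y < R then (Real.pi * y)⁻¹ else 0) = (Iio R).indicator (fun _ => Real.pi⁻¹) y := by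
  by_cases h : y < R
  · simp only [h, if_true, indicator, mem_Iio]
    field_simp
  · simp [h]

/-- In polar coordinates the Jacobian r cancels the singularity 1/r of the kernel. -/
theorem integrable_dzKernel (R : ℝ) : Integrable (dzKernel R) := by
  rw [← integrable_norm_iff (measurable_dzKernel R).aestronglyMeasurable]
  simp only [norm_dzKernel]
  rw [integrable_fun_norm_addHaar volume
    (f := fun y : ℝ => if y < R then (Real.pi * y)⁻¹ else 0)]
  simp only [Complex.finrank_real_complex, Nat.add_one_sub_one, pow_one, smul_eq_mul]
  rw [integrableOn_congr_fun (g := (Iio R).indicator (fun _ => Real.pi⁻¹))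
    (fun y (hy : y ∈ Ioi 0) => mul_dzKernel_radial hy) measurableSet_Ioi]
  rw [IntegrableOn, integrable_indicator_iff measurableSet_Iio]
  rw [IntegrableOn, Measure.restrict_restrict measurableSet_Iio]
  refine integrableOn_const ?_
  rw [inter_comm, Ioi_inter_Iio]
  simp

/-- The circumference factor 2π times ∫₀^R dr/π. Smallness of this L¹ norm for small R drives the
Neumann series. -/
theorem integral_norm_dzKernel {R : ℝ} (hR : 0 ≤ R) : ∫ w, ‖dzKernel R w‖ = 2 * R := by
  simp only [norm_dzKernel]
  rw [integral_fun_norm_addHaar volume (fun y : ℝ => if y < R then (Real.pi * y)⁻¹ else 0)]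
  simp only [Complex.finrank_real_complex, Nat.add_one_sub_one, pow_one, smul_eq_mul]
  rw [setIntegral_congr_fun (g := (Iio R).indicator (fun _ => Real.pi⁻¹)) measurableSet_Ioi
    (fun y hy => mul_dzKernel_radial hy)]
  rw [setIntegral_indicator measurableSet_Iio, Ioi_inter_Iio]
  have h : volume.real (ball (0 : ℂ) 1) = Real.pi := by
    simp [Measure.real, Complex.volume_ball]
  have h2 : volume.real (Ioo 0 R) = R := by simp [Measure.real, hR]
  rw [setIntegral_const, h, h2]
  simp only [smul_eq_mul, nsmul_eq_mul]
  have := Real.pi_ne_zero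
  push_cast
  field_simp

variable {E : Type*} [NormedAddCommGroup E] [NormedSpace ℂ E]

theorem hasDerivAt_polar {G : ℂ → E} (hG : ContDiff ℝ 1 G) (r θ : ℝ) :
    HasDerivAt (fun r : ℝ => G (r * Complex.exp (θ * Complex.I)))
        (fderiv ℝ G (r * Complex.exp (θ * Complex.I)) (Complex.exp (θ * Complex.I))) r ∧
      HasDerivAt (fun θ : ℝ => G (r * Complex.exp (θ * Complex.I)))
        (r • fderiv ℝ G (r * Complex.exp (θ * Complex.I))
          (Complex.I * Complex.exp (θ * Complex.I))) θ := by
  have hd : HasFDerivAt G (fderiv ℝ G (r * Complex.exp (θ * Complex.I)))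
      (r * Complex.exp (θ * Complex.I)) :=
    (hG.differentiable (by norm_num) _).hasFDerivAt
  constructor
  · have h1 : HasDerivAt (fun r : ℝ => (r : ℂ) * Complex.exp (θ * Complex.I))
        (1 * Complex.exp (θ * Complex.I)) r := (Complex.ofRealCLM.hasDerivAt).mul_const _
    rw [one_mul] at h1
    exact hd.comp_hasDerivAt r h1
  · have h1 : HasDerivAt (fun θ : ℝ => (r : ℂ) * Complex.exp (θ * Complex.I))
        (r * (Complex.exp (θ * Complex.I) * (1 * Complex.I))) θ :=
      (((Complex.ofRealCLM.hasDerivAt (x := θ)).mul_const Complex.I).cexp).const_mul _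
    have h2 := hd.comp_hasDerivAt θ h1
    have h3 : (r : ℂ) * (Complex.exp (θ * Complex.I) * (1 * Complex.I))
        = r • (Complex.I * Complex.exp (θ * Complex.I)) := by
      rw [Complex.real_smul]
      ring
    rw [h3, map_smul] at h2
    exact h2

/-- The Cauchy–Pompeiu formula for a function that vanishes off the disc of radius `R`. -/
theorem integral_dzKernel_smul_dz [CompleteSpace E] {G : ℂ → E} (hG : ContDiff ℝ 1 G) {R : ℝ}
    (hR : 0 < R) (h0 : ∀ w, R ≤ ‖w‖ → G w = 0) :
    ∫ w, dzKernel R w • dz G w = -G 0 := by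
  set e : ℝ → ℂ := fun θ => Complex.exp (θ * Complex.I) with he
  have hec : Continuous e := by fun_prop
  have hfc : Continuous (fderiv ℝ G) := hG.continuous_fderiv (by norm_num)
  set A : ℝ × ℝ → E := fun p => fderiv ℝ G (p.1 * e p.2) (e p.2) with hA
  set B : ℝ × ℝ → E := fun p => fderiv ℝ G (p.1 * e p.2) (Complex.I * e p.2) with hB
  have hAc : Continuous A := by
    refine (hfc.comp ?_).clm_apply (hec.comp continuous_snd)
    exact (Complex.continuous_ofReal.comp continuous_fst).mul (hec.comp continuous_snd)
  have hBc : Continuous B := by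
    refine (hfc.comp ?_).clm_apply (continuous_const.mul (hec.comp continuous_snd))
    exact (Complex.continuous_ofReal.comp continuous_fst).mul (hec.comp continuous_snd)
  -- `A` is ∂_r G and `B` is (1/r) ∂_θ G. Since G_z = (e^{-iθ}/2)(∂_r G - (i/r) ∂_θ G), the phases
  -- of G_z and of the kernel cancel, as do r and 1/r.
  have key : ∀ p ∈ Ioi (0 : ℝ) ×ˢ Ioo (-Real.pi) Real.pi,
      p.1 • (dzKernel R (Complex.polarCoord.symm p) • dz G (Complex.polarCoord.symm p))
      = (Iio R ×ˢ univ).indicator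
        (fun p => (1 / (2 * Real.pi) : ℂ) • (A p - Complex.I • B p)) p := by
    rintro ⟨r, θ⟩ ⟨hr, -⟩
    have hr : 0 < r := hr
    have hp : Complex.polarCoord.symm (r, θ) = r * e θ := by
      rw [Complex.polarCoord_symm_apply, he]
      simp [Complex.exp_mul_I]
    have hn : ‖(r : ℂ) * e θ‖ = r := by
      simp [he, Complex.norm_exp_ofReal_mul_I, abs_of_pos hr]
    rw [hp, dzKernel, hn]
    by_cases hrR : r < R
    · rw [if_pos hrR, indicator_of_mem (by simp [hrR])]
      simp only [hA, hB]
      have hrc : (r : ℂ) ≠ 0 := by exact_mod_cast hr.ne'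
      have hpi : (Real.pi : ℂ) ≠ 0 := by exact_mod_cast Real.pi_ne_zero
      have hce : conj (e θ) * e θ = 1 := by
        rw [mul_comm, Complex.mul_conj, Complex.normSq_eq_norm_sq, he]
        simp [Complex.norm_exp_ofReal_mul_I]
      have hce0 : conj (e θ) ≠ 0 := left_ne_zero_of_mul_eq_one hce
      have hre : e θ = (Real.cos θ : ℝ) • (1 : ℂ) + (Real.sin θ : ℝ) • Complex.I := by
        simp [he, Complex.exp_mul_I]
      have hre2 : Complex.I * e θ = (-Real.sin θ : ℝ) • (1 : ℂ)
          + (Real.cos θ : ℝ) • Complex.I := by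
        rw [hre]
        simp only [Complex.real_smul]
        push_cast
        linear_combination Complex.sin θ * Complex.I_mul_I
      set X := fderiv ℝ G (r * e θ) 1 with hX
      set Z := fderiv ℝ G (r * e θ) Complex.I with hZ
      have h1 : fderiv ℝ G (r * e θ) (e θ) = (Real.cos θ : ℂ) • X + (Real.sin θ : ℂ) • Z := by
        conv_lhs => arg 2; rw [hre]
        rw [map_add, map_smul, map_smul, Complex.coe_smul, Complex.coe_smul]
      have h2 : fderiv ℝ G (r * e θ) (Complex.I * e θ)
          = (-Real.sin θ : ℂ) • X + (Real.cos θ : ℂ) • Z := by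
        conv_lhs => arg 2; rw [hre2]
        rw [map_add, map_smul, map_smul, ← Complex.coe_smul, ← Complex.coe_smul]
        push_cast
        rfl
      have h3 : dz G (r * e θ) = (1 / 2 : ℂ) • (X - Complex.I • Z) := rfl
      have h4 : (r : ℂ) * (Real.pi * conj ((r : ℂ) * e θ))⁻¹ = (1 / Real.pi) * e θ := by
        rw [map_mul, Complex.conj_ofReal]
        field_simp
        exact hce.symm
      have h5 : e θ = Real.cos θ + Real.sin θ * Complex.I := by
        rw [hre]; simp
      rw [h1, h2, h3, ← Complex.coe_smul, smul_smul, h4, h5]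
      have h6 : Complex.I • ((-Real.sin θ : ℂ) • X + (Real.cos θ : ℂ) • Z)
          = (-(Real.sin θ * Complex.I) : ℂ) • X + (Real.cos θ * Complex.I : ℂ) • Z := by module
      have h7 : ((Real.cos θ : ℂ) + Real.sin θ * Complex.I) • (X - Complex.I • Z)
          = ((Real.cos θ : ℂ) + Real.sin θ * Complex.I) • X
            - (Real.cos θ * Complex.I + Real.sin θ * (Complex.I * Complex.I)) • Z := by module
      rw [h6, smul_smul, mul_right_comm, ← smul_smul, h7, Complex.I_mul_I]
      have h8 : (1 / (Real.pi : ℂ)) * (1 / 2) = 1 / (2 * Real.pi) := by field_simp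
      rw [h8]
      module
    · rw [if_neg hrR, indicator_of_notMem (by simp [hrR])]
      simp
  rw [← Complex.integral_comp_polarCoord_symm]
  have ht : polarCoord.target = Ioi (0 : ℝ) ×ˢ Ioo (-Real.pi) Real.pi := rfl
  rw [ht, setIntegral_congr_fun (measurableSet_Ioi.prod measurableSet_Ioo) key,
    setIntegral_indicator (measurableSet_Iio.prod MeasurableSet.univ), prod_inter_prod, inter_univ,
    Ioi_inter_Iio]
  have hint : ∀ {H : ℝ × ℝ → E}, Continuous H →
      IntegrableOn H (Ioo 0 R ×ˢ Ioo (-Real.pi) Real.pi) := fun hH =>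
    (hH.continuousOn.integrableOn_compact (isCompact_Icc.prod isCompact_Icc)).mono_set
      (prod_mono Ioo_subset_Icc_self Ioo_subset_Icc_self)
  have hpi : (-Real.pi) ≤ Real.pi := by linarith [Real.pi_pos]
  have IA : ∫ p in Ioo 0 R ×ˢ Ioo (-Real.pi) Real.pi, A p = -((2 * Real.pi) • G 0) := by
    have hsw := setIntegral_prod_swap (μ := (volume : Measure ℝ)) (ν := (volume : Measure ℝ))
      (Ioo 0 R) (Ioo (-Real.pi) Real.pi) A
    rw [Measure.volume_eq_prod, ← hsw, setIntegral_prod (fun z => A z.swap)]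
    -- Along each ray the integral telescopes to G(R e^{iθ}) - G(0), and the first value vanishes by
    -- `h0`.
    · have inner : ∀ θ : ℝ, ∫ r in Ioo 0 R, A (r, θ) = -G 0 := by
        intro θ
        rw [← integral_Ioc_eq_integral_Ioo, ← intervalIntegral.integral_of_le hR.le,
          intervalIntegral.integral_eq_sub_of_hasDerivAt
            (fun r _ => (hasDerivAt_polar hG r θ).1)
            ((hAc.comp (by fun_prop : Continuous fun r : ℝ => (r, θ))).intervalIntegrable _ _)]
        rw [h0 _ (by simp [Complex.norm_exp_ofReal_mul_I, le_abs_self])]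
        simp
      simp only [Prod.swap_prod_mk, inner]
      rw [setIntegral_const]
      have : volume.real (Ioo (-Real.pi) Real.pi) = 2 * Real.pi := by
        rw [Real.volume_real_Ioo_of_le hpi]; ring
      rw [this, smul_neg]
    · exact ((hAc.comp continuous_swap).continuousOn.integrableOn_compact
        (isCompact_Icc.prod isCompact_Icc)).mono_set
        (prod_mono Ioo_subset_Icc_self Ioo_subset_Icc_self)
  have IB : ∫ p in Ioo 0 R ×ˢ Ioo (-Real.pi) Real.pi, B p = 0 := by
    rw [Measure.volume_eq_prod, setIntegral_prod B (hint hBc)]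
    refine setIntegral_eq_zero_of_forall_eq_zero fun r hr => ?_
    rw [← integral_Ioc_eq_integral_Ioo, ← intervalIntegral.integral_of_le hpi]
    have h := intervalIntegral.integral_eq_sub_of_hasDerivAt (a := -Real.pi) (b := Real.pi)
      (fun θ _ => (hasDerivAt_polar hG r θ).2)
      ((((hBc.comp (by fun_prop : Continuous fun θ : ℝ => (r, θ))).const_smul r)).intervalIntegrable
        _ _)
    rw [intervalIntegral.integral_smul] at h
    -- The angular derivative r `B` integrates to zero over a full circle by periodicity, and r ≠ 0.
    have h2 : Complex.exp ((-Real.pi : ℝ) * Complex.I)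
        = Complex.exp ((Real.pi : ℝ) * Complex.I) := by
      push_cast
      rw [neg_mul, Complex.exp_neg, Complex.exp_pi_mul_I]
      norm_num
    rw [h2, sub_self] at h
    exact (smul_eq_zero.1 h).resolve_left hr.1.ne'
  rw [integral_smul, integral_sub (g := fun a => Complex.I • B a) (hint hAc)
    ((hint hBc).smul Complex.I), integral_smul, IA, IB,
    smul_zero, sub_zero, smul_neg, ← Complex.coe_smul, smul_smul]
  have : (1 / (2 * Real.pi) : ℂ) * ((2 * Real.pi : ℝ) : ℂ) = 1 := by
    have hpi : (Real.pi : ℂ) ≠ 0 := by exact_mod_cast Real.pi_ne_zero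
    push_cast
    field_simp
  rw [this, one_smul]

end CauchyKernel

/-! ### Local solutions of linear `∂_z`-systems -/

section CauchyOperator

open MeasureTheory Set Metric

/-- Convolution with the truncated Cauchy kernel of `∂_z`. -/
def cauchyOp {E : Type*} [NormedAddCommGroup E] [NormedSpace ℝ E] [NormedSpace ℂ E]
    (R : ℝ) (g : ℂ → E) (x : ℂ) : E := ∫ t, dzKernel R t • g (x - t)

section Real

variable {E : Type*} [NormedAddCommGroup E] [NormedSpace ℝ E] [NormedSpace ℂ E]
  [IsScalarTower ℝ ℂ E]

theorem cauchyOp_eq_convolution (R : ℝ) (g : ℂ → E) :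
    cauchyOp R g = convolution (dzKernel R) g (ContinuousLinearMap.lsmul ℝ ℂ) volume := rfl

theorem contDiff_cauchyOp (R : ℝ) {g : ℂ → E} (hg : ContDiff ℝ ∞ g) (hc : HasCompactSupport g) :
    ContDiff ℝ ∞ (cauchyOp R g) := by
  rw [cauchyOp_eq_convolution]
  exact hc.contDiff_convolution_right _ (integrable_dzKernel R).locallyIntegrable
    (n := (⊤ : ℕ∞)) hg

theorem fderiv_cauchyOp (R : ℝ) {g : ℂ → E} (hg : ContDiff ℝ ∞ g) (hc : HasCompactSupport g) :
    fderiv ℝ (cauchyOp R g) = cauchyOp R (fderiv ℝ g) := by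
  funext x
  have h := hc.hasFDerivAt_convolution_right (ContinuousLinearMap.lsmul ℝ ℂ)
    (integrable_dzKernel R).locallyIntegrable (hg.of_le (by norm_cast)) x
  rw [cauchyOp_eq_convolution, h.fderiv]
  rfl

omit [IsScalarTower ℝ ℂ E] in
theorem norm_cauchyOp_le {R : ℝ} (hR : 0 ≤ R) {g : ℂ → E} {M : ℝ} (h : ∀ y, ‖g y‖ ≤ M) (x : ℂ) :
    ‖cauchyOp R g x‖ ≤ 2 * R * M := by
  rw [← integral_norm_dzKernel hR, ← integral_mul_const]
  refine norm_integral_le_of_norm_le ((integrable_dzKernel R).norm.mul_const M) ?_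
  filter_upwards with t
  rw [norm_smul]
  gcongr
  exact h _

end Real

/-- Differentiation commutes with convolution, so the constant 2R is the same at every order. The
space `E` is quantified inside the induction because `fderiv ℝ g` takes values in `ℂ →L[ℝ] E`. -/
theorem norm_iteratedFDeriv_cauchyOp_le {R : ℝ} (hR : 0 ≤ R) (k : ℕ) :
    ∀ {E : Type*} [NormedAddCommGroup E] [NormedSpace ℝ E] [NormedSpace ℂ E]
      [IsScalarTower ℝ ℂ E] {g : ℂ → E}, ContDiff ℝ ∞ g → HasCompactSupport g →
      ∀ {M : ℝ}, (∀ y, ‖iteratedFDeriv ℝ k g y‖ ≤ M) →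
      ∀ x, ‖iteratedFDeriv ℝ k (cauchyOp R g) x‖ ≤ 2 * R * M := by
  induction k with
  | zero =>
    intro E _ _ _ _ g _ _ M h x
    simp only [norm_iteratedFDeriv_zero] at h ⊢
    exact norm_cauchyOp_le hR h x
  | succ k ih =>
    intro E _ _ _ _ g hg hc M h x
    simp only [← norm_iteratedFDeriv_fderiv] at h ⊢
    rw [fderiv_cauchyOp R hg hc]
    exact ih (hg.fderiv_right (by norm_num)) (hc.fderiv ℝ) h x

variable {E : Type*} [NormedAddCommGroup E] [NormedSpace ℂ E] [CompleteSpace E]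

/-- The derivative falls on g inside the convolution, and what remains is the Cauchy–Pompeiu formula
at the origin for t ↦ g(z - t). -/
theorem dz_cauchyOp {p z : ℂ} {r : ℝ} (hr : 0 < r) {g : ℂ → E} (hg : ContDiff ℝ ∞ g)
    (hc : HasCompactSupport g) (h0 : ∀ y, r < dist y p → g y = 0) (hz : z ∈ ball p r) :
    dz (cauchyOp (2 * r) g) z = g z := by
  have hg1 : ContDiff ℝ 1 g := hg.of_le (by norm_cast)
  have hfc : Continuous (fderiv ℝ g) := hg1.continuous_fderiv (by norm_num)
  obtain ⟨C, hC⟩ := hfc.bounded_above_of_compact_support (hc.fderiv ℝ)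
  have hi : Integrable fun t => dzKernel (2 * r) t • fderiv ℝ g (z - t) := by
    refine (integrable_dzKernel (2 * r)).smul_bdd C ?_ (.of_forall fun t => hC _)
    exact (hfc.comp (by fun_prop : Continuous fun t : ℂ => z - t)).aestronglyMeasurable
  have hv : ∀ v : ℂ, fderiv ℝ (cauchyOp (2 * r) g) z v
      = ∫ t, dzKernel (2 * r) t • fderiv ℝ g (z - t) v := by
    intro v
    rw [fderiv_cauchyOp _ hg hc, cauchyOp, ContinuousLinearMap.integral_apply hi]
    rfl
  have hiv : ∀ v : ℂ, Integrable fun t => dzKernel (2 * r) t • fderiv ℝ g (z - t) v := fun v =>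
    hi.apply_continuousLinearMap v
  have hG : ContDiff ℝ 1 fun t => g (z - t) := hg1.comp (contDiff_const.sub contDiff_id)
  have hdG : ∀ t, dz (fun t => g (z - t)) t = -dz g (z - t) := by
    intro t
    have hd : fderiv ℝ (fun t => g (z - t)) t = -fderiv ℝ g (z - t) := by
      have h := (hg1.differentiable (by norm_num) (z - t)).hasFDerivAt.comp t
        ((hasFDerivAt_id (𝕜 := ℝ) t).const_sub z)
      have h2 := h.fderiv
      simp only [Function.comp_def, ContinuousLinearMap.comp_neg, ContinuousLinearMap.comp_id]
        at h2
      exact h2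
    simp only [dz, hd, neg_apply]
    module
  -- The truncation radius 2r is enough: if |w| ≥ 2r and z lies in the disc of radius r about p,
  -- then z - w is at distance more than r from p.
  have h1 := integral_dzKernel_smul_dz hG (R := 2 * r) (by positivity) (fun w hw => h0 _ (by
    rw [mem_ball] at hz
    have := dist_triangle z (z - w) p
    have h2 : dist (z) (z - w) = ‖w‖ := by simp
    have h3 := dist_triangle (z - w) p z
    rw [dist_comm p z, dist_comm (z - w) z, h2] at h3
    linarith))
  simp only [hdG, smul_neg, integral_neg, neg_inj, sub_zero] at h1
  rw [← h1]
  have h2 : ∀ t, dzKernel (2 * r) t • dz g (z - t)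
      = (1 / 2 : ℂ) • (dzKernel (2 * r) t • fderiv ℝ g (z - t) 1
        - Complex.I • (dzKernel (2 * r) t • fderiv ℝ g (z - t) Complex.I)) := by
    intro t
    simp only [dz]
    module
  simp only [h2]
  rw [integral_smul, integral_sub (hiv 1) (g := fun t => Complex.I •
    (dzKernel (2 * r) t • fderiv ℝ g (z - t) Complex.I)) ((hiv Complex.I).smul Complex.I),
    integral_smul, ← hv, ← hv]
  rfl

/-- The terms of the Neumann series for `w = w₀ + K * (B w)`. -/
def neumannTerm (R : ℝ) (B : ℂ → E →L[ℝ] E) (w₀ : E) : ℕ → ℂ → E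
  | 0 => fun _ => w₀
  | j + 1 => cauchyOp R fun z => B z (neumannTerm R B w₀ j z)

variable {B : ℂ → E →L[ℝ] E} {R M : ℝ}

omit [CompleteSpace E] in
theorem contDiff_neumannTerm (hB : ContDiff ℝ ∞ B) (hc : HasCompactSupport B) (w₀ : E) (j : ℕ) :
    ContDiff ℝ ∞ (neumannTerm R B w₀ j) ∧
      ContDiff ℝ ∞ (fun z => B z (neumannTerm R B w₀ j z)) ∧
      HasCompactSupport (fun z => B z (neumannTerm R B w₀ j z)) := by
  have hs : ∀ w : ℂ → E, HasCompactSupport (fun z => B z (w z)) := fun w =>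
    hc.mono fun z hz hB0 => hz (by simp [hB0])
  induction j with
  | zero => exact ⟨contDiff_const, hB.clm_apply contDiff_const, hs _⟩
  | succ j ih =>
    have h := contDiff_cauchyOp R ih.2.1 ih.2.2
    exact ⟨h, hB.clm_apply h, hs _⟩

omit [CompleteSpace E] in
theorem norm_neumannTerm_le (hR : 0 ≤ R) (hM : ∀ z, ‖B z‖ ≤ M) (hRM : 2 * R * M ≤ 1 / 8)
    (w₀ : E) (j : ℕ) (x : ℂ) : ‖neumannTerm R B w₀ j x‖ ≤ ‖w₀‖ * (1 / 8) ^ j := by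
  induction j generalizing x with
  | zero => simp [neumannTerm]
  | succ j ih =>
    have h1 : ∀ y, ‖B y (neumannTerm R B w₀ j y)‖ ≤ M * (‖w₀‖ * (1 / 8) ^ j) := fun y =>
      ((B y).le_opNorm _).trans (mul_le_mul (hM y) (ih y) (norm_nonneg _)
        ((norm_nonneg _).trans (hM y)))
    refine (norm_cauchyOp_le hR h1 x).trans ?_
    have h2 : 0 ≤ ‖w₀‖ * (1 / 8 : ℝ) ^ j := by positivity
    calc 2 * R * (M * (‖w₀‖ * (1 / 8) ^ j)) = (2 * R * M) * (‖w₀‖ * (1 / 8) ^ j) := by ring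
      _ ≤ (1 / 8) * (‖w₀‖ * (1 / 8) ^ j) := by gcongr
      _ = ‖w₀‖ * (1 / 8) ^ (j + 1) := by ring

-- By the Leibniz rule, the term in which all k derivatives fall on the previous iterate is
-- contracted by 2RM ≤ 1/8, and the others involve lower orders, which already decay like (1/2)^j.
-- Neither R nor the rate depends on k, so one disc serves all orders and the sum is smooth.
omit [CompleteSpace E] in
theorem exists_iteratedFDeriv_neumannTerm_le (hR : 0 ≤ R) (hB : ContDiff ℝ ∞ B)
    (hc : HasCompactSupport B) (hM : ∀ z, ‖B z‖ ≤ M) (hRM : 2 * R * M ≤ 1 / 8) (w₀ : E) (k : ℕ) :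
    ∃ C : ℝ, 0 ≤ C ∧
      ∀ j x, ‖iteratedFDeriv ℝ k (neumannTerm R B w₀ j) x‖ ≤ C * (1 / 2) ^ j := by
  induction k using Nat.strong_induction_on with
  | _ k ih =>
  choose! C hC0 hC using ih
  have hb : ∀ i : ℕ, ∃ b, ∀ z, ‖iteratedFDeriv ℝ i B z‖ ≤ b := fun i =>
    (hB.continuous_iteratedFDeriv (by exact_mod_cast le_top)).bounded_above_of_compact_support
      (hc.iteratedFDeriv i)
  choose b hb using hb
  have hb0 : ∀ i, 0 ≤ b i := fun i => (norm_nonneg _).trans (hb i 0)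
  set D : ℝ := ∑ i ∈ Finset.range k, (k.choose (i + 1) : ℝ) * b (i + 1) * C (k - (i + 1)) with hD
  have hD0 : 0 ≤ D := Finset.sum_nonneg fun i hi =>
    mul_nonneg (mul_nonneg (by positivity) (hb0 _))
      (hC0 _ (by have := Finset.mem_range.1 hi; omega))
  have hM0 : 0 ≤ M := (norm_nonneg _).trans (hM 0)
  -- For C = ‖w₀‖ + 8RD one has 2R(D + MC) ≤ 2RD + C/8 ≤ C/2. The margin between 1/8 and 1/2 absorbs
  -- the lower-order terms collected in `D`.
  refine ⟨‖w₀‖ + 8 * R * D, by positivity, fun j => ?_⟩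
  induction j with
  | zero =>
    intro x
    have h1 : ‖iteratedFDeriv ℝ k (neumannTerm R B w₀ 0) x‖ ≤ ‖w₀‖ := by
      rcases Nat.eq_zero_or_pos k with rfl | hk
      · simp [neumannTerm]
      · have : iteratedFDeriv ℝ k (neumannTerm R B w₀ 0) = 0 :=
          iteratedFDeriv_const_of_ne hk.ne' w₀
        rw [this]
        simp
    have : 0 ≤ 8 * R * D := by positivity
    simpa using h1.trans (le_add_of_nonneg_right this)
  | succ j ihj =>
    intro x
    obtain ⟨s1, s2, s3⟩ := contDiff_neumannTerm (R := R) hB hc w₀ j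
    have h1 : ∀ y, ‖iteratedFDeriv ℝ k (fun z => B z (neumannTerm R B w₀ j z)) y‖
        ≤ (D + M * (‖w₀‖ + 8 * R * D)) * (1 / 2) ^ j := by
      intro y
      refine (norm_iteratedFDeriv_clm_apply hB s1 y (n := k) (by exact_mod_cast le_top)).trans ?_
      rw [Finset.sum_range_succ', add_mul, hD, Finset.sum_mul]
      refine add_le_add (Finset.sum_le_sum fun i hi => ?_) ?_
      · rw [mul_assoc _ (C _)]
        refine mul_le_mul (mul_le_mul_of_nonneg_left (hb _ _) (by positivity)) (hC _ ?_ _ _)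
          (norm_nonneg _) (mul_nonneg (by positivity) (hb0 _))
        have := Finset.mem_range.1 hi
        omega
      · simp only [Nat.choose_zero_right, Nat.cast_one, one_mul, norm_iteratedFDeriv_zero,
          Nat.sub_zero]
        rw [mul_assoc]
        exact mul_le_mul (hM y) (ihj y) (norm_nonneg _) hM0
    refine (norm_iteratedFDeriv_cauchyOp_le hR k s2 s3 h1 x).trans ?_
    have h2 : 0 ≤ ‖w₀‖ + 8 * R * D := by positivity
    have h3 : 2 * R * (D + M * (‖w₀‖ + 8 * R * D)) ≤ (‖w₀‖ + 8 * R * D) * (1 / 2) := by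
      have := mul_le_mul_of_nonneg_right hRM h2
      have h4 : 0 ≤ R * D := by positivity
      nlinarith [norm_nonneg w₀]
    calc 2 * R * ((D + M * (‖w₀‖ + 8 * R * D)) * (1 / 2) ^ j)
        = 2 * R * (D + M * (‖w₀‖ + 8 * R * D)) * (1 / 2) ^ j := by ring
      _ ≤ (‖w₀‖ + 8 * R * D) * (1 / 2) * (1 / 2) ^ j := by gcongr
      _ = _ := by ring

/-- Solutions of `w_z = B w` on a small disc, close to a given constant. -/
theorem exists_dz_eq_clm {p : ℂ} {r : ℝ} (hr : 0 < r) (hB : ContDiff ℝ ∞ B)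
    (h0 : ∀ y, r < dist y p → B y = 0) (hM : ∀ z, ‖B z‖ ≤ M) (hrM : 4 * r * M ≤ 1 / 8) (w₀ : E) :
    ∃ w : ℂ → E, ContDiff ℝ ∞ w ∧ (∀ z ∈ ball p r, dz w z = B z (w z)) ∧
      ∀ z, ‖w z - w₀‖ ≤ ‖w₀‖ / 4 := by
  have hc : HasCompactSupport B := HasCompactSupport.intro (isCompact_closedBall p r)
    fun y hy => h0 y (by simpa using hy)
  have hR : 0 ≤ 2 * r := by positivity
  have hRM : 2 * (2 * r) * M ≤ 1 / 8 := by linarith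
  set w := neumannTerm (2 * r) B w₀ with hw
  have hs := fun j => contDiff_neumannTerm (R := 2 * r) hB hc w₀ j
  choose C hC0 hC using exists_iteratedFDeriv_neumannTerm_le hR hB hc hM hRM w₀
  have hsum : ∀ k, Summable fun j : ℕ => C k * (1 / 2 : ℝ) ^ j := fun k =>
    summable_geometric_two.mul_left _
  have hnorm := norm_neumannTerm_le hR hM hRM w₀
  have hsum8 : Summable fun j : ℕ => ‖w₀‖ * (1 / 8 : ℝ) ^ j :=
    (summable_geometric_of_lt_one (by norm_num) (by norm_num)).mul_left _
  have hws : ∀ z, Summable fun j => w j z := fun z =>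
    Summable.of_norm_bounded hsum8 fun j => hnorm j z
  refine ⟨fun z => ∑' j, w j z, ?_, ?_, ?_⟩
  · exact contDiff_tsum (N := (⊤ : ℕ∞)) (v := fun k j => C k * (1 / 2 : ℝ) ^ j)
      (fun j => (hs j).1) (fun k _ => hsum k) (fun k j x _ => hC k j x)
  · intro z hz
    have hf1 : ∀ j x, ‖fderiv ℝ (w j) x‖ ≤ C 1 * (1 / 2 : ℝ) ^ j := fun j x => by
      rw [← norm_iteratedFDeriv_one]; exact hC 1 j x
    have hfs : Summable fun j => fderiv ℝ (w j) z :=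
      Summable.of_norm_bounded (hsum 1) fun j => hf1 j z
    have hfd : fderiv ℝ (fun z => ∑' j, w j z) z = ∑' j, fderiv ℝ (w j) z :=
      fderiv_tsum_apply (hsum 1) (fun j => (hs j).1.differentiable (by simp)) hf1 (hws z) z
    have hv : ∀ v, Summable fun j => fderiv ℝ (w j) z v := fun v =>
      hfs.mapL (ContinuousLinearMap.apply ℝ E v)
    have hv2 : ∀ v, fderiv ℝ (fun z => ∑' j, w j z) z v = ∑' j, fderiv ℝ (w j) z v := fun v => by
      rw [hfd]
      exact (ContinuousLinearMap.apply ℝ E v).map_tsum hfs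
    have hdz : dz (fun z => ∑' j, w j z) z = ∑' j, dz (w j) z := by
      simp only [dz, hv2]
      rw [tsum_const_smul'' , Summable.tsum_sub (hv 1) ((hv Complex.I).const_smul Complex.I),
        tsum_const_smul'']
    have hds : Summable fun j => dz (w j) z :=
      ((hv 1).sub ((hv Complex.I).const_smul Complex.I)).const_smul (1 / 2 : ℂ)
    -- The constant term has zero derivative and each later one satisfies (w_{j+1})_z = B w_j, so
    -- shifting the index gives the equation.
    rw [hdz, hds.tsum_eq_zero_add]
    have h00 : dz (w 0) z = 0 := dz_const w₀ z
    have hj : ∀ j, dz (w (j + 1)) z = B z (w j z) := fun j =>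
      dz_cauchyOp hr (hs j).2.1 (hs j).2.2 (fun y hy => by simp [h0 y hy]) hz
    simp only [h00, zero_add, hj]
    exact ((B z).map_tsum (hws z)).symm
  · intro z
    have h1 : (∑' j, w j z) - w₀ = ∑' j, w (j + 1) z := by
      rw [(hws z).tsum_eq_zero_add]
      have : w 0 z = w₀ := rfl
      rw [this]
      abel
    rw [h1]
    -- The geometric tail ∑_{j ≥ 1} 8^{-j} is 1/7, below the required 1/4.
    have h2 : HasSum (fun j : ℕ => ‖w₀‖ * (1 / 8 : ℝ) ^ (j + 1)) (‖w₀‖ / 7) := by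
      have := (hasSum_geometric_of_lt_one (r := (1 / 8 : ℝ)) (by norm_num) (by norm_num)).mul_left
        (‖w₀‖ * (1 / 8))
      have e1 : ‖w₀‖ * (1 / 8) * (1 - 1 / 8 : ℝ)⁻¹ = ‖w₀‖ / 7 := by norm_num; ring
      have e2 : (fun j : ℕ => ‖w₀‖ * (1 / 8) * (1 / 8 : ℝ) ^ j)
          = fun j : ℕ => ‖w₀‖ * (1 / 8 : ℝ) ^ (j + 1) := by funext j; ring
      rwa [e1, e2] at this
    have h3 := tsum_of_norm_bounded h2 fun j => hnorm (j + 1) z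
    have := norm_nonneg w₀
    linarith

end CauchyOperator

/-! ### Local solutions of the Riccati equation -/

section Riccati

open Set Metric

theorem contDiff_smul_of_tsupport_subset {X E : Type*} [NormedAddCommGroup X] [NormedSpace ℝ X]
    [NormedAddCommGroup E] [NormedSpace ℝ E] {Ω : Set X} (hΩ : IsOpen Ω) {χ : X → ℝ} {g : X → E}
    (hχ : ContDiff ℝ ∞ χ) (hs : tsupport χ ⊆ Ω) (hg : ContDiffOn ℝ ∞ g Ω) :
    ContDiff ℝ ∞ fun z => χ z • g z := by
  rw [contDiff_iff_contDiffAt]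
  intro z
  by_cases hz : z ∈ tsupport χ
  · exact hχ.contDiffAt.smul (hg.contDiffAt (hΩ.mem_nhds (hs hz)))
  · have h : (fun z => χ z • g z) =ᶠ[nhds z] fun _ => 0 := by
      filter_upwards [(isClosed_tsupport χ).isOpen_compl.mem_nhds hz] with w hw
      rw [image_eq_zero_of_notMem_tsupport hw, zero_smul]
    exact contDiffAt_const.congr_of_eventuallyEq h

theorem dz_fst_snd {w : ℂ → ℂ × ℂ} {z : ℂ} (hw : DifferentiableAt ℝ w z) :
    dz (fun x => (w x).1) z = (dz w z).1 ∧ dz (fun x => (w x).2) z = (dz w z).2 := by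
  constructor
  · simp [dz, fderiv.fst hw]
  · simp [dz, fderiv.snd hw]

/-- Local solutions of `φ_z = ψ`, `ψ_z = -(s/2) φ` with values near any given constant. -/
theorem exists_dz_system {Ω : Set ℂ} (hΩ : IsOpen Ω) {s : ℂ → ℂ} (hs : ContDiffOn ℝ ∞ s Ω) {p : ℂ}
    (hp : p ∈ Ω) : ∃ r > 0, ball p r ⊆ Ω ∧ ∀ a b : ℂ, ∃ φ ψ : ℂ → ℂ, ContDiff ℝ ∞ φ ∧
      ContDiff ℝ ∞ ψ ∧ (∀ z ∈ ball p r, dz φ z = ψ z) ∧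
      (∀ z ∈ ball p r, dz ψ z = -(s z / 2) * φ z) ∧
      ∀ z, ‖φ z - a‖ ≤ ‖(a, b)‖ / 4 ∧ ‖ψ z - b‖ ≤ ‖(a, b)‖ / 4 := by
  obtain ⟨r₀, hr₀, hball⟩ := nhds_basis_closedBall.mem_iff.1 (hΩ.mem_nhds hp)
  obtain ⟨S, hS⟩ := (isCompact_closedBall p r₀).exists_bound_of_continuousOn
    (hs.continuousOn.mono hball)
  have hS0 : 0 ≤ S := (norm_nonneg _).trans (hS p (mem_closedBall_self hr₀.le))
  set J₁ : ℂ × ℂ →L[ℝ] ℂ × ℂ :=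
    (ContinuousLinearMap.inl ℝ ℂ ℂ).comp (ContinuousLinearMap.snd ℝ ℂ ℂ) with hJ₁
  set J₂ : ℂ × ℂ →L[ℝ] ℂ × ℂ :=
    (ContinuousLinearMap.inr ℝ ℂ ℂ).comp (ContinuousLinearMap.fst ℝ ℂ ℂ) with hJ₂
  -- Matrix of the system: (φ, ψ) ↦ (ψ, -(s/2) φ).
  set A : ℂ → ℂ × ℂ →L[ℝ] ℂ × ℂ := fun z => J₁ + (-(s z / 2)) • J₂ with hA
  have hAs : ContDiffOn ℝ ∞ A Ω :=
    contDiffOn_const.add ((hs.div_const 2).neg.smul contDiffOn_const)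
  set M : ℝ := ‖J₁‖ + S / 2 * ‖J₂‖ with hM
  have hM0 : 0 ≤ M := by positivity
  have hAM : ∀ z ∈ closedBall p r₀, ‖A z‖ ≤ M := by
    intro z hz
    refine (norm_add_le _ _).trans (add_le_add_right ?_ _)
    rw [norm_smul]
    gcongr
    rw [norm_neg, norm_div, Complex.norm_ofNat]
    linarith [hS z hz]
  -- The factor 32 yields 4rM ≤ 1/8, and M + 1 keeps the denominator positive.
  set r : ℝ := min r₀ (1 / (32 * (M + 1))) with hr
  have hr0 : 0 < r := lt_min hr₀ (by positivity)
  have hrr : closedBall p r ⊆ closedBall p r₀ := closedBall_subset_closedBall (min_le_left _ _)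
  -- The cutoff makes the coefficient globally smooth with support in the disc of radius r. It
  -- equals 1 only on the disc of radius r/2, where the original system is recovered.
  let χ : ContDiffBump p := ⟨r / 2, r, by positivity, by linarith⟩
  have hts : tsupport χ = closedBall p r := χ.tsupport_eq
  have hB : ContDiff ℝ ∞ fun z => χ z • A z :=
    contDiff_smul_of_tsupport_subset hΩ χ.contDiff (by rw [hts]; exact hrr.trans hball) hAs
  have h0 : ∀ y, r < dist y p → χ y • A y = 0 := fun y hy => by
    rw [χ.zero_of_le_dist hy.le]
    exact zero_smul ℝ (A y)
  have hBM : ∀ z, ‖χ z • A z‖ ≤ M := by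
    intro z
    by_cases hz : z ∈ closedBall p r
    · rw [norm_smul, Real.norm_of_nonneg χ.nonneg]
      calc χ z * ‖A z‖ ≤ 1 * M :=
            mul_le_mul χ.le_one (hAM z (hrr hz)) (norm_nonneg _) zero_le_one
        _ = M := one_mul M
    · rw [h0 z (by simpa using hz)]
      simpa using hM0
  have hrM : 4 * r * M ≤ 1 / 8 := by
    have h1 : r * (M + 1) ≤ 1 / 32 := by
      have := mul_le_mul_of_nonneg_right (min_le_right r₀ (1 / (32 * (M + 1))))
        (by positivity : 0 ≤ M + 1)
      refine this.trans (le_of_eq ?_)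
      field_simp
    nlinarith
  refine ⟨r / 2, by positivity, (ball_subset_closedBall.trans
    (closedBall_subset_closedBall (by linarith))).trans (hrr.trans hball), fun a b => ?_⟩
  obtain ⟨w, hws, hw, hwn⟩ := exists_dz_eq_clm hr0 hB h0 hBM hrM (a, b)
  have hwd : ∀ z, DifferentiableAt ℝ w z := fun z => hws.differentiable (by simp) z
  have hwA : ∀ z ∈ ball p (r / 2), dz w z = ((w z).2, -(s z / 2) * (w z).1) := by
    intro z hz
    rw [hw z (ball_subset_ball (by linarith) hz),
      χ.one_of_mem_closedBall (ball_subset_closedBall hz)]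
    simp [hA, hJ₁, hJ₂]
  refine ⟨fun z => (w z).1, fun z => (w z).2, contDiff_fst.comp hws, contDiff_snd.comp hws,
    fun z hz => ?_, fun z hz => ?_, fun z => ?_⟩
  · rw [(dz_fst_snd (hwd z)).1, hwA z hz]
  · rw [(dz_fst_snd (hwd z)).2, hwA z hz]
  · exact ⟨(norm_fst_le (w z - (a, b))).trans (hwn z), (norm_snd_le (w z - (a, b))).trans (hwn z)⟩

/-- If φ_z = ψ and ψ_z = -(s/2) φ, then μ = -2ψ/φ satisfies μ_z = μ²/2 + s wherever φ ≠ 0. Two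
solution pairs, close to (1, 0) and (0, 1), are combined with a real parameter t in [0, 1]. Then |φ
- 1| ≤ 1/2, so φ has no zero, and different t give different values at p. -/
theorem exists_riccati {Ω : Set ℂ} (hΩ : IsOpen Ω) {s : ℂ → ℂ} (hs : ContDiffOn ℝ ∞ s Ω) {p : ℂ}
    (hp : p ∈ Ω) : ∃ V : Set ℂ, IsOpen V ∧ p ∈ V ∧ V ⊆ Ω ∧
      {m : ℂ | ∃ μ : ℂ → ℂ, ContDiffOn ℝ ∞ μ V ∧ (∀ z ∈ V, dz μ z - μ z ^ 2 / 2 - s z = 0) ∧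
        μ p = m}.Infinite := by
  obtain ⟨r, hr, hball, h⟩ := exists_dz_system hΩ hs hp
  obtain ⟨φ₁, ψ₁, sφ₁, sψ₁, eφ₁, eψ₁, b₁⟩ := h 1 0
  obtain ⟨φ₂, ψ₂, sφ₂, sψ₂, eφ₂, eψ₂, b₂⟩ := h 0 1
  have n1 : ‖((1 : ℂ), (0 : ℂ))‖ = 1 := by simp [Prod.norm_def]
  have n2 : ‖((0 : ℂ), (1 : ℂ))‖ = 1 := by simp [Prod.norm_def]
  rw [n1] at b₁
  rw [n2] at b₂
  refine ⟨ball p r, isOpen_ball, mem_ball_self hr, hball, ?_⟩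
  set φ : ℝ → ℂ → ℂ := fun t z => φ₁ z + (t : ℂ) * φ₂ z with hφ
  set ψ : ℝ → ℂ → ℂ := fun t z => ψ₁ z + (t : ℂ) * ψ₂ z with hψ
  have hne : ∀ t ∈ Icc (0 : ℝ) 1, ∀ z, φ t z ≠ 0 := by
    intro t ht z h0
    have h1 := (b₁ z).1
    have h2 : ‖(t : ℂ) * φ₂ z‖ ≤ 1 / 4 := by
      have h3 := (b₂ z).1
      rw [sub_zero] at h3
      rw [norm_mul, Complex.norm_real, Real.norm_of_nonneg ht.1]
      nlinarith [norm_nonneg (φ₂ z), ht.2]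
    have h4 : (1 : ℂ) = -(φ₁ z - 1) - (t : ℂ) * φ₂ z := by
      linear_combination h0
    have h5 : (1 : ℝ) ≤ 1 / 4 + 1 / 4 := by
      calc (1 : ℝ) = ‖(1 : ℂ)‖ := by simp
        _ = ‖-(φ₁ z - 1) - (t : ℂ) * φ₂ z‖ := by rw [← h4]
        _ ≤ ‖-(φ₁ z - 1)‖ + ‖(t : ℂ) * φ₂ z‖ := norm_sub_le _ _
        _ ≤ 1 / 4 + 1 / 4 := add_le_add (by rwa [norm_neg]) h2
    norm_num at h5
  have hsφ : ∀ t, ContDiff ℝ ∞ (φ t) := fun t => sφ₁.add (contDiff_const.mul sφ₂)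
  have hsψ : ∀ t, ContDiff ℝ ∞ (ψ t) := fun t => sψ₁.add (contDiff_const.mul sψ₂)
  have dd : ∀ {g : ℂ → ℂ}, ContDiff ℝ ∞ g → ∀ z, DifferentiableAt ℝ g z := fun hg z =>
    hg.differentiable (by simp) z
  have hdφ : ∀ t, ∀ z ∈ ball p r, dz (φ t) z = ψ t z := by
    intro t z hz
    have := dz_add (dd sφ₁ z) ((dd sφ₂ z).const_mul (t : ℂ))
    rw [this, eφ₁ z hz]
    have h2 := dz_const_smul (t : ℂ) (dd sφ₂ z)
    simp only [smul_eq_mul] at h2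
    rw [h2, eφ₂ z hz]
  have hdψ : ∀ t, ∀ z ∈ ball p r, dz (ψ t) z = -(s z / 2) * φ t z := by
    intro t z hz
    have := dz_add (dd sψ₁ z) ((dd sψ₂ z).const_mul (t : ℂ))
    rw [this, eψ₁ z hz]
    have h2 := dz_const_smul (t : ℂ) (dd sψ₂ z)
    simp only [smul_eq_mul] at h2
    rw [h2, eψ₂ z hz]
    simp only [hφ]
    ring
  refine Set.infinite_of_injOn_mapsTo (s := Icc (0 : ℝ) 1)
    (f := fun t => -2 * ψ t p / φ t p) ?_ ?_ (Icc_infinite zero_lt_one)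
  · intro t ht t' ht' h
    have h1 := hne t ht p
    have h2 := hne t' ht' p
    simp only at h
    rw [div_eq_div_iff h1 h2] at h
    -- Equality of the quotients forces t = t' unless the Wronskian φ₁ψ₂ - φ₂ψ₁ vanishes at p. It
    -- does not: |φ₁ψ₂| ≥ 9/16, whereas |φ₂ψ₁| ≤ 1/16.
    have h3 : ((t : ℂ) - t') * (φ₁ p * ψ₂ p - φ₂ p * ψ₁ p) = 0 := by
      simp only [hφ, hψ] at h
      linear_combination (-1 / 2 : ℂ) * h
    rcases mul_eq_zero.1 h3 with h4 | h4
    · exact_mod_cast sub_eq_zero.1 h4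
    · exfalso
      have c1 := (b₁ p).1
      have c2 := (b₁ p).2
      have c3 := (b₂ p).1
      have c4 := (b₂ p).2
      rw [sub_zero] at c2 c3
      have l1 : 3 / 4 ≤ ‖φ₁ p‖ := by
        have := norm_sub_norm_le (1 : ℂ) (φ₁ p)
        rw [norm_one, norm_sub_rev] at this
        linarith
      have l4 : 3 / 4 ≤ ‖ψ₂ p‖ := by
        have := norm_sub_norm_le (1 : ℂ) (ψ₂ p)
        rw [norm_one, norm_sub_rev] at this
        linarith
      have h5 : ‖φ₁ p‖ * ‖ψ₂ p‖ = ‖φ₂ p‖ * ‖ψ₁ p‖ := by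
        rw [← norm_mul, ← norm_mul, sub_eq_zero.1 h4]
      nlinarith [norm_nonneg (φ₂ p), norm_nonneg (ψ₁ p)]
  · intro t ht
    have hμ : ContDiff ℝ ∞ fun z => -2 * ψ t z / φ t z :=
      (contDiff_const.mul (hsψ t)).mul ((hsφ t).inv (hne t ht))
    refine ⟨fun z => -2 * ψ t z / φ t z, hμ.contDiffOn, fun z hz => ?_, rfl⟩
    have h0 := hne t ht z
    -- Differentiating φ μ = -2ψ avoids a quotient rule.
    have e1 : (fun z => φ t z * (-2 * ψ t z / φ t z)) = fun z => (-2 : ℂ) • ψ t z := by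
      funext z
      have := hne t ht z
      rw [smul_eq_mul]
      field_simp
    have e2 := dz_mul (dd (hsφ t) z) (dd hμ z)
    rw [e1, dz_const_smul _ (dd (hsψ t) z), hdφ t z hz, hdψ t z hz, smul_eq_mul] at e2
    refine mul_left_cancel₀ h0 ?_
    rw [mul_zero]
    have e3 : φ t z * (-2 * ψ t z / φ t z) = -2 * ψ t z := by field_simp
    linear_combination -e2 - (-2 * ψ t z / φ t z) / 2 * e3

end Riccati

/-! ### The Möbius density of a light-like lift -/

section GramDensity

variable {n : ℕ}

/-- The real part of the Minkowski form, as a real bilinear form. -/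
def rm (x y : Mink n) : ℝ := (mink x y).re

theorem mink_real_smul_left (a : ℝ) (x y : Mink n) : mink (a • x) y = a * mink x y := by
  rw [← mink_smul_left]; rfl

theorem mink_real_smul_right (a : ℝ) (x y : Mink n) : mink x (a • y) = a * mink x y := by
  rw [mink_comm, mink_real_smul_left, mink_comm]

theorem rm_comm (x y : Mink n) : rm x y = rm y x := by rw [rm, mink_comm]; rfl

@[simp] theorem rm_add_left (x y w : Mink n) : rm (x + y) w = rm x w + rm y w := by simp [rm]

@[simp] theorem rm_add_right (x y w : Mink n) : rm w (x + y) = rm w x + rm w y := by simp [rm]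

@[simp] theorem rm_sub_left (x y w : Mink n) : rm (x - y) w = rm x w - rm y w := by simp [rm]

@[simp] theorem rm_sub_right (x y w : Mink n) : rm w (x - y) = rm w x - rm w y := by simp [rm]

@[simp] theorem rm_smul_left (a : ℝ) (x w : Mink n) : rm (a • x) w = a * rm x w := by
  simp [rm, mink_real_smul_left]

@[simp] theorem rm_smul_right (a : ℝ) (x w : Mink n) : rm w (a • x) = a * rm w x := by
  simp [rm, mink_real_smul_right]

/-- The determinant of the first fundamental form. -/
def gramDet (x₁ x₂ : Mink n) : ℝ := rm x₁ x₁ * rm x₂ x₂ - rm x₁ x₂ ^ 2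

/-- The component of `y` orthogonal to `x₁` and `x₂`. -/
def orthPart (x₁ x₂ y : Mink n) : Mink n :=
  y - ((rm x₂ x₂ * rm y x₁ - rm x₁ x₂ * rm y x₂) / gramDet x₁ x₂) • x₁
    - ((rm x₁ x₁ * rm y x₂ - rm x₁ x₂ * rm y x₁) / gramDet x₁ x₂) • x₂

/-- The trace of a symmetric bilinear map with values `h₁₁, h₁₂, h₂₂`, times the determinant of the
first fundamental form. -/
def gramTrace (x₁ x₂ h₁₁ h₁₂ h₂₂ : Mink n) : Mink n :=
  rm x₂ x₂ • h₁₁ - (2 * rm x₁ x₂) • h₁₂ + rm x₁ x₁ • h₂₂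

/-- The quantity `4 det² (|H|² - K)` of a second fundamental form with values `h₁₁, h₁₂, h₂₂`. -/
def gramNum (x₁ x₂ h₁₁ h₁₂ h₂₂ : Mink n) : ℝ :=
  rm (gramTrace x₁ x₂ h₁₁ h₁₂ h₂₂) (gramTrace x₁ x₂ h₁₁ h₁₂ h₂₂)
    - 4 * gramDet x₁ x₂ * (rm h₁₁ h₂₂ - rm h₁₂ h₁₂)

/-- The Möbius density of a second fundamental form with values `h₁₁, h₁₂, h₂₂`. -/
def gramDensity (x₁ x₂ h₁₁ h₁₂ h₂₂ : Mink n) : ℝ :=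
  gramNum x₁ x₂ h₁₁ h₁₂ h₂₂ * Real.sqrt (gramDet x₁ x₂) / (16 * gramDet x₁ x₂ ^ 2)

/-- The Möbius density of a light-like lift `X` in terms of its derivatives. -/
def liftDensity (x₁ x₂ x₁₁ x₁₂ x₂₂ : Mink n) : ℝ :=
  gramDensity x₁ x₂ (orthPart x₁ x₂ x₁₁) (orthPart x₁ x₂ x₁₂) (orthPart x₁ x₂ x₂₂)

theorem orthPart_add (x₁ x₂ y w : Mink n) :
    orthPart x₁ x₂ (y + w) = orthPart x₁ x₂ y + orthPart x₁ x₂ w := by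
  simp only [orthPart, rm_add_left, mul_add, sub_div, add_div]
  module

theorem orthPart_smul (x₁ x₂ y : Mink n) (a : ℝ) :
    orthPart x₁ x₂ (a • y) = a • orthPart x₁ x₂ y := by
  have h1 : (rm x₂ x₂ * rm (a • y) x₁ - rm x₁ x₂ * rm (a • y) x₂) / gramDet x₁ x₂
      = a * ((rm x₂ x₂ * rm y x₁ - rm x₁ x₂ * rm y x₂) / gramDet x₁ x₂) := by
    simp only [rm_smul_left]; ring
  have h2 : (rm x₁ x₁ * rm (a • y) x₂ - rm x₁ x₂ * rm (a • y) x₁) / gramDet x₁ x₂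
      = a * ((rm x₁ x₁ * rm y x₂ - rm x₁ x₂ * rm y x₁) / gramDet x₁ x₂) := by
    simp only [rm_smul_left]; ring
  rw [orthPart, h1, h2, orthPart]
  module

theorem orthPart_eq_self {x₁ x₂ y : Mink n} (h1 : rm y x₁ = 0) (h2 : rm y x₂ = 0) :
    orthPart x₁ x₂ y = y := by
  simp [orthPart, h1, h2]

theorem orthPart_left {x₁ x₂ : Mink n} (hd : gramDet x₁ x₂ ≠ 0) : orthPart x₁ x₂ x₁ = 0 := by
  have h1 : (rm x₂ x₂ * rm x₁ x₁ - rm x₁ x₂ * rm x₁ x₂) / gramDet x₁ x₂ = 1 := by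
    rw [div_eq_one_iff_eq hd, gramDet]; ring
  have h2 : (rm x₁ x₁ * rm x₁ x₂ - rm x₁ x₂ * rm x₁ x₁) / gramDet x₁ x₂ = 0 := by
    rw [div_eq_zero_iff]; left; ring
  rw [orthPart, h1, h2]
  module

theorem orthPart_right {x₁ x₂ : Mink n} (hd : gramDet x₁ x₂ ≠ 0) : orthPart x₁ x₂ x₂ = 0 := by
  have h1 : (rm x₂ x₂ * rm x₂ x₁ - rm x₁ x₂ * rm x₂ x₂) / gramDet x₁ x₂ = 0 := by
    rw [div_eq_zero_iff]; left; rw [rm_comm x₂ x₁]; ring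
  have h2 : (rm x₁ x₁ * rm x₂ x₂ - rm x₁ x₂ * rm x₂ x₁) / gramDet x₁ x₂ = 1 := by
    rw [div_eq_one_iff_eq hd, gramDet, rm_comm x₂ x₁]; ring
  rw [orthPart, h1, h2]
  module

/-- `gramNum` does not change when a pure trace part and multiples of a light-like normal vector
are added, and scales with the lift. -/
theorem gramNum_change {x₁ x₂ X₁ X₂ x v h₁₁ h₁₂ h₂₂ : Mink n} {l c₁₁ c₁₂ c₂₂ : ℝ}
    (g₁₁ : rm X₁ X₁ = l ^ 2 * rm x₁ x₁) (g₁₂ : rm X₁ X₂ = l ^ 2 * rm x₁ x₂)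
    (g₂₂ : rm X₂ X₂ = l ^ 2 * rm x₂ x₂) (hx : rm x x = 0) (hx₁ : rm x h₁₁ = 0)
    (hx₂ : rm x h₁₂ = 0) (hx₃ : rm x h₂₂ = 0) :
    gramNum X₁ X₂ (l • h₁₁ + c₁₁ • x + rm x₁ x₁ • v) (l • h₁₂ + c₁₂ • x + rm x₁ x₂ • v)
      (l • h₂₂ + c₂₂ • x + rm x₂ x₂ • v) = l ^ 6 * gramNum x₁ x₂ h₁₁ h₁₂ h₂₂ := by
  have hx₁' : rm h₁₁ x = 0 := by rw [rm_comm, hx₁]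
  have hx₂' : rm h₁₂ x = 0 := by rw [rm_comm, hx₂]
  have hx₃' : rm h₂₂ x = 0 := by rw [rm_comm, hx₃]
  simp only [gramNum, gramTrace, gramDet, g₁₁, g₁₂, g₂₂, rm_add_left, rm_add_right, rm_sub_left,
    rm_sub_right, rm_smul_left, rm_smul_right, hx, hx₁, hx₂, hx₃, hx₁', hx₂', hx₃',
    rm_comm v x, rm_comm v h₁₁, rm_comm v h₁₂, rm_comm v h₂₂, rm_comm h₁₂ h₁₁, rm_comm h₂₂ h₁₁,
    rm_comm h₂₂ h₁₂]
  ring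

/-- The Möbius density of the lift `λ (1, F)` is that of `F`. -/
theorem liftDensity_eq {x x₁ x₂ e h₁₁ h₁₂ h₂₂ X₁ X₂ X₁₁ X₁₂ X₂₂ : Mink n}
    {l l₁ l₂ a₁₁ b₁₁ d₁₁ a₁₂ b₁₂ d₁₂ a₂₂ b₂₂ d₂₂ : ℝ} (hl : l ≠ 0) (hd : gramDet x₁ x₂ ≠ 0)
    (hx : rm x x = 0) (hx₁ : rm x x₁ = 0) (hx₂ : rm x x₂ = 0)
    (k₁ : rm x h₁₁ = 0) (k₂ : rm x h₁₂ = 0) (k₃ : rm x h₂₂ = 0)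
    (m₁ : rm h₁₁ x₁ = 0) (m₂ : rm h₁₁ x₂ = 0) (m₃ : rm h₁₂ x₁ = 0) (m₄ : rm h₁₂ x₂ = 0)
    (m₅ : rm h₂₂ x₁ = 0) (m₆ : rm h₂₂ x₂ = 0)
    (e₁ : X₁ = l • x₁ + l₁ • x) (e₂ : X₂ = l • x₂ + l₂ • x)
    (e₁₁ : X₁₁ = l • h₁₁ + (-l * rm x₁ x₁) • e + a₁₁ • x₁ + b₁₁ • x₂ + d₁₁ • x)
    (e₁₂ : X₁₂ = l • h₁₂ + (-l * rm x₁ x₂) • e + a₁₂ • x₁ + b₁₂ • x₂ + d₁₂ • x)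
    (e₂₂ : X₂₂ = l • h₂₂ + (-l * rm x₂ x₂) • e + a₂₂ • x₁ + b₂₂ • x₂ + d₂₂ • x) :
    liftDensity X₁ X₂ X₁₁ X₁₂ X₂₂ = gramDensity x₁ x₂ h₁₁ h₁₂ h₂₂ := by
  have hx₁' : rm x₁ x = 0 := by rw [rm_comm, hx₁]
  have hx₂' : rm x₂ x = 0 := by rw [rm_comm, hx₂]
  have g₁₁ : rm X₁ X₁ = l ^ 2 * rm x₁ x₁ := by rw [e₁]; simp [hx, hx₁, hx₁']; ring
  have g₁₂ : rm X₁ X₂ = l ^ 2 * rm x₁ x₂ := by rw [e₁, e₂]; simp [hx, hx₂, hx₁']; ring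
  have g₂₂ : rm X₂ X₂ = l ^ 2 * rm x₂ x₂ := by rw [e₂]; simp [hx, hx₂, hx₂']; ring
  have hD : gramDet X₁ X₂ = (l ^ 2) ^ 2 * gramDet x₁ x₂ := by
    simp only [gramDet, g₁₁, g₁₂, g₂₂]; ring
  have hD0 : gramDet X₁ X₂ ≠ 0 := by
    rw [hD]; exact mul_ne_zero (by positivity) hd
  have ox : orthPart X₁ X₂ x = x := orthPart_eq_self (by rw [e₁]; simp [hx, hx₁])
    (by rw [e₂]; simp [hx, hx₂])
  have oh : ∀ h : Mink n, rm x h = 0 → rm h x₁ = 0 → rm h x₂ = 0 → orthPart X₁ X₂ h = h := by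
    intro h q1 q2 q3
    rw [rm_comm] at q1
    exact orthPart_eq_self (by rw [e₁]; simp [q1, q2]) (by rw [e₂]; simp [q1, q3])
  have ox₁ : orthPart X₁ X₂ x₁ = (-(l⁻¹ * l₁)) • x := by
    have : x₁ = l⁻¹ • X₁ + (-(l⁻¹ * l₁)) • x := by
      rw [e₁, smul_add, smul_smul, smul_smul, inv_mul_cancel₀ hl]; module
    conv_lhs => rw [this]
    rw [orthPart_add, orthPart_smul, orthPart_smul, orthPart_left hD0, ox, smul_zero, zero_add]
  have ox₂ : orthPart X₁ X₂ x₂ = (-(l⁻¹ * l₂)) • x := by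
    have : x₂ = l⁻¹ • X₂ + (-(l⁻¹ * l₂)) • x := by
      rw [e₂, smul_add, smul_smul, smul_smul, inv_mul_cancel₀ hl]; module
    conv_lhs => rw [this]
    rw [orthPart_add, orthPart_smul, orthPart_smul, orthPart_right hD0, ox, smul_zero, zero_add]
  -- Orthogonally to X₁ and X₂, a second derivative of X becomes l h plus a multiple of x plus its
  -- metric coefficient times one fixed vector. The last part is pure trace, so `gramNum_change`
  -- removes both corrections.
  have key : ∀ (h : Mink n) (g a b d : ℝ), orthPart X₁ X₂ h = h →
      orthPart X₁ X₂ (l • h + (-l * g) • e + a • x₁ + b • x₂ + d • x)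
        = l • h + (a * (-(l⁻¹ * l₁)) + b * (-(l⁻¹ * l₂)) + d) • x
          + g • ((-l) • orthPart X₁ X₂ e) := by
    intro h g a b d q
    simp only [orthPart_add, orthPart_smul, q, ox, ox₁, ox₂]
    module
  -- The powers of l cancel: l⁶ from `gramNum`, l² from the root of the determinant, l⁸ from its
  -- square below.
  rw [liftDensity, gramDensity, e₁₁, e₁₂, e₂₂, key _ _ _ _ _ (oh _ k₁ m₁ m₂),
    key _ _ _ _ _ (oh _ k₂ m₃ m₄), key _ _ _ _ _ (oh _ k₃ m₅ m₆),
    gramNum_change g₁₁ g₁₂ g₂₂ hx k₁ k₂ k₃, hD, gramDensity, Real.sqrt_mul (by positivity),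
    Real.sqrt_sq (by positivity)]
  field_simp

/-- `rm` as a continuous bilinear map. -/
def rmL (n : ℕ) : Mink n →L[ℝ] Mink n →L[ℝ] ℝ :=
  (ContinuousLinearMap.compL ℝ (Mink n) ℂ ℝ Complex.reCLM).comp
    ((minkL n).bilinearRestrictScalars ℝ)

theorem hasDerivAt_rm {x y : ℝ → Mink n} {x' y' : Mink n} {t : ℝ} (hx : HasDerivAt x x' t)
    (hy : HasDerivAt y y' t) :
    HasDerivAt (fun t => rm (x t) (y t)) (rm (x t) y' + rm x' (y t)) t :=
  (rmL n).hasDerivAt_of_bilinear (fun _ => hx) (fun _ => hy)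

/-- The derivative of the density along a family that starts at a conformal point. -/
theorem hasDerivAt_liftDensity {X₁ X₂ X₁₁ X₁₂ X₂₂ : ℝ → Mink n}
    {a₁ a₂ a₁₁ a₁₂ a₂₂ b₁ b₂ b₁₁ b₁₂ b₂₂ : Mink n}
    (h₁ : HasDerivAt X₁ b₁ 0) (h₂ : HasDerivAt X₂ b₂ 0) (h₁₁ : HasDerivAt X₁₁ b₁₁ 0)
    (h₁₂ : HasDerivAt X₁₂ b₁₂ 0) (h₂₂ : HasDerivAt X₂₂ b₂₂ 0)
    (i₁ : X₁ 0 = a₁) (i₂ : X₂ 0 = a₂) (i₁₁ : X₁₁ 0 = a₁₁) (i₁₂ : X₁₂ 0 = a₁₂) (i₂₂ : X₂₂ 0 = a₂₂)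
    (g₁₁ : rm a₁ a₁ = 1) (g₁₂ : rm a₁ a₂ = 0) (g₂₂ : rm a₂ a₂ = 1)
    (m₁ : rm a₁₁ a₁ = 0) (m₂ : rm a₁₁ a₂ = 0) (m₃ : rm a₁₂ a₁ = 0) (m₄ : rm a₁₂ a₂ = 0)
    (m₅ : rm a₂₂ a₁ = 0) (m₆ : rm a₂₂ a₂ = 0) (hdet : rm a₁ b₁ + rm a₂ b₂ = 0) :
    HasDerivAt (fun t => liftDensity (X₁ t) (X₂ t) (X₁₁ t) (X₁₂ t) (X₂₂ t))
      ((2 * rm (a₁₁ - a₂₂) (b₁₁ - b₂₂) + 8 * rm a₁₂ b₁₂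
        + 2 * rm (a₁₁ + a₂₂) ((2 * rm a₁ b₁) • (a₂₂ - a₁₁)
          - (2 * (rm a₁ b₂ + rm a₂ b₁)) • a₁₂)) / 16) 0 := by
  have c₁₁ : HasDerivAt (fun t => rm (X₁ t) (X₁ t)) (2 * rm a₁ b₁) 0 := by
    have h := hasDerivAt_rm h₁ h₁
    rw [i₁, rm_comm b₁] at h
    rwa [two_mul]
  have c₂₂ : HasDerivAt (fun t => rm (X₂ t) (X₂ t)) (-(2 * rm a₁ b₁)) 0 := by
    have h := hasDerivAt_rm h₂ h₂
    rw [i₂, rm_comm b₂] at h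
    have e : -(2 * rm a₁ b₁) = rm a₂ b₂ + rm a₂ b₂ := by linarith
    rwa [e]
  have c₁₂ : HasDerivAt (fun t => rm (X₁ t) (X₂ t)) (rm a₁ b₂ + rm a₂ b₁) 0 := by
    have h := hasDerivAt_rm h₁ h₂
    rwa [i₁, i₂, rm_comm b₁] at h
  -- The metric varies without trace (`hdet`), so its determinant is stationary at t = 0.
  have cD : HasDerivAt (fun t => gramDet (X₁ t) (X₂ t)) 0 0 := by
    refine HasDerivAt.congr_deriv (f := fun t => gramDet (X₁ t) (X₂ t))
      ((c₁₁.mul c₂₂).sub (c₁₂.pow 2)) ?_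
    rw [i₁, i₂, g₁₁, g₁₂, g₂₂]
    norm_num
  have D0 : gramDet (X₁ 0) (X₂ 0) = 1 := by simp [gramDet, i₁, i₂, g₁₁, g₁₂, g₂₂]
  -- The derivative of the normal part is needed only modulo a₁ and a₂: `p` and `q` remain
  -- unspecified because the second derivatives at t = 0 are orthogonal to both.
  have orth : ∀ {X : ℝ → Mink n} {a b : Mink n}, HasDerivAt X b 0 → X 0 = a → rm a a₁ = 0 →
      rm a a₂ = 0 → ∃ p q : ℝ,
        HasDerivAt (fun t => orthPart (X₁ t) (X₂ t) (X t)) (b - p • a₁ - q • a₂) 0 := by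
    intro X a b hX i q1 q2
    have d1 := hasDerivAt_rm hX h₁
    have d2 := hasDerivAt_rm hX h₂
    have D0' : gramDet (X₁ 0) (X₂ 0) ≠ 0 := by rw [D0]; exact one_ne_zero
    obtain ⟨p, hp⟩ : ∃ p : ℝ, HasDerivAt (fun t => (rm (X₂ t) (X₂ t) * rm (X t) (X₁ t)
        - rm (X₁ t) (X₂ t) * rm (X t) (X₂ t)) / gramDet (X₁ t) (X₂ t)) p 0 :=
      ⟨_, ((c₂₂.mul d1).sub (c₁₂.mul d2)).div cD D0'⟩
    obtain ⟨q, hq⟩ : ∃ q : ℝ, HasDerivAt (fun t => (rm (X₁ t) (X₁ t) * rm (X t) (X₂ t)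
        - rm (X₁ t) (X₂ t) * rm (X t) (X₁ t)) / gramDet (X₁ t) (X₂ t)) q 0 :=
      ⟨_, ((c₁₁.mul d2).sub (c₁₂.mul d1)).div cD D0'⟩
    refine ⟨p, q, HasDerivAt.congr_deriv (f := fun t => orthPart (X₁ t) (X₂ t) (X t))
      ((hX.sub (hp.smul h₁)).sub (hq.smul h₂)) ?_⟩
    simp only [i, i₁, i₂, q1, q2, mul_zero, sub_self, zero_div, zero_smul, zero_add]
  have n0 : ∀ {X : ℝ → Mink n} {a : Mink n}, X 0 = a → rm a a₁ = 0 → rm a a₂ = 0 →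
      orthPart (X₁ 0) (X₂ 0) (X 0) = a := by
    intro X a i q1 q2
    rw [i, i₁, i₂, orthPart_eq_self q1 q2]
  obtain ⟨p1, q1, o₁₁⟩ := orth h₁₁ i₁₁ m₁ m₂
  obtain ⟨p2, q2, o₁₂⟩ := orth h₁₂ i₁₂ m₃ m₄
  obtain ⟨p3, q3, o₂₂⟩ := orth h₂₂ i₂₂ m₅ m₆
  set H₁₁ : ℝ → Mink n := fun t => orthPart (X₁ t) (X₂ t) (X₁₁ t) with hH₁₁
  set H₁₂ : ℝ → Mink n := fun t => orthPart (X₁ t) (X₂ t) (X₁₂ t) with hH₁₂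
  set H₂₂ : ℝ → Mink n := fun t => orthPart (X₁ t) (X₂ t) (X₂₂ t) with hH₂₂
  have z₁₁ : H₁₁ 0 = a₁₁ := n0 i₁₁ m₁ m₂
  have z₁₂ : H₁₂ 0 = a₁₂ := n0 i₁₂ m₃ m₄
  have z₂₂ : H₂₂ 0 = a₂₂ := n0 i₂₂ m₅ m₆
  have T0 : gramTrace (X₁ 0) (X₂ 0) (H₁₁ 0) (H₁₂ 0) (H₂₂ 0) = a₁₁ + a₂₂ := by
    rw [gramTrace, z₁₁, z₁₂, z₂₂, i₁, i₂, g₁₁, g₁₂, g₂₂]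
    module
  have cT : HasDerivAt (fun t => gramTrace (X₁ t) (X₂ t) (H₁₁ t) (H₁₂ t) (H₂₂ t))
      ((b₁₁ - p1 • a₁ - q1 • a₂) + -(2 * rm a₁ b₁) • a₁₁
        - (2 * (rm a₁ b₂ + rm a₂ b₁)) • a₁₂ + ((b₂₂ - p3 • a₁ - q3 • a₂)
        + (2 * rm a₁ b₁) • a₂₂)) 0 := by
    refine HasDerivAt.congr_deriv
      (f := fun t => gramTrace (X₁ t) (X₂ t) (H₁₁ t) (H₁₂ t) (H₂₂ t))
      (((c₂₂.smul o₁₁).sub ((c₁₂.const_mul 2).smul o₁₂)).add (c₁₁.smul o₂₂)) ?_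
    rw [z₁₁, z₁₂, z₂₂, i₁, i₂, g₁₁, g₁₂, g₂₂]
    module
  have cN : HasDerivAt (fun t => gramNum (X₁ t) (X₂ t) (H₁₁ t) (H₁₂ t) (H₂₂ t))
      (2 * rm (a₁₁ - a₂₂) (b₁₁ - b₂₂) + 8 * rm a₁₂ b₁₂
        + 2 * rm (a₁₁ + a₂₂) ((2 * rm a₁ b₁) • (a₂₂ - a₁₁)
          - (2 * (rm a₁ b₂ + rm a₂ b₁)) • a₁₂)) 0 := by
    refine HasDerivAt.congr_deriv
      (f := fun t => gramNum (X₁ t) (X₂ t) (H₁₁ t) (H₁₂ t) (H₂₂ t))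
      ((hasDerivAt_rm cT cT).sub
        ((cD.const_mul 4).mul ((hasDerivAt_rm o₁₁ o₂₂).sub (hasDerivAt_rm o₁₂ o₁₂)))) ?_
    rw [T0, z₁₁, z₁₂, z₂₂, D0]
    simp only [rm_add_left, rm_add_right, rm_sub_left, rm_sub_right, rm_smul_left, rm_smul_right,
      m₁, m₂, m₃, m₄, m₅, m₆, rm_comm a₁ a₁₁, rm_comm a₁ a₁₂, rm_comm a₁ a₂₂, rm_comm a₂ a₁₁,
      rm_comm a₂ a₁₂, rm_comm a₂ a₂₂, rm_comm b₁₁ a₁₁, rm_comm b₁₁ a₂₂, rm_comm b₁₂ a₁₂,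
      rm_comm b₂₂ a₁₁, rm_comm b₂₂ a₂₂, rm_comm a₂₂ a₁₁, rm_comm a₁₂ a₁₁, rm_comm a₂₂ a₁₂]
    ring
  have cS := cD.sqrt (by rw [D0]; exact one_ne_zero)
  refine HasDerivAt.congr_deriv (f := fun t =>
    liftDensity (X₁ t) (X₂ t) (X₁₁ t) (X₁₂ t) (X₂₂ t))
    ((cN.mul cS).div ((cD.pow 2).const_mul 16) (by rw [D0]; norm_num)) ?_
  simp only [Pi.mul_apply, D0, Real.sqrt_one]
  ring

end GramDensity

/-! ### Points of the sphere and light-like vectors -/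

section Sphere

variable {n : ℕ}

/-- The point of the sphere that is represented by a real light-like vector. -/
def sphereMap (x : Mink n) : EuclideanSpace ℝ (Fin (n + 1)) :=
  (x 0).re⁻¹ • WithLp.toLp 2 fun i => (x i.succ).re

theorem ofReal_re_of_cconj {x : Mink n} (hx : cconj x = x) (i : Fin (n + 2)) :
    (((x i).re : ℝ) : ℂ) = x i :=
  Complex.conj_eq_iff_re.1 (congrFun hx i)

/-- For a real null vector the time component squared is the sum of the spatial squares, so its
vanishing would kill the whole vector. -/
theorem re_zero_ne_zero {x : Mink n} (hx : cconj x = x) (h0 : mink x x = 0) (hne : x ≠ 0) :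
    (x 0).re ≠ 0 ∧ (x 0).re ^ 2 = ∑ i : Fin (n + 1), (x i.succ).re ^ 2 := by
  have h : (x 0).re ^ 2 = ∑ i : Fin (n + 1), (x i.succ).re ^ 2 := by
    have h1 : (((-((x 0).re * (x 0).re) + ∑ i : Fin (n + 1), (x i.succ).re * (x i.succ).re : ℝ))
        : ℂ) = 0 := by
      push_cast
      simp only [ofReal_re_of_cconj hx]
      exact h0
    have h2 := Complex.ofReal_eq_zero.1 h1
    simp only [pow_two]
    linarith
  refine ⟨fun hz => hne ?_, h⟩
  rw [hz, zero_pow two_ne_zero, eq_comm,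
    Finset.sum_eq_zero_iff_of_nonneg fun i _ => sq_nonneg _] at h
  funext i
  rw [← ofReal_re_of_cconj hx i]
  induction i using Fin.cases with
  | zero => simp [hz]
  | succ i => simpa using h i (Finset.mem_univ i)

theorem norm_sphereMap {x : Mink n} (hx : cconj x = x) (h0 : mink x x = 0) (hne : x ≠ 0) :
    ‖sphereMap x‖ = 1 := by
  obtain ⟨h1, h2⟩ := re_zero_ne_zero hx h0 hne
  have h3 : ‖(WithLp.toLp 2 fun i : Fin (n + 1) => (x i.succ).re : EuclideanSpace ℝ _)‖
      = |(x 0).re| := by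
    rw [EuclideanSpace.norm_eq, ← Real.sqrt_sq_eq_abs, h2]
    simp
  rw [sphereMap, norm_smul, h3, norm_inv, Real.norm_eq_abs, inv_mul_cancel₀ (abs_ne_zero.2 h1)]

theorem eq_smul_lightVec_sphereMap {x : Mink n} (hx : cconj x = x) (h0 : mink x x = 0)
    (hne : x ≠ 0) : x = (((x 0).re : ℝ) : ℂ) • lightVec (sphereMap x) := by
  obtain ⟨h1, -⟩ := re_zero_ne_zero hx h0 hne
  funext i
  induction i using Fin.cases with
  | zero => simp [lightVec, ofReal_re_of_cconj hx]
  | succ i =>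
    have h2 : ((x 0).re : ℂ) ≠ 0 := Complex.ofReal_ne_zero.2 h1
    simp only [lightVec, sphereMap, Pi.smul_apply, Fin.cons_succ, PiLp.smul_apply, smul_eq_mul]
    push_cast
    rw [mul_inv_cancel_left₀ h2, ofReal_re_of_cconj hx]

theorem sphereMap_smul_lightVec {c : ℝ} (hc : c ≠ 0) (x : EuclideanSpace ℝ (Fin (n + 1))) :
    sphereMap ((c : ℂ) • lightVec x) = x := by
  ext i
  simp [sphereMap, lightVec, hc]

/-- The inclusion of `ℝ^{n+1}` as the spatial part of the Minkowski space. -/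
def spatial (n : ℕ) : EuclideanSpace ℝ (Fin (n + 1)) →L[ℝ] Mink n :=
  LinearMap.toContinuousLinearMap
    { toFun := fun x => Fin.cons 0 fun i => ((x i : ℝ) : ℂ)
      map_add' := fun x y => by
        funext i
        induction i using Fin.cases <;> simp
      map_smul' := fun c x => by
        funext i
        induction i using Fin.cases <;> simp }

theorem spatial_zero_apply (x : EuclideanSpace ℝ (Fin (n + 1))) : spatial n x 0 = 0 := rfl

theorem spatial_succ_apply (x : EuclideanSpace ℝ (Fin (n + 1))) (i : Fin (n + 1)) :
    spatial n x i.succ = ((x i : ℝ) : ℂ) := rfl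

theorem lightVec_eq (x : EuclideanSpace ℝ (Fin (n + 1))) :
    lightVec x = Fin.cons 1 0 + spatial n x := by
  funext i
  induction i using Fin.cases <;> simp [lightVec, spatial_zero_apply, spatial_succ_apply]

theorem rm_spatial_spatial (x y : EuclideanSpace ℝ (Fin (n + 1))) :
    rm (spatial n x) (spatial n y) = inner ℝ x y := by
  simp [rm, mink, spatial_zero_apply, spatial_succ_apply, PiLp.inner_apply, mul_comm]

theorem rm_lightVec_spatial (x y : EuclideanSpace ℝ (Fin (n + 1))) :
    rm (lightVec x) (spatial n y) = inner ℝ x y := by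
  simp [rm, mink, lightVec, spatial_zero_apply, spatial_succ_apply, PiLp.inner_apply, mul_comm]

theorem rm_lightVec_self {x : EuclideanSpace ℝ (Fin (n + 1))} (hx : ‖x‖ = 1) :
    rm (lightVec x) (lightVec x) = 0 := by
  rw [rm, mink_lightVec_self hx, Complex.zero_re]

end Sphere

/-! ### The Möbius density in terms of a lift -/

section Density

variable {n : ℕ} {F : ℂ → EuclideanSpace ℝ (Fin (n + 1))} {l : ℂ → ℝ} {W : Set ℂ}

/-- The Möbius density of the map that is represented by the light-like map `X`. -/
def jetDensity (X : ℂ → Mink n) (z : ℂ) : ℝ :=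
  liftDensity (fderiv ℝ X z 1) (fderiv ℝ X z Complex.I)
    (fderiv ℝ (fun w => fderiv ℝ X w 1) z 1) (fderiv ℝ (fun w => fderiv ℝ X w Complex.I) z 1)
    (fderiv ℝ (fun w => fderiv ℝ X w Complex.I) z Complex.I)

theorem hasFDerivAt_lightVec {z : ℂ} (hF : DifferentiableAt ℝ F z) :
    HasFDerivAt (fun w => lightVec (F w)) ((spatial n).comp (fderiv ℝ F z)) z := by
  simp only [lightVec_eq]
  exact ((spatial n).hasFDerivAt.comp z hF.hasFDerivAt).const_add _

theorem fderiv_smul_lightVec {z : ℂ} (hF : DifferentiableAt ℝ F z) (hl : DifferentiableAt ℝ l z)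
    (v : ℂ) : fderiv ℝ (fun w => l w • lightVec (F w)) z v
      = l z • spatial n (fderiv ℝ F z v) + fderiv ℝ l z v • lightVec (F z) := by
  have h : HasFDerivAt (fun w => l w • lightVec (F w)) _ z :=
    hl.hasFDerivAt.smul (hasFDerivAt_lightVec hF)
  rw [h.fderiv]
  rfl

theorem differentiableAt_of_contDiffOn_real {E : Type*} [NormedAddCommGroup E] [NormedSpace ℝ E]
    {G : ℂ → E} (hW : IsOpen W) (hG : ContDiffOn ℝ ∞ G W) {z : ℂ} (hz : z ∈ W) :
    DifferentiableAt ℝ G z :=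
  (hG.contDiffAt (hW.mem_nhds hz)).differentiableAt (by simp)

theorem contDiffOn_fderiv_apply {E : Type*} [NormedAddCommGroup E] [NormedSpace ℝ E] {G : ℂ → E}
    (hW : IsOpen W) (hG : ContDiffOn ℝ ∞ G W) (v : ℂ) :
    ContDiffOn ℝ ∞ (fun w => fderiv ℝ G w v) W :=
  (hG.fderiv_of_isOpen hW (by norm_cast)).clm_apply contDiffOn_const

theorem fderiv_fderiv_smul_lightVec (hW : IsOpen W) (hF : ContDiffOn ℝ ∞ F W)
    (hl : ContDiffOn ℝ ∞ l W) {z : ℂ} (hz : z ∈ W) (u v : ℂ) :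
    fderiv ℝ (fun w => fderiv ℝ (fun w => l w • lightVec (F w)) w v) z u
      = l z • spatial n (fderiv ℝ (fun w => fderiv ℝ F w v) z u)
        + fderiv ℝ l z u • spatial n (fderiv ℝ F z v)
        + fderiv ℝ l z v • spatial n (fderiv ℝ F z u)
        + fderiv ℝ (fun w => fderiv ℝ l w v) z u • lightVec (F z) := by
  have dF := fun w hw => differentiableAt_of_contDiffOn_real hW hF (z := w) hw
  have dl := fun w hw => differentiableAt_of_contDiffOn_real hW hl (z := w) hw
  have dF' := differentiableAt_of_contDiffOn_real hW (contDiffOn_fderiv_apply hW hF v) hz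
  have dl' := differentiableAt_of_contDiffOn_real hW (contDiffOn_fderiv_apply hW hl v) hz
  have h1 : (fun w => fderiv ℝ (fun w => l w • lightVec (F w)) w v) =ᶠ[nhds z]
      fun w => l w • spatial n (fderiv ℝ F w v) + fderiv ℝ l w v • lightVec (F w) := by
    filter_upwards [hW.mem_nhds hz] with w hw
    exact fderiv_smul_lightVec (dF w hw) (dl w hw) v
  have h2 : HasFDerivAt (fun w => l w • spatial n (fderiv ℝ F w v)
      + fderiv ℝ l w v • lightVec (F w)) _ z :=
    ((dl z hz).hasFDerivAt.smul ((spatial n).hasFDerivAt.comp z dF'.hasFDerivAt)).add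
      (dl'.hasFDerivAt.smul (hasFDerivAt_lightVec (dF z hz)))
  rw [h1.fderiv_eq, h2.fderiv]
  change l z • spatial n (fderiv ℝ (fun w => fderiv ℝ F w v) z u)
    + fderiv ℝ l z u • spatial n (fderiv ℝ F z v)
    + (fderiv ℝ l z v • spatial n (fderiv ℝ F z u)
    + fderiv ℝ (fun w => fderiv ℝ l w v) z u • lightVec (F z)) = _
  abel

theorem inner_fderiv_eq_zero (hW : IsOpen W) (hF : ContDiffOn ℝ ∞ F W)
    (h1 : ∀ w ∈ W, ‖F w‖ = 1) {z : ℂ} (hz : z ∈ W) (v : ℂ) : inner ℝ (F z) (fderiv ℝ F z v) = 0 := by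
  have d := (differentiableAt_of_contDiffOn_real hW hF hz).hasFDerivAt
  have h2 : (fun w => inner ℝ (F w) (F w)) =ᶠ[nhds z] fun _ => (1 : ℝ) := by
    filter_upwards [hW.mem_nhds hz] with w hw
    rw [real_inner_self_eq_norm_sq, h1 w hw, one_pow]
  have h3 := h2.fderiv_eq (𝕜 := ℝ)
  have h4 := fderiv_inner_apply ℝ d.differentiableAt d.differentiableAt v
  rw [h3] at h4
  rw [real_inner_comm _ (F z)] at h4
  simp at h4
  linarith [real_inner_comm (F z) (fderiv ℝ F z v)]

/-- Derivative of ⟨F, F_v⟩ = 0. The component of the second derivatives along F is thus minus the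
metric, which is the pure trace part in `liftDensity_eq`. -/
theorem inner_fderiv_fderiv (hW : IsOpen W) (hF : ContDiffOn ℝ ∞ F W)
    (h1 : ∀ w ∈ W, ‖F w‖ = 1) {z : ℂ} (hz : z ∈ W) (u v : ℂ) :
    inner ℝ (fderiv ℝ (fun w => fderiv ℝ F w v) z u) (F z)
      = - inner ℝ (fderiv ℝ F z u) (fderiv ℝ F z v) := by
  have d := differentiableAt_of_contDiffOn_real hW hF hz
  have d' := differentiableAt_of_contDiffOn_real hW (contDiffOn_fderiv_apply hW hF v) hz
  have h2 : (fun w => inner ℝ (F w) (fderiv ℝ F w v)) =ᶠ[nhds z] fun _ => (0 : ℝ) := by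
    filter_upwards [hW.mem_nhds hz] with w hw
    exact inner_fderiv_eq_zero hW hF h1 hw v
  have h3 := h2.fderiv_eq (𝕜 := ℝ)
  have h4 := fderiv_inner_apply ℝ d d' u
  rw [h3] at h4
  rw [real_inner_comm]
  simp at h4
  linarith

theorem willmoreDensity_eq_gramDensity {z : ℂ} (hd : gDet F z ≠ 0) :
    willmoreDensity F z = gramDensity (spatial n (du F z)) (spatial n (dv F z))
      (spatial n (secUU F z)) (spatial n (secUV F z)) (spatial n (secVV F z)) := by
  have hD : gramDet (spatial n (du F z)) (spatial n (dv F z)) = gDet F z := by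
    simp only [gramDet, rm_spatial_spatial, gDet, gE, gF, gG]
  have hT : gramTrace (spatial n (du F z)) (spatial n (dv F z)) (spatial n (secUU F z))
      (spatial n (secUV F z)) (spatial n (secVV F z)) = spatial n
        (gG F z • secUU F z - (2 * gF F z) • secUV F z + gE F z • secVV F z) := by
    simp only [gramTrace, rm_spatial_spatial, gE, gF, gG, map_add, map_sub, map_smul]
  have hH : ‖meanCurv F z‖ ^ 2 = (1 / (2 * gDet F z)) ^ 2 * inner ℝ
      (gG F z • secUU F z - (2 * gF F z) • secUV F z + gE F z • secVV F z)
      (gG F z • secUU F z - (2 * gF F z) • secUV F z + gE F z • secVV F z) := by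
    rw [meanCurv, norm_smul, mul_pow, real_inner_self_eq_norm_sq, Real.norm_eq_abs, sq_abs]
  rw [willmoreDensity, hH, extCurv, gramDensity, gramNum, hT, hD]
  simp only [rm_spatial_spatial]
  field_simp
  ring

theorem normalPart_orth {z : ℂ} (hd : gDet F z ≠ 0) (h0 : ‖F z‖ = 1)
    (hu : inner ℝ (F z) (du F z) = (0 : ℝ)) (hv : inner ℝ (F z) (dv F z) = (0 : ℝ))
    (x : EuclideanSpace ℝ (Fin (n + 1))) :
    inner ℝ (F z) (normalPart F z x) = (0 : ℝ) ∧ inner ℝ (normalPart F z x) (du F z) = (0 : ℝ) ∧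
      inner ℝ (normalPart F z x) (dv F z) = (0 : ℝ) := by
  have hD : gDet F z = inner ℝ (du F z) (du F z) * inner ℝ (dv F z) (dv F z)
    - inner ℝ (du F z) (dv F z) ^ 2 := rfl
  refine ⟨?_, ?_, ?_⟩
  · simp only [normalPart, inner_sub_right, inner_smul_right, hu, hv, real_inner_self_eq_norm_sq,
      h0, real_inner_comm x (F z)]
    ring
  · simp only [normalPart, inner_sub_left, real_inner_smul_left, hu, gE, gF, gG,
      real_inner_comm (du F z) (dv F z)]
    field_simp
    rw [hD]
    ring
  · simp only [normalPart, inner_sub_left, real_inner_smul_left, hv, gE, gF, gG]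
    field_simp
    rw [hD]
    ring

/-- The density of the Willmore functional can be computed from any light-like lift. -/
theorem willmoreDensity_eq (hW : IsOpen W) (hF : ContDiffOn ℝ ∞ F W) (hl : ContDiffOn ℝ ∞ l W)
    (h1 : ∀ w ∈ W, ‖F w‖ = 1) {X : ℂ → Mink n} (hX : ∀ w ∈ W, X w = l w • lightVec (F w))
    {z : ℂ} (hz : z ∈ W) (hlz : l z ≠ 0) (hd : gDet F z ≠ 0) :
    willmoreDensity F z = jetDensity X z := by
  have dF := differentiableAt_of_contDiffOn_real hW hF hz
  have dl := differentiableAt_of_contDiffOn_real hW hl hz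
  have hX1 : ∀ w ∈ W, X =ᶠ[nhds w] fun w => l w • lightVec (F w) := fun w hw => by
    filter_upwards [hW.mem_nhds hw] with y hy using hX y hy
  have e1 : ∀ v, fderiv ℝ X z v = l z • spatial n (fderiv ℝ F z v)
      + fderiv ℝ l z v • lightVec (F z) := fun v => by
    rw [(hX1 z hz).fderiv_eq, fderiv_smul_lightVec dF dl]
  have e2 : ∀ u v, fderiv ℝ (fun w => fderiv ℝ X w v) z u
      = l z • spatial n (fderiv ℝ (fun w => fderiv ℝ F w v) z u)
        + fderiv ℝ l z u • spatial n (fderiv ℝ F z v)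
        + fderiv ℝ l z v • spatial n (fderiv ℝ F z u)
        + fderiv ℝ (fun w => fderiv ℝ l w v) z u • lightVec (F z) := fun u v => by
    rw [← fderiv_fderiv_smul_lightVec hW hF hl hz]
    congr 1
    refine Filter.EventuallyEq.fderiv_eq ?_
    filter_upwards [hW.mem_nhds hz] with w hw
    rw [(hX1 w hw).fderiv_eq]
  have hu := inner_fderiv_eq_zero hW hF h1 hz 1
  have hv := inner_fderiv_eq_zero hW hF h1 hz Complex.I
  have ho := normalPart_orth hd (h1 z hz) hu hv
  -- Only the coefficient along F matters. The tangential coefficients are absorbed into free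
  -- parameters of `liftDensity_eq`.
  have hdec : ∀ x, ∃ a b : ℝ, x = normalPart F z x + (inner ℝ x (F z) : ℝ) • F z
      + a • du F z + b • dv F z := fun x =>
    ⟨_, _, by rw [normalPart]; abel⟩
  have key : ∀ u v, ∃ a b d : ℝ, fderiv ℝ (fun w => fderiv ℝ X w v) z u
      = l z • spatial n (normalPart F z (fderiv ℝ (fun w => fderiv ℝ F w v) z u))
        + (-l z * inner ℝ (fderiv ℝ F z u) (fderiv ℝ F z v)) • spatial n (F z)
        + a • spatial n (du F z) + b • spatial n (dv F z) + d • lightVec (F z) + (fderiv ℝ l z u • spatial n (fderiv ℝ F z v)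
        + fderiv ℝ l z v • spatial n (fderiv ℝ F z u)) := fun u v => by
    obtain ⟨a, b, h⟩ := hdec (fderiv ℝ (fun w => fderiv ℝ F w v) z u)
    rw [inner_fderiv_fderiv hW hF h1 hz] at h
    refine ⟨l z * a, l z * b, fderiv ℝ (fun w => fderiv ℝ l w v) z u, ?_⟩
    rw [e2]
    conv_lhs => rw [h]
    simp only [map_add, map_smul]
    module
  obtain ⟨a₁₁, b₁₁, d₁₁, k₁₁⟩ := key 1 1
  obtain ⟨a₁₂, b₁₂, d₁₂, k₁₂⟩ := key 1 Complex.I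
  obtain ⟨a₂₂, b₂₂, d₂₂, k₂₂⟩ := key Complex.I Complex.I
  rw [willmoreDensity_eq_gramDensity hd, jetDensity, eq_comm]
  refine liftDensity_eq (x := lightVec (F z)) (e := spatial n (F z)) (l := l z)
    (l₁ := fderiv ℝ l z 1) (l₂ := fderiv ℝ l z Complex.I)
    (a₁₁ := a₁₁ + fderiv ℝ l z 1 + fderiv ℝ l z 1) (b₁₁ := b₁₁) (d₁₁ := d₁₁)
    (a₁₂ := a₁₂ + fderiv ℝ l z Complex.I) (b₁₂ := b₁₂ + fderiv ℝ l z 1) (d₁₂ := d₁₂)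
    (a₂₂ := a₂₂) (b₂₂ := b₂₂ + fderiv ℝ l z Complex.I + fderiv ℝ l z Complex.I) (d₂₂ := d₂₂)
    hlz ?_ (rm_lightVec_self (h1 z hz)) ?_ ?_ ?_ ?_ ?_ ?_ ?_ ?_ ?_ ?_ ?_ (e1 1) (e1 Complex.I)
    ?_ ?_ ?_
  · simpa only [gramDet, rm_spatial_spatial] using (show inner ℝ (du F z) (du F z) * inner ℝ (dv F z) (dv F z) - inner ℝ (du F z) (dv F z) ^ 2 ≠ 0 from hd)
  · rw [rm_lightVec_spatial]; exact hu
  · rw [rm_lightVec_spatial]; exact hv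
  · rw [rm_lightVec_spatial]; exact (ho _).1
  · rw [rm_lightVec_spatial]; exact (ho _).1
  · rw [rm_lightVec_spatial]; exact (ho _).1
  · rw [rm_spatial_spatial]; exact (ho _).2.1
  · rw [rm_spatial_spatial]; exact (ho _).2.2
  · rw [rm_spatial_spatial]; exact (ho _).2.1
  · rw [rm_spatial_spatial]; exact (ho _).2.2
  · rw [rm_spatial_spatial]; exact (ho _).2.1
  · rw [rm_spatial_spatial]; exact (ho _).2.2
  · rw [k₁₁, rm_spatial_spatial, show secUU F z = normalPart F z
      (fderiv ℝ (fun w => fderiv ℝ F w 1) z 1) from rfl]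
    simp only [du]
    module
  · rw [k₁₂, rm_spatial_spatial, show secUV F z = normalPart F z
      (fderiv ℝ (fun w => fderiv ℝ F w Complex.I) z 1) from rfl]
    simp only [du, dv]
    module
  · rw [k₂₂, rm_spatial_spatial, show secVV F z = normalPart F z
      (fderiv ℝ (fun w => fderiv ℝ F w Complex.I) z Complex.I) from rfl]
    simp only [dv]
    module

end Density

/-! ### Differentiation under the integral sign and integration by parts -/

section Integrals

open MeasureTheory Set Metric

/-- The tube lemma gives δ with [-δ, δ] × K inside O, and compactness bounds the t-derivative there,
which gives dominated convergence. `G` has to agree with the smooth `D` only on O, since the formula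
for the density holds only where the family is immersed. -/
theorem hasDerivAt_setIntegral_of_contDiffOn {O : Set (ℝ × ℂ)} (hO : IsOpen O) {D : ℝ → ℂ → ℝ}
    (hD : ContDiffOn ℝ ∞ (fun q : ℝ × ℂ => D q.1 q.2) O) {K : Set ℂ} (hK : IsCompact K)
    (hKO : ∀ z ∈ K, ((0 : ℝ), z) ∈ O) {G : ℝ → ℂ → ℝ} (hG : ∀ q ∈ O, G q.1 q.2 = D q.1 q.2)
    {D' : ℂ → ℝ} (hD' : ∀ z ∈ K, HasDerivAt (fun t => D t z) (D' z) 0) :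
    HasDerivAt (fun t => ∫ z in K, G t z) (∫ z in K, D' z) 0 := by
  obtain ⟨u, v, hu, -, hsu, htv, huv⟩ := generalized_tube_lemma (isCompact_singleton (x := (0 : ℝ)))
    hK hO (fun q hq => by
      obtain ⟨h1, h2⟩ := hq
      have : q = (0, q.2) := Prod.ext h1 rfl
      rw [this]
      exact hKO _ h2)
  obtain ⟨δ, hδ, hball⟩ := nhds_basis_closedBall.mem_iff.1 (hu.mem_nhds (hsu rfl))
  have hsub : closedBall (0 : ℝ) δ ×ˢ K ⊆ O := (prod_mono hball htv).trans huv
  have hfd : ContinuousOn (fun q : ℝ × ℂ => fderiv ℝ (fun q : ℝ × ℂ => D q.1 q.2) q (1, 0)) O :=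
    (hD.continuousOn_fderiv_of_isOpen hO (by simp)).clm_apply continuousOn_const
  have hder : ∀ t z, (t, z) ∈ O → HasDerivAt (fun t => D t z)
      (fderiv ℝ (fun q : ℝ × ℂ => D q.1 q.2) (t, z) (1, 0)) t := by
    intro t z h
    have h1 : HasFDerivAt (fun q : ℝ × ℂ => D q.1 q.2) _ (t, z) :=
      ((hD.contDiffAt (hO.mem_nhds h)).differentiableAt (by simp)).hasFDerivAt
    exact h1.comp_hasDerivAt t ((hasDerivAt_id t).prodMk (hasDerivAt_const t z))
  obtain ⟨C, hC⟩ := ((isCompact_closedBall (0 : ℝ) δ).prod hK).exists_bound_of_continuousOn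
    (hfd.mono hsub)
  have hslice : ∀ {E : Type} [TopologicalSpace E] {g : ℝ × ℂ → E}, ContinuousOn g O →
      ∀ t ∈ closedBall (0 : ℝ) δ, ContinuousOn (fun z => g (t, z)) K := by
    intro E _ g hg t ht
    exact hg.comp (by fun_prop) fun z hz => hsub ⟨ht, hz⟩
  have h0 : (0 : ℝ) ∈ closedBall (0 : ℝ) δ := mem_closedBall_self hδ.le
  have hmain := (hasDerivAt_integral_of_dominated_loc_of_deriv_le (μ := volume.restrict K)
    (F := D) (F' := fun t z => fderiv ℝ (fun q : ℝ × ℂ => D q.1 q.2) (t, z) (1, 0)) (x₀ := 0)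
    (bound := fun _ => C) (closedBall_mem_nhds (0 : ℝ) hδ) ?_ ?_ ?_ ?_ ?_ ?_).2
  · have e1 : (∫ z in K, D' z)
        = ∫ z in K, fderiv ℝ (fun q : ℝ × ℂ => D q.1 q.2) (0, z) (1, 0) :=
      setIntegral_congr_fun hK.measurableSet fun z hz =>
        (hD' z hz).unique (hder 0 z (hKO z hz))
    rw [e1]
    refine hmain.congr_of_eventuallyEq ?_
    filter_upwards [closedBall_mem_nhds (0 : ℝ) hδ] with t ht
    exact setIntegral_congr_fun hK.measurableSet fun z hz => hG (t, z) (hsub ⟨ht, hz⟩)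
  · filter_upwards [closedBall_mem_nhds (0 : ℝ) hδ] with t ht
    exact (hslice hD.continuousOn t ht).aestronglyMeasurable hK.measurableSet
  · exact (hslice hD.continuousOn 0 h0).integrableOn_compact hK
  · exact (hslice hfd 0 h0).aestronglyMeasurable hK.measurableSet
  · exact ae_restrict_of_forall_mem hK.measurableSet fun z hz t ht => hC (t, z) ⟨ht, hz⟩
  · exact (continuousOn_const).integrableOn_compact hK
  · exact ae_restrict_of_forall_mem hK.measurableSet fun z hz t ht => hder t z (hsub ⟨ht, hz⟩)

/-- Integration by parts against the constant function 1. -/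
theorem integral_fderiv_eq_zero {h : ℂ → ℂ} (hh : ContDiff ℝ ∞ h) (hc : HasCompactSupport h)
    (v : ℂ) : ∫ z, fderiv ℝ h z v = 0 := by
  have hi : Integrable (fun z => fderiv ℝ h z v) :=
    ((hh.continuous_fderiv (by simp)).clm_apply continuous_const).integrable_of_hasCompactSupport
      (hc.fderiv_apply ℝ v)
  have h1 := integral_smul_fderiv_eq_neg_fderiv_smul_of_integrable (𝕜 := ℝ) (μ := volume)
    (f := fun _ : ℂ => (1 : ℝ)) (g := h) (v := v) (by simp) (by simpa using hi)
    (by simpa using hh.continuous.integrable_of_hasCompactSupport hc)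
    (fun _ _ => differentiableAt_const _) (fun x _ => (hh.differentiable (by simp)) x)
  simpa using h1

theorem integrable_dzbar {h : ℂ → ℂ} (hh : ContDiff ℝ ∞ h) (hc : HasCompactSupport h) :
    Integrable (dzbar h) := by
  have hi : ∀ v, Integrable (fun z => fderiv ℝ h z v) := fun v =>
    ((hh.continuous_fderiv (by simp)).clm_apply continuous_const).integrable_of_hasCompactSupport
      (hc.fderiv_apply ℝ v)
  exact ((hi 1).add ((hi Complex.I).smul Complex.I)).smul (1 / 2 : ℂ)

theorem integral_dzbar_eq_zero {h : ℂ → ℂ} (hh : ContDiff ℝ ∞ h) (hc : HasCompactSupport h) :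
    ∫ z, dzbar h z = 0 := by
  have hi : ∀ v, Integrable (fun z => fderiv ℝ h z v) := fun v =>
    ((hh.continuous_fderiv (by simp)).clm_apply continuous_const).integrable_of_hasCompactSupport
      (hc.fderiv_apply ℝ v)
  have hI : Integrable (fun z => Complex.I • fderiv ℝ h z Complex.I) := (hi Complex.I).smul Complex.I
  simp only [dzbar]
  rw [integral_smul, integral_add (hi 1) hI, integral_smul,
    integral_fderiv_eq_zero hh hc, integral_fderiv_eq_zero hh hc]
  simp

end Integrals

/-! ### Densities along a quadratic family of lifts -/

section Family

variable {n : ℕ}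

/-! ### Smooth dependence of the Gram quantities on their vectors. -/

section Smooth

variable {X : Type*} [NormedAddCommGroup X] [NormedSpace ℝ X] {s : Set X}

theorem contDiffOn_rm {x y : X → Mink n} (hx : ContDiffOn ℝ ∞ x s) (hy : ContDiffOn ℝ ∞ y s) :
    ContDiffOn ℝ ∞ (fun q => rm (x q) (y q)) s :=
  ((rmL n).contDiff.comp_contDiffOn hx).clm_apply hy

theorem contDiffOn_gramDet {x₁ x₂ : X → Mink n} (h₁ : ContDiffOn ℝ ∞ x₁ s)
    (h₂ : ContDiffOn ℝ ∞ x₂ s) : ContDiffOn ℝ ∞ (fun q => gramDet (x₁ q) (x₂ q)) s :=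
  ((contDiffOn_rm h₁ h₁).mul (contDiffOn_rm h₂ h₂)).sub ((contDiffOn_rm h₁ h₂).pow 2)

theorem contDiffOn_orthPart {x₁ x₂ y : X → Mink n} (h₁ : ContDiffOn ℝ ∞ x₁ s)
    (h₂ : ContDiffOn ℝ ∞ x₂ s) (hy : ContDiffOn ℝ ∞ y s) (hd : ∀ q ∈ s, gramDet (x₁ q) (x₂ q) ≠ 0) :
    ContDiffOn ℝ ∞ (fun q => orthPart (x₁ q) (x₂ q) (y q)) s :=
  (hy.sub (((((contDiffOn_rm h₂ h₂).mul (contDiffOn_rm hy h₁)).sub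
    ((contDiffOn_rm h₁ h₂).mul (contDiffOn_rm hy h₂))).div (contDiffOn_gramDet h₁ h₂) hd).smul
    h₁)).sub (((((contDiffOn_rm h₁ h₁).mul (contDiffOn_rm hy h₂)).sub
    ((contDiffOn_rm h₁ h₂).mul (contDiffOn_rm hy h₁))).div (contDiffOn_gramDet h₁ h₂) hd).smul h₂)

theorem contDiffOn_gramDensity {x₁ x₂ h₁₁ h₁₂ h₂₂ : X → Mink n} (h₁ : ContDiffOn ℝ ∞ x₁ s)
    (h₂ : ContDiffOn ℝ ∞ x₂ s) (k₁ : ContDiffOn ℝ ∞ h₁₁ s) (k₂ : ContDiffOn ℝ ∞ h₁₂ s)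
    (k₃ : ContDiffOn ℝ ∞ h₂₂ s) (hd : ∀ q ∈ s, gramDet (x₁ q) (x₂ q) ≠ 0) :
    ContDiffOn ℝ ∞ (fun q => gramDensity (x₁ q) (x₂ q) (h₁₁ q) (h₁₂ q) (h₂₂ q)) s := by
  have hD := contDiffOn_gramDet h₁ h₂
  have hT : ContDiffOn ℝ ∞ (fun q => gramTrace (x₁ q) (x₂ q) (h₁₁ q) (h₁₂ q) (h₂₂ q)) s :=
    (((contDiffOn_rm h₂ h₂).smul k₁).sub
      ((contDiffOn_const.mul (contDiffOn_rm h₁ h₂)).smul k₂)).add ((contDiffOn_rm h₁ h₁).smul k₃)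
  have hN : ContDiffOn ℝ ∞ (fun q => gramNum (x₁ q) (x₂ q) (h₁₁ q) (h₁₂ q) (h₂₂ q)) s :=
    (contDiffOn_rm hT hT).sub ((contDiffOn_const.mul hD).mul
      ((contDiffOn_rm k₁ k₃).sub (contDiffOn_rm k₂ k₂)))
  exact (hN.mul (hD.sqrt hd)).div (contDiffOn_const.mul (hD.pow 2)) fun q hq =>
    mul_ne_zero (by norm_num) (pow_ne_zero 2 (hd q hq))

theorem contDiffOn_liftDensity {x₁ x₂ x₁₁ x₁₂ x₂₂ : X → Mink n} (h₁ : ContDiffOn ℝ ∞ x₁ s)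
    (h₂ : ContDiffOn ℝ ∞ x₂ s) (k₁ : ContDiffOn ℝ ∞ x₁₁ s) (k₂ : ContDiffOn ℝ ∞ x₁₂ s)
    (k₃ : ContDiffOn ℝ ∞ x₂₂ s) (hd : ∀ q ∈ s, gramDet (x₁ q) (x₂ q) ≠ 0) :
    ContDiffOn ℝ ∞ (fun q => liftDensity (x₁ q) (x₂ q) (x₁₁ q) (x₁₂ q) (x₂₂ q)) s :=
  contDiffOn_gramDensity h₁ h₂ (contDiffOn_orthPart h₁ h₂ k₁ hd)
    (contDiffOn_orthPart h₁ h₂ k₂ hd) (contDiffOn_orthPart h₁ h₂ k₃ hd) hd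

end Smooth

/-- The family `A + t B + t² C` of maps. -/
def quadFamily {E : Type*} [AddCommGroup E] [Module ℝ E] (A B C : ℂ → E) (t : ℝ) (z : ℂ) : E :=
  A z + t • B z + t ^ 2 • C z

variable {E : Type*} [NormedAddCommGroup E] [NormedSpace ℝ E] {A B C : ℂ → E} {Ω : Set ℂ}

theorem contDiffOn_quadFamily (hA : ContDiffOn ℝ ∞ A Ω) (hB : ContDiffOn ℝ ∞ B Ω)
    (hC : ContDiffOn ℝ ∞ C Ω) (J : Set ℝ) :
    ContDiffOn ℝ ∞ (fun q : ℝ × ℂ => quadFamily A B C q.1 q.2) (J ×ˢ Ω) := by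
  have hs : Set.MapsTo (Prod.snd : ℝ × ℂ → ℂ) (J ×ˢ Ω) Ω := fun q hq => hq.2
  exact ((hA.comp contDiffOn_snd hs).add (contDiffOn_fst.smul (hB.comp contDiffOn_snd hs))).add
    ((contDiffOn_fst.pow 2).smul (hC.comp contDiffOn_snd hs))

theorem fderiv_quadFamily (hΩ : IsOpen Ω) (hA : ContDiffOn ℝ ∞ A Ω) (hB : ContDiffOn ℝ ∞ B Ω)
    (hC : ContDiffOn ℝ ∞ C Ω) (t : ℝ) {z : ℂ} (hz : z ∈ Ω) (v : ℂ) :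
    fderiv ℝ (quadFamily A B C t) z v = quadFamily (fun w => fderiv ℝ A w v)
      (fun w => fderiv ℝ B w v) (fun w => fderiv ℝ C w v) t z := by
  have h : HasFDerivAt (quadFamily A B C t) _ z :=
    ((differentiableAt_of_contDiffOn_real hΩ hA hz).hasFDerivAt.add
      ((differentiableAt_of_contDiffOn_real hΩ hB hz).hasFDerivAt.const_smul t)).add
      ((differentiableAt_of_contDiffOn_real hΩ hC hz).hasFDerivAt.const_smul (t ^ 2))
  rw [h.fderiv]
  rfl

theorem fderiv_fderiv_quadFamily (hΩ : IsOpen Ω) (hA : ContDiffOn ℝ ∞ A Ω)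
    (hB : ContDiffOn ℝ ∞ B Ω) (hC : ContDiffOn ℝ ∞ C Ω) (t : ℝ) {z : ℂ} (hz : z ∈ Ω) (u v : ℂ) :
    fderiv ℝ (fun w => fderiv ℝ (quadFamily A B C t) w v) z u
      = quadFamily (fun w => fderiv ℝ (fun w => fderiv ℝ A w v) w u)
        (fun w => fderiv ℝ (fun w => fderiv ℝ B w v) w u)
        (fun w => fderiv ℝ (fun w => fderiv ℝ C w v) w u) t z := by
  have h : (fun w => fderiv ℝ (quadFamily A B C t) w v) =ᶠ[nhds z]
      quadFamily (fun w => fderiv ℝ A w v) (fun w => fderiv ℝ B w v)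
        (fun w => fderiv ℝ C w v) t := by
    filter_upwards [hΩ.mem_nhds hz] with w hw using fderiv_quadFamily hΩ hA hB hC t hw v
  rw [h.fderiv_eq]
  exact fderiv_quadFamily hΩ (contDiffOn_fderiv_apply hΩ hA v) (contDiffOn_fderiv_apply hΩ hB v)
    (contDiffOn_fderiv_apply hΩ hC v) t hz u

theorem quadFamily_zero (A B C : ℂ → E) (z : ℂ) : quadFamily A B C 0 z = A z := by
  simp [quadFamily]

/-- The coefficient of t² does not contribute at t = 0, so the correction that keeps the family
light-like is irrelevant to the first variation. -/
theorem hasDerivAt_quadFamily (A B C : ℂ → E) (z : ℂ) :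
    HasDerivAt (fun t => quadFamily A B C t z) (B z) 0 := by
  refine HasDerivAt.congr_deriv (f := fun t => quadFamily A B C t z)
    (((hasDerivAt_const (0 : ℝ) (A z)).add ((hasDerivAt_id (0 : ℝ)).smul_const (B z))).add
      (((hasDerivAt_id (0 : ℝ)).pow 2).smul_const (C z))) ?_
  simp

variable {A B C : ℂ → Mink n}

/-- The density of the family `A + t B + t² C` in terms of explicit derivatives. -/
def quadDensity (A B C : ℂ → Mink n) (t : ℝ) (z : ℂ) : ℝ :=
  let D := fun (v : ℂ) (G : ℂ → Mink n) (w : ℂ) => fderiv ℝ G w v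
  liftDensity (quadFamily (D 1 A) (D 1 B) (D 1 C) t z)
    (quadFamily (D Complex.I A) (D Complex.I B) (D Complex.I C) t z)
    (quadFamily (D 1 (D 1 A)) (D 1 (D 1 B)) (D 1 (D 1 C)) t z)
    (quadFamily (D 1 (D Complex.I A)) (D 1 (D Complex.I B)) (D 1 (D Complex.I C)) t z)
    (quadFamily (D Complex.I (D Complex.I A)) (D Complex.I (D Complex.I B))
      (D Complex.I (D Complex.I C)) t z)

/-- The Gram determinant of the family `A + t B + t² C`. -/
def quadDet (A B C : ℂ → Mink n) (t : ℝ) (z : ℂ) : ℝ :=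
  let D := fun (v : ℂ) (G : ℂ → Mink n) (w : ℂ) => fderiv ℝ G w v
  gramDet (quadFamily (D 1 A) (D 1 B) (D 1 C) t z)
    (quadFamily (D Complex.I A) (D Complex.I B) (D Complex.I C) t z)

theorem jetDensity_quadFamily (hΩ : IsOpen Ω) (hA : ContDiffOn ℝ ∞ A Ω) (hB : ContDiffOn ℝ ∞ B Ω)
    (hC : ContDiffOn ℝ ∞ C Ω) (t : ℝ) {z : ℂ} (hz : z ∈ Ω) :
    jetDensity (quadFamily A B C t) z = quadDensity A B C t z := by
  simp only [jetDensity, fderiv_quadFamily hΩ hA hB hC t hz,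
    fderiv_fderiv_quadFamily hΩ hA hB hC t hz, quadDensity]

/-- The set of points at which the family `A + t B + t² C` is immersed. -/
def quadDomain (A B C : ℂ → Mink n) (Ω : Set ℂ) : Set (ℝ × ℂ) :=
  (Set.univ ×ˢ Ω) ∩ (fun q : ℝ × ℂ => quadDet A B C q.1 q.2) ⁻¹' {0}ᶜ

theorem contDiffOn_quadDet (hΩ : IsOpen Ω) (hA : ContDiffOn ℝ ∞ A Ω) (hB : ContDiffOn ℝ ∞ B Ω)
    (hC : ContDiffOn ℝ ∞ C Ω) :
    ContDiffOn ℝ ∞ (fun q : ℝ × ℂ => quadDet A B C q.1 q.2) (Set.univ ×ˢ Ω) := by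
  have h := fun v => contDiffOn_quadFamily (contDiffOn_fderiv_apply hΩ hA v)
    (contDiffOn_fderiv_apply hΩ hB v) (contDiffOn_fderiv_apply hΩ hC v) Set.univ
  exact contDiffOn_gramDet (h 1) (h Complex.I)

theorem isOpen_quadDomain (hΩ : IsOpen Ω) (hA : ContDiffOn ℝ ∞ A Ω) (hB : ContDiffOn ℝ ∞ B Ω)
    (hC : ContDiffOn ℝ ∞ C Ω) : IsOpen (quadDomain A B C Ω) :=
  (contDiffOn_quadDet hΩ hA hB hC).continuousOn.isOpen_inter_preimage (isOpen_univ.prod hΩ)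
    isOpen_compl_singleton

theorem contDiffOn_quadDensity (hΩ : IsOpen Ω) (hA : ContDiffOn ℝ ∞ A Ω) (hB : ContDiffOn ℝ ∞ B Ω)
    (hC : ContDiffOn ℝ ∞ C Ω) :
    ContDiffOn ℝ ∞ (fun q : ℝ × ℂ => quadDensity A B C q.1 q.2) (quadDomain A B C Ω) := by
  have h := fun v => (contDiffOn_quadFamily (contDiffOn_fderiv_apply hΩ hA v)
    (contDiffOn_fderiv_apply hΩ hB v) (contDiffOn_fderiv_apply hΩ hC v) Set.univ).mono
    (Set.inter_subset_left : quadDomain A B C Ω ⊆ _)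
  have h2 := fun u v => (contDiffOn_quadFamily
    (contDiffOn_fderiv_apply hΩ (contDiffOn_fderiv_apply hΩ hA v) u)
    (contDiffOn_fderiv_apply hΩ (contDiffOn_fderiv_apply hΩ hB v) u)
    (contDiffOn_fderiv_apply hΩ (contDiffOn_fderiv_apply hΩ hC v) u) Set.univ).mono
    (Set.inter_subset_left : quadDomain A B C Ω ⊆ _)
  exact contDiffOn_liftDensity (h 1) (h Complex.I) (h2 1 1) (h2 1 Complex.I)
    (h2 Complex.I Complex.I) fun q hq => hq.2

end Family

/-! ### The first variation of the Willmore functional -/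

section FirstVariation

open MeasureTheory Set

variable {n : ℕ} {f : ℂ → EuclideanSpace ℝ (Fin (n + 1))} {Ω : Set ℂ} {z : ℂ}

theorem fderiv_fderiv_eq {G : ℂ → Mink n} (hΩ : IsOpen Ω) (hG : ContDiffOn ℝ ∞ G Ω) (hz : z ∈ Ω) :
    fderiv ℝ (fun w => fderiv ℝ G w 1) z 1
        = dz (dz G) z + (2 : ℂ) • dzbar (dz G) z + dzbar (dzbar G) z ∧
      fderiv ℝ (fun w => fderiv ℝ G w Complex.I) z 1
        = Complex.I • (dz (dz G) z - dzbar (dzbar G) z) ∧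
      fderiv ℝ (fun w => fderiv ℝ G w Complex.I) z Complex.I
        = -(dz (dz G) z - (2 : ℂ) • dzbar (dz G) z + dzbar (dzbar G) z) := by
  have h1 := differentiableAt_of_contDiffOn hΩ (contDiffOn_dz hΩ hG) hz
  have h2 := differentiableAt_of_contDiffOn hΩ (contDiffOn_dzbar hΩ hG) hz
  have hI : ∀ v, fderiv ℝ (fun w => fderiv ℝ G w Complex.I) z v
      = Complex.I • (fderiv ℝ (dz G) z v - fderiv ℝ (dzbar G) z v) := fun v => by
    simp only [fderiv_I_eq]
    have h : HasFDerivAt (fun w => Complex.I • (dz G w - dzbar G w)) _ z :=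
      (h1.hasFDerivAt.sub h2.hasFDerivAt).const_smul Complex.I
    rw [h.fderiv]
    rfl
  have hc : dz (dzbar G) z = dzbar (dz G) z := dz_dzbar_comm hΩ hG hz
  refine ⟨?_, ?_, ?_⟩
  · have h : HasFDerivAt (fun w => dz G w + dzbar G w) _ z := h1.hasFDerivAt.add h2.hasFDerivAt
    rw [funext fun w => fderiv_one_eq G w, h.fderiv, add_apply, fderiv_one_eq, fderiv_one_eq, hc]
    module
  · rw [hI, fderiv_one_eq, fderiv_one_eq, hc]
    module
  · rw [hI, fderiv_I_eq, fderiv_I_eq, hc, ← smul_sub, smul_smul, Complex.I_mul_I]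
    module

theorem mink_neg_left (x y : Mink n) : mink (-x) y = -mink x y := by
  rw [← neg_one_smul ℂ x, mink_smul_left, neg_one_mul]

theorem mink_neg_right (x y : Mink n) : mink x (-y) = -mink x y := by
  rw [mink_comm, mink_neg_left, mink_comm]

/-- `hasDerivAt_liftDensity` in terms of Wirtinger derivatives. -/
theorem hasDerivAt_liftDensity_wirtinger {X₁ X₂ X₁₁ X₁₂ X₂₂ : ℝ → Mink n}
    {Y₁ Y₂ Y₁₁ Y₁₂ Y₂₂ P₁ P₂ P₁₁ P₁₂ P₂₂ b₁ b₂ b₁₁ b₁₂ b₂₂ : Mink n} {s k p q : ℂ}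
    (h₁ : HasDerivAt X₁ b₁ 0) (h₂ : HasDerivAt X₂ b₂ 0) (h₁₁ : HasDerivAt X₁₁ b₁₁ 0)
    (h₁₂ : HasDerivAt X₁₂ b₁₂ 0) (h₂₂ : HasDerivAt X₂₂ b₂₂ 0)
    (i₁ : X₁ 0 = Y₁ + Y₂) (i₂ : X₂ 0 = Complex.I • (Y₁ - Y₂))
    (i₁₁ : X₁₁ 0 = Y₁₁ + (2 : ℂ) • Y₁₂ + Y₂₂) (i₁₂ : X₁₂ 0 = Complex.I • (Y₁₁ - Y₂₂))
    (i₂₂ : X₂₂ 0 = -(Y₁₁ - (2 : ℂ) • Y₁₂ + Y₂₂))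
    (e₁ : b₁ = P₁ + P₂) (e₂ : b₂ = Complex.I • (P₁ - P₂))
    (e₁₁ : b₁₁ = P₁₁ + (2 : ℂ) • P₁₂ + P₂₂) (e₁₂ : b₁₂ = Complex.I • (P₁₁ - P₂₂))
    (e₂₂ : b₂₂ = -(P₁₁ - (2 : ℂ) • P₁₂ + P₂₂))
    (g₁₁ : mink Y₁ Y₁ = 0) (g₁₂ : mink Y₁ Y₂ = 1 / 2) (g₂₂ : mink Y₂ Y₂ = 0)
    (m₁ : mink Y₁₁ Y₁ = 0) (m₂ : mink Y₁₁ Y₂ = 0) (m₃ : mink Y₂₂ Y₁ = 0) (m₄ : mink Y₂₂ Y₂ = 0)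
    (m₅ : mink Y₁₂ Y₁ = 0) (m₆ : mink Y₁₂ Y₂ = 0)
    (w₁ : mink Y₁₂ Y₁₁ = s / 4) (w₂ : mink Y₁₂ Y₂₂ = conj s / 4)
    (k₁ : mink Y₁ P₁ = -k) (k₂ : mink Y₁ P₂ = 0) (k₃ : mink Y₂ P₁ = 0) (k₄ : mink Y₂ P₂ = -conj k)
    (q₁ : mink Y₁₁ P₁₁ = p) (q₂ : mink Y₂₂ P₂₂ = conj p)
    (q₃ : mink Y₁₁ P₂₂ = q) (q₄ : mink Y₂₂ P₁₁ = conj q) :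
    HasDerivAt (fun t => liftDensity (X₁ t) (X₂ t) (X₁₁ t) (X₁₂ t) (X₂₂ t))
      (2 * q.re + 2 * (conj s * k).re) 0 := by
  have g₂₁ : mink Y₂ Y₁ = 1 / 2 := by rw [mink_comm, g₁₂]
  have r₁ : rm (Y₁ + Y₂) b₁ = -2 * k.re := by
    rw [e₁]
    simp only [rm, mink_add_left, mink_add_right, k₁, k₂, k₃, k₄]
    simp
    ring
  have r₂ : rm (Y₁ + Y₂) b₂ = 2 * k.im := by
    rw [e₂]
    simp only [rm, mink_add_left, mink_smul_right, mink_sub_right, k₁, k₂, k₃, k₄]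
    simp
    ring
  have r₃ : rm (Complex.I • (Y₁ - Y₂)) b₁ = 2 * k.im := by
    rw [e₁]
    simp only [rm, mink_add_right, mink_smul_left, mink_sub_left, k₁, k₂, k₃, k₄]
    simp
    ring
  have r₄ : rm (Complex.I • (Y₁ - Y₂)) b₂ = 2 * k.re := by
    rw [e₂]
    simp only [rm, mink_smul_left, mink_smul_right, mink_sub_left, mink_sub_right, k₁, k₂, k₃, k₄]
    simp
    ring
  refine (hasDerivAt_liftDensity h₁ h₂ h₁₁ h₁₂ h₂₂ i₁ i₂ i₁₁ i₁₂ i₂₂ ?_ ?_ ?_ ?_ ?_ ?_ ?_ ?_ ?_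
    ?_).congr_deriv ?_
  -- The variation of the metric is trace-free because the mixed products `k₂` and `k₃` vanish.
  case refine_10 => rw [r₁, r₄]; ring
  case refine_11 =>
    have d₁ : Y₁₁ + (2 : ℂ) • Y₁₂ + Y₂₂ - -(Y₁₁ - (2 : ℂ) • Y₁₂ + Y₂₂) = (2 : ℂ) • (Y₁₁ + Y₂₂) := by
      module
    have d₂ : Y₁₁ + (2 : ℂ) • Y₁₂ + Y₂₂ + -(Y₁₁ - (2 : ℂ) • Y₁₂ + Y₂₂) = (4 : ℂ) • Y₁₂ := by
      module
    have d₃ : -(Y₁₁ - (2 : ℂ) • Y₁₂ + Y₂₂) - (Y₁₁ + (2 : ℂ) • Y₁₂ + Y₂₂)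
        = -((2 : ℂ) • (Y₁₁ + Y₂₂)) := by module
    have d₄ : b₁₁ - b₂₂ = (2 : ℂ) • (P₁₁ + P₂₂) := by rw [e₁₁, e₂₂]; module
    -- The (u,u)-(v,v) difference contributes Re p + Re q and the (u,v) term contributes Re q - Re p
    -- in equal weight, so p cancels.
    rw [d₁, d₂, d₃, d₄, r₁, r₂, r₃, e₁₂]
    simp only [rm, mink_smul_left, mink_smul_right, mink_add_left, mink_add_right, mink_sub_left,
      mink_sub_right, mink_neg_right, mink_real_smul_right, w₁, w₂, q₁, q₂, q₃, q₄]
    simp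
    ring
  all_goals
    simp only [rm, mink_add_left, mink_add_right, mink_sub_left, mink_sub_right, mink_smul_left,
      mink_smul_right, mink_neg_left, g₁₁, g₁₂, g₂₁, g₂₂, m₁, m₂, m₃, m₄, m₅, m₆]
    norm_num

/-- The family of light-like lifts with initial velocity `ψ`. -/
def liftFamily (f : ℂ → EuclideanSpace ℝ (Fin (n + 1))) (ψ : ℂ → Mink n) : ℝ → ℂ → Mink n :=
  quadFamily (lift f) ψ fun z => (mink (ψ z) (ψ z) / 2) • frameN f z

variable (hΩ : IsOpen Ω) (hf : IsConformalImmersion Ω f) {ψ : ℂ → Mink n}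
  (hψ : ContDiffOn ℝ ∞ ψ Ω) (hn : ∀ z ∈ Ω, IsNormal f z (ψ z)) (hr : ∀ z ∈ Ω, cconj (ψ z) = ψ z)

include hΩ hf

theorem contDiffOn_liftFamily_coeff (hψ : ContDiffOn ℝ ∞ ψ Ω) :
    ContDiffOn ℝ ∞ (fun z => (mink (ψ z) (ψ z) / 2) • frameN f z) Ω :=
  contDiffOn_fun_smul ((contDiffOn_mink hψ hψ).div_const 2) (contDiffOn_frameN hΩ hf)

include hr in
theorem cconj_liftFamily (t : ℝ) (hz : z ∈ Ω) :
    cconj (liftFamily f ψ t z) = liftFamily f ψ t z := by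
  have h : conj (mink (ψ z) (ψ z)) = mink (ψ z) (ψ z) := by rw [← mink_cconj, hr z hz]
  have hs : ∀ (a : ℝ) (x : Mink n), cconj (a • x) = a • cconj x := fun a x => by
    rw [← Complex.coe_smul, cconj_smul, Complex.conj_ofReal, Complex.coe_smul]
  simp only [liftFamily, quadFamily, cconj_add, hs, cconj_lift, hr z hz, cconj_smul,
    cconj_frameN hΩ hf hz, map_div₀, h, conj_two]

include hn

/-- The coefficient ⟨ψ, ψ⟩/2 of t² N makes the cross term with Y, where ⟨Y, N⟩ = -1, cancel t²⟨ψ,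
ψ⟩. -/
theorem mink_liftFamily (t : ℝ) (hz : z ∈ Ω) :
    mink (liftFamily f ψ t z) (liftFamily f ψ t z) = 0 := by
  have h1 := (hn z hz).lift
  have h2 := (hn z hz).frameN
  simp only [liftFamily, quadFamily, mink_add_left, mink_add_right, mink_real_smul_left,
    mink_real_smul_right, mink_smul_left, mink_smul_right, mink_comm (lift f z) (ψ z),
    mink_comm (frameN f z) (ψ z), mink_comm (lift f z) (frameN f z), h1, h2,
    mink_lift_lift hf hz, mink_frameN_lift hΩ hf hz, mink_frameN_frameN hΩ hf hz]
  push_cast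
  ring

/-- The product with N is -1 for every t, so the family represents points of the sphere without any
smallness of t. -/
theorem liftFamily_ne_zero (t : ℝ) (hz : z ∈ Ω) : liftFamily f ψ t z ≠ 0 := by
  intro h
  have h2 : mink (liftFamily f ψ t z) (frameN f z) = -1 := by
    simp only [liftFamily, quadFamily, mink_add_left, mink_real_smul_left, mink_smul_left,
      (hn z hz).frameN, mink_frameN_frameN hΩ hf hz, mink_comm (lift f z) (frameN f z),
      mink_frameN_lift hΩ hf hz]
    ring
  rw [h, mink_zero_left] at h2
  norm_num at h2

include hψ in
/-- The products of the derivatives of the lift and of a normal field. -/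
theorem mink_deriv_lift_deriv_normal (hz : z ∈ Ω) :
    mink (dz (lift f) z) (dz ψ z) = -mink (hopf f z) (ψ z) ∧
      mink (dz (lift f) z) (dzbar ψ z) = 0 ∧
      mink (lift f z) (dzbar (dzbar ψ) z) = mink (dzbar (dzbar (lift f)) z) (ψ z) := by
  have n1 : ∀ w ∈ Ω, mink (dz (lift f) w) (ψ w) = 0 := fun w hw => by
    rw [mink_comm]; exact (hn w hw).dz
  have n2 : ∀ w ∈ Ω, mink (dzbar (lift f) w) (ψ w) = 0 := fun w hw => by
    rw [mink_comm]; exact (hn w hw).dzbar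
  have n3 : ∀ w ∈ Ω, mink (lift f w) (ψ w) = 0 := fun w hw => by
    rw [mink_comm]; exact (hn w hw).lift
  have hY := contDiffOn_lift hΩ hf
  have hz1 := contDiffOn_dz_lift hΩ hf
  have hz2 := contDiffOn_dzbar_lift hΩ hf
  refine ⟨?_, ?_, ?_⟩
  · have h := mink_dz_add_eq_zero hΩ hz1 hψ 0 n1 hz
    have h2 : mink (hopf f z) (ψ z) = mink (dz (dz (lift f)) z) (ψ z) := by
      rw [hopf, mink_add_left, mink_smul_left, n3 z hz, mul_zero, add_zero]
    rw [h2]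
    linear_combination h
  · have h := mink_dzbar_add_eq_zero hΩ hz1 hψ 0 n1 hz
    rw [mink_comm (dzbar (dz (lift f)) z), (hn z hz).lapl] at h
    linear_combination h
  · have n4 : ∀ w ∈ Ω, mink (lift f w) (dzbar ψ w) = 0 := fun w hw => by
      have h := mink_dzbar_add_eq_zero hΩ hY hψ 0 n3 hw
      rw [n2 w hw] at h
      linear_combination h
    have h := mink_dzbar_add_eq_zero hΩ hY (contDiffOn_dzbar hΩ hψ) 0 n4 hz
    have h2 := mink_dzbar_add_eq_zero hΩ hz2 hψ 0 n2 hz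
    linear_combination h - h2

include hψ hr in
/-- The first variation of the Möbius density. -/
theorem hasDerivAt_quadDensity (C : ℂ → Mink n) (hz : z ∈ Ω) :
    HasDerivAt (fun t => quadDensity (lift f) ψ C t z)
      (2 * (mink (hopf f z) (dzbar (dzbar ψ) z)
        + conj (schwarzian f z) / 2 * mink (hopf f z) (ψ z)).re) 0 := by
  have hY := contDiffOn_lift hΩ hf
  have cz : ∀ w ∈ Ω, cconj (dz ψ w) = dzbar ψ w := fun w hw => by
    rw [← dzbar_cconj (differentiableAt_of_contDiffOn hΩ hψ hw)]
    exact dzbar_congr hΩ hr hw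
  have czz : cconj (dz (dz ψ) z) = dzbar (dzbar ψ) z := by
    rw [← dzbar_cconj (differentiableAt_of_contDiffOn hΩ (contDiffOn_dz hΩ hψ) hz)]
    exact dzbar_congr hΩ cz hz
  have cY : cconj (dz (dz (lift f)) z) = dzbar (dzbar (lift f)) z := by
    rw [← dzbar_cconj (differentiableAt_of_contDiffOn hΩ (contDiffOn_dz hΩ hY) hz)]
    exact dzbar_congr hΩ (fun w hw => cconj_dz_lift hΩ hf hw) hz
  have c1 := cconj_dz_lift hΩ hf hz
  have c2 := cz z hz
  obtain ⟨p1, p2, p3⟩ := mink_deriv_lift_deriv_normal hΩ hf hψ hn hz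
  have p1' : mink (dzbar (lift f) z) (dzbar ψ z) = -conj (mink (hopf f z) (ψ z)) := by
    rw [← c1, ← c2, mink_cconj, p1, map_neg]
  have p2' : mink (dzbar (lift f) z) (dz ψ z) = 0 := by
    rw [← c1, ← cconj_cconj (dz ψ z), c2, mink_cconj, p2, map_zero]
  have q1 : mink (dzbar (dzbar (lift f)) z) (dzbar (dzbar ψ) z)
      = conj (mink (dz (dz (lift f)) z) (dz (dz ψ) z)) := by rw [← cY, ← czz, mink_cconj]
  have q2 : mink (dzbar (dzbar (lift f)) z) (dz (dz ψ) z)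
      = conj (mink (dz (dz (lift f)) z) (dzbar (dzbar ψ) z)) := by
    rw [← cY, ← cconj_cconj (dz (dz ψ) z), czz, mink_cconj]
  have n3 : mink (lift f z) (ψ z) = 0 := by rw [mink_comm]; exact (hn z hz).lift
  have q3 : mink (hopf f z) (dzbar (dzbar ψ) z) = mink (dz (dz (lift f)) z) (dzbar (dzbar ψ) z)
      + schwarzian f z / 2 * conj (mink (hopf f z) (ψ z)) := by
    have h : mink (hopf f z) (ψ z) = mink (dz (dz (lift f)) z) (ψ z) := by
      rw [hopf, mink_add_left, mink_smul_left, n3, mul_zero, add_zero]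
    rw [h, ← mink_cconj, cY, hr z hz, hopf, mink_add_left, mink_smul_left, p3]
  -- Y_zz is orthogonal to Y, so only the part N/2 of Y_zz̄ contributes, and ⟨Y_zz, N⟩ = s/2.
  have w1 : mink (dzbar (dz (lift f)) z) (dz (dz (lift f)) z) = schwarzian f z / 4 := by
    rw [lapl_eq, mink_sub_left, mink_smul_left, mink_smul_left, mink_comm (lift f z),
      mink_dzdz_lift hΩ hf hz, mink_comm (frameN f z), schwarzian]
    ring
  have w2 : mink (dzbar (dz (lift f)) z) (dzbar (dzbar (lift f)) z)
      = conj (schwarzian f z) / 4 := by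
    rw [← cY, ← cconj_lapl hΩ hf hz, mink_cconj, w1, map_div₀]
    congr 1
    exact Complex.conj_ofNat 4
  obtain ⟨y1, y2, y3⟩ := fderiv_fderiv_eq hΩ hY hz
  obtain ⟨x1, x2, x3⟩ := fderiv_fderiv_eq hΩ hψ hz
  have t1 := mink_dz_dz hΩ hf hz
  have t2 := mink_dz_dzbar hΩ hf hz
  have t3 := mink_dzbar_dz hΩ hf hz
  have t4 := mink_dzbar_dzbar hΩ hf hz
  have t5 := mink_dzdz_dz hΩ hf hz
  have t6 := mink_dzdz_dzbar hΩ hf hz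
  have t7 : mink (dzbar (dzbar (lift f)) z) (dzbar (lift f) z) = 0 := by
    rw [← cY, ← c1, mink_cconj, t5, map_zero]
  have t8 : mink (dzbar (dzbar (lift f)) z) (dz (lift f) z) = 0 := by
    rw [← cY, ← cconj_dzbar_lift hΩ hf hz, mink_cconj, t6, map_zero]
  have t9 := mink_lapl_dz hΩ hf hz
  have t10 := mink_lapl_dzbar hΩ hf hz
  refine (hasDerivAt_liftDensity_wirtinger
    (hasDerivAt_quadFamily _ _ _ z) (hasDerivAt_quadFamily _ _ _ z) (hasDerivAt_quadFamily _ _ _ z)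
    (hasDerivAt_quadFamily _ _ _ z) (hasDerivAt_quadFamily _ _ _ z)
    ((quadFamily_zero _ _ _ z).trans (fderiv_one_eq _ _))
    ((quadFamily_zero _ _ _ z).trans (fderiv_I_eq _ _)) ((quadFamily_zero _ _ _ z).trans y1)
    ((quadFamily_zero _ _ _ z).trans y2) ((quadFamily_zero _ _ _ z).trans y3)
    (fderiv_one_eq _ _) (fderiv_I_eq _ _) x1 x2 x3 t1 t2 t4 t5 t6 t8 t7 t9 t10 w1 w2 p1 p2 p2' p1'
    rfl q1 rfl q2).congr_deriv ?_
  -- Passing from Y_zz to κ in the leading term contributes (s/2) times the conjugate of ⟨κ, ψ⟩. Its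
  -- real part accounts for half of Re(s̄⟨κ, ψ⟩), which leaves the coefficient s̄/2.
  rw [q3]
  simp
  ring

end FirstVariation

/-! ### The Euler-Lagrange equation of Willmore surfaces -/

section EulerLagrange

open MeasureTheory Set

variable {n : ℕ} {f : ℂ → EuclideanSpace ℝ (Fin (n + 1))} {Ω : Set ℂ} {z : ℂ}

theorem contDiffOn_re_apply {X : Type*} [NormedAddCommGroup X] [NormedSpace ℝ X] {s : Set X}
    {F : X → Mink n} (hF : ContDiffOn ℝ ∞ F s) (i : Fin (n + 2)) :
    ContDiffOn ℝ ∞ (fun q => (F q i).re) s :=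
  Complex.reCLM.contDiff.comp_contDiffOn (contDiffOn_pi.1 hF i)

theorem contDiffOn_sphereMap {X : Type*} [NormedAddCommGroup X] [NormedSpace ℝ X] {s : Set X}
    {F : X → Mink n} (hF : ContDiffOn ℝ ∞ F s) (h0 : ∀ q ∈ s, (F q 0).re ≠ 0) :
    ContDiffOn ℝ ∞ (fun q => sphereMap (F q)) s := by
  rw [contDiffOn_euclidean]
  intro i
  exact ((contDiffOn_re_apply hF 0).inv h0).mul (contDiffOn_re_apply hF i.succ)

theorem sphereMap_lift (hf : IsConformalImmersion Ω f) (hz : z ∈ Ω) :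
    sphereMap (lift f z) = f z := by
  rw [lift_eq, sphereMap_smul_lightVec (liftFactor_pos hf hz).ne']

/-- Differentiating the factor l adds only multiples of the null vector (1, F), which is orthogonal
to the derivatives of F. It follows that an immersed lift represents an immersed map. -/
theorem gramDet_smul_lightVec {F : ℂ → EuclideanSpace ℝ (Fin (n + 1))} {l : ℂ → ℝ} {W : Set ℂ}
    (hW : IsOpen W) (hF : ContDiffOn ℝ ∞ F W) (hl : ContDiffOn ℝ ∞ l W) (h1 : ∀ w ∈ W, ‖F w‖ = 1)
    {X : ℂ → Mink n} (hX : ∀ w ∈ W, X w = l w • lightVec (F w)) (hz : z ∈ W) :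
    gramDet (fderiv ℝ X z 1) (fderiv ℝ X z Complex.I) = l z ^ 4 * gDet F z := by
  have hX1 : X =ᶠ[nhds z] fun w => l w • lightVec (F w) := by
    filter_upwards [hW.mem_nhds hz] with y hy using hX y hy
  have e : ∀ v, fderiv ℝ X z v = l z • spatial n (fderiv ℝ F z v)
      + fderiv ℝ l z v • lightVec (F z) := fun v => by
    rw [hX1.fderiv_eq, fderiv_smul_lightVec (differentiableAt_of_contDiffOn_real hW hF hz)
      (differentiableAt_of_contDiffOn_real hW hl hz)]
  have h0 := fun v => inner_fderiv_eq_zero hW hF h1 hz v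
  have h2 : ∀ u v, rm (fderiv ℝ X z u) (fderiv ℝ X z v)
      = l z ^ 2 * inner ℝ (fderiv ℝ F z u) (fderiv ℝ F z v) := fun u v => by
    rw [e, e]
    simp only [rm_add_left, rm_add_right, rm_smul_left, rm_smul_right, rm_spatial_spatial,
      rm_comm (spatial n _) (lightVec _), rm_lightVec_spatial, rm_lightVec_self (h1 z hz), h0]
    ring
  simp only [gramDet, h2, gDet, gE, gF, gG, du, dv]
  ring

/-! ### The variation given by a compactly supported real normal field. -/

section Variation

variable (hΩ : IsOpen Ω) (hf : IsConformalImmersion Ω f) {ψ : ℂ → Mink n}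
  (hψ : ContDiffOn ℝ ∞ ψ Ω) (hn : ∀ z ∈ Ω, IsNormal f z (ψ z)) (hr : ∀ z ∈ Ω, cconj (ψ z) = ψ z)

include hΩ hf hψ

theorem contDiffOn_liftFamily (J : Set ℝ) :
    ContDiffOn ℝ ∞ (fun q : ℝ × ℂ => liftFamily f ψ q.1 q.2) (J ×ˢ Ω) :=
  contDiffOn_quadFamily (contDiffOn_lift hΩ hf) hψ (contDiffOn_liftFamily_coeff hΩ hf hψ) J

include hn hr

theorem isVariation_liftFamily {K : Set ℂ} (hK : IsCompact K) (hKΩ : K ⊆ Ω)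
    (h0 : ∀ z ∈ Ω \ K, ψ z = 0) :
    IsVariation Ω f 1 K fun t z => sphereMap (liftFamily f ψ t z) where
  eps_pos := one_pos
  compact := hK
  subset := hKΩ
  smooth := contDiffOn_sphereMap (contDiffOn_liftFamily hΩ hf hψ _) fun q hq =>
    (re_zero_ne_zero (cconj_liftFamily hΩ hf hr q.1 hq.2) (mink_liftFamily hΩ hf hn q.1 hq.2)
      (liftFamily_ne_zero hΩ hf hn q.1 hq.2)).1
  norm_eq_one t _ z hz := norm_sphereMap (cconj_liftFamily hΩ hf hr t hz)
    (mink_liftFamily hΩ hf hn t hz) (liftFamily_ne_zero hΩ hf hn t hz)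
  initial z hz := by simp only [liftFamily, quadFamily_zero, sphereMap_lift hf hz]
  support t _ z hz := by
    simp only [liftFamily, quadFamily, h0 z hz, mink_zero_left, zero_div, zero_smul, smul_zero,
      add_zero, sphereMap_lift hf hz.1]

theorem willmoreDensity_liftFamily (t : ℝ) (hz : z ∈ Ω)
    (hd : quadDet (lift f) ψ (fun z => (mink (ψ z) (ψ z) / 2) • frameN f z) t z ≠ 0) :
    willmoreDensity (fun z => sphereMap (liftFamily f ψ t z)) z
      = quadDensity (lift f) ψ (fun z => (mink (ψ z) (ψ z) / 2) • frameN f z) t z := by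
  have hC := contDiffOn_liftFamily_coeff hΩ hf hψ
  have hY := contDiffOn_lift hΩ hf
  have hX : ContDiffOn ℝ ∞ (liftFamily f ψ t) Ω :=
    (hY.add (hψ.const_smul t)).add (hC.const_smul (t ^ 2))
  have hl0 : ∀ w ∈ Ω, (liftFamily f ψ t w 0).re ≠ 0 := fun w hw =>
    (re_zero_ne_zero (cconj_liftFamily hΩ hf hr t hw) (mink_liftFamily hΩ hf hn t hw)
      (liftFamily_ne_zero hΩ hf hn t hw)).1
  have hF := contDiffOn_sphereMap hX hl0
  have hl := contDiffOn_re_apply hX 0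
  have h1 : ∀ w ∈ Ω, ‖sphereMap (liftFamily f ψ t w)‖ = 1 := fun w hw =>
    norm_sphereMap (cconj_liftFamily hΩ hf hr t hw)
      (mink_liftFamily hΩ hf hn t hw) (liftFamily_ne_zero hΩ hf hn t hw)
  have hXl : ∀ w ∈ Ω, liftFamily f ψ t w
      = (liftFamily f ψ t w 0).re • lightVec (sphereMap (liftFamily f ψ t w)) := fun w hw => by
    rw [← Complex.coe_smul]
    exact eq_smul_lightVec_sphereMap (cconj_liftFamily hΩ hf hr t hw)
      (mink_liftFamily hΩ hf hn t hw) (liftFamily_ne_zero hΩ hf hn t hw)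
  have hdet := gramDet_smul_lightVec hΩ hF hl h1 hXl hz
  have hq : gramDet (fderiv ℝ (liftFamily f ψ t) z 1) (fderiv ℝ (liftFamily f ψ t) z Complex.I)
      = quadDet (lift f) ψ (fun z => (mink (ψ z) (ψ z) / 2) • frameN f z) t z := by
    simp only [liftFamily, fderiv_quadFamily hΩ hY hψ hC t hz, quadDet]
  rw [← jetDensity_quadFamily hΩ hY hψ hC t hz]
  refine willmoreDensity_eq hΩ hF hl h1 hXl hz (hl0 z hz) fun h => hd ?_
  rw [← hq, hdet, h, mul_zero]

theorem hasDerivAt_willmoreFunctional {K : Set ℂ} (hK : IsCompact K) (hKΩ : K ⊆ Ω) :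
    HasDerivAt (fun t => willmoreFunctional (fun z => sphereMap (liftFamily f ψ t z)) K)
      (∫ z in K, 2 * (mink (hopf f z) (dzbar (dzbar ψ) z)
        + conj (schwarzian f z) / 2 * mink (hopf f z) (ψ z)).re) 0 := by
  have hC := contDiffOn_liftFamily_coeff hΩ hf hψ
  have hY := contDiffOn_lift hΩ hf
  refine hasDerivAt_setIntegral_of_contDiffOn (isOpen_quadDomain hΩ hY hψ hC)
    (contDiffOn_quadDensity hΩ hY hψ hC) hK (fun z hz => ⟨⟨mem_univ _, hKΩ hz⟩, ?_⟩)
    (fun q hq => willmoreDensity_liftFamily hΩ hf hψ hn hr q.1 hq.1.2 hq.2)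
    fun z hz => hasDerivAt_quadDensity hΩ hf hψ hn hr _ (hKΩ hz)
  have hz := hKΩ hz
  -- The canonical lift satisfies |dY|² = |dz|², so at t = 0 the Gram determinant is 1 and {0} × K
  -- lies in the domain of the density formula.
  have : quadDet (lift f) ψ (fun z => (mink (ψ z) (ψ z) / 2) • frameN f z) 0 z = 1 := by
    simp only [quadDet, quadFamily_zero, fderiv_one_eq, fderiv_I_eq, gramDet, rm, mink_add_left,
      mink_add_right, mink_smul_left, mink_smul_right, mink_sub_left, mink_sub_right,
      mink_dz_dz hΩ hf hz, mink_dz_dzbar hΩ hf hz, mink_dzbar_dz hΩ hf hz,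
      mink_dzbar_dzbar hΩ hf hz]
    norm_num
  change quadDet (lift f) ψ (fun z => (mink (ψ z) (ψ z) / 2) • frameN f z) 0 z ≠ 0
  rw [this]
  exact one_ne_zero

omit hn hr in
/-- Integration by parts in the first variation. -/
theorem integral_first_variation {K : Set ℂ} (hK : IsCompact K) (hKΩ : K ⊆ Ω)
    (h0 : ∀ z, z ∉ K → ψ z = 0) :
    (∫ z in K, 2 * (mink (hopf f z) (dzbar (dzbar ψ) z)
        + conj (schwarzian f z) / 2 * mink (hopf f z) (ψ z)).re)
      = ∫ z in K, 2 * (mink (willmoreVec f z) (ψ z)).re := by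
  have hκ := contDiffOn_hopf hΩ hf
  have hκ' := contDiffOn_dzbar hΩ hκ
  have hψ' := contDiffOn_dzbar hΩ hψ
  -- The divergence term: h_z̄ = ⟨κ, ψ_z̄z̄⟩ - ⟨κ_z̄z̄, ψ⟩, the two first-order terms cancelling. It
  -- is smooth on all of ℂ because ψ vanishes off K.
  set h : ℂ → ℂ := fun w => mink (hopf f w) (dzbar ψ w) - mink (dzbar (hopf f) w) (ψ w) with hh
  have hcΩ : ContDiffOn ℝ ∞ h Ω := (contDiffOn_mink hκ hψ').sub (contDiffOn_mink hκ' hψ)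
  have hz0 : ∀ z, z ∉ K → h z = 0 := fun z hz => by
    have e : dzbar ψ z = dzbar (fun _ => 0) z :=
      dzbar_congr hK.isClosed.isOpen_compl (fun w hw => h0 w hw) hz
    simp only [hh, e, h0 z hz, dzbar_const, mink_zero_right, sub_zero]
  have hc : ContDiff ℝ ∞ h := by
    rw [contDiff_iff_contDiffAt]
    intro z
    by_cases hz : z ∈ K
    · exact hcΩ.contDiffAt (hΩ.mem_nhds (hKΩ hz))
    · refine contDiffAt_const (c := (0 : ℂ)) |>.congr_of_eventuallyEq ?_
      filter_upwards [hK.isClosed.isOpen_compl.mem_nhds hz] with w hw using hz0 w hw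
  have hs : HasCompactSupport h := HasCompactSupport.intro hK hz0
  have hd : ∀ z ∈ K, 2 * (mink (hopf f z) (dzbar (dzbar ψ) z)
        + conj (schwarzian f z) / 2 * mink (hopf f z) (ψ z)).re
      = 2 * (dzbar h z).re + 2 * (mink (willmoreVec f z) (ψ z)).re := fun z hz => by
    have hz := hKΩ hz
    have dκ := differentiableAt_of_contDiffOn hΩ hκ hz
    have dκ' := differentiableAt_of_contDiffOn hΩ hκ' hz
    have dψ := differentiableAt_of_contDiffOn hΩ hψ hz
    have dψ' := differentiableAt_of_contDiffOn hΩ hψ' hz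
    have e : dzbar h z = mink (hopf f z) (dzbar (dzbar ψ) z)
        - mink (dzbar (dzbar (hopf f)) z) (ψ z) := by
      rw [hh, dzbar_sub (differentiableAt_of_contDiffOn hΩ (contDiffOn_mink hκ hψ') hz)
        (differentiableAt_of_contDiffOn hΩ (contDiffOn_mink hκ' hψ) hz), dzbar_mink dκ dψ',
        dzbar_mink dκ' dψ]
      ring
    rw [e, willmoreVec, mink_add_left, mink_smul_left]
    simp only [Complex.sub_re, Complex.add_re]
    ring
  have hi := integrable_dzbar hc hs
  have hre : ∫ z in K, (dzbar h z).re = 0 := by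
    have h1 : ∫ z in K, dzbar h z = 0 := by
      rw [setIntegral_eq_integral_of_forall_compl_eq_zero, integral_dzbar_eq_zero hc hs]
      intro z hz
      have e : dzbar h z = dzbar (fun _ => 0) z :=
        dzbar_congr hK.isClosed.isOpen_compl (fun w hw => hz0 w hw) hz
      rw [e, dzbar_const]
    have h2 := integral_re (𝕜 := ℂ) (hi.integrableOn (s := K))
    rw [h1] at h2
    simpa using h2
  have hi2 : IntegrableOn (fun z => 2 * (mink (willmoreVec f z) (ψ z)).re) K :=
    ((Complex.continuous_re.comp_continuousOn
      (contDiffOn_mink (contDiffOn_willmoreVec hΩ hf) hψ).continuousOn).const_smul (2 : ℝ)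
      |>.mono hKΩ).integrableOn_compact hK
  rw [setIntegral_congr_fun hK.measurableSet hd, integral_add _ hi2, integral_const_mul, hre,
    mul_zero, zero_add]
  exact (hi.integrableOn.re).const_mul 2

end Variation

/-- A real normal vector of length zero vanishes. -/
theorem IsNormal.eq_zero (hΩ : IsOpen Ω) (hf : IsConformalImmersion Ω f) (hz : z ∈ Ω) {x : Mink n}
    (hx : IsNormal f z x) (hr : WillmoreAdjoint.cconj x = x) (h0 : mink x x = 0) : x = 0 := by
  by_contra hne
  obtain ⟨h1, -⟩ := re_zero_ne_zero hr h0 hne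
  have h2 := eq_smul_lightVec_sphereMap hr h0 hne
  have h3 := hx.lift
  have hl := (liftFactor_pos hf hz).ne'
  rw [h2, lift_eq, mink_smul_left, mink_smul_right, mul_eq_zero, mul_eq_zero,
    Complex.ofReal_eq_zero, Complex.ofReal_eq_zero] at h3
  have h4 : mink (lightVec (sphereMap x)) (lightVec (f z)) = 0 := by tauto
  -- Orthogonality of the null vectors x and Y is the equality case of Cauchy–Schwarz on the sphere,
  -- so x is a multiple of Y. Since ⟨Y, N⟩ = -1, orthogonality to N rules out x ≠ 0.
  have h5 : inner ℝ (sphereMap x) (f z) = (1 : ℝ) := by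
    have h6 := congrArg Complex.re h4
    simp [mink, lightVec] at h6
    rw [PiLp.inner_apply]
    simp only [RCLike.inner_apply, conj_trivial, mul_comm (f z _)]
    linarith
  have h6 : sphereMap x = f z :=
    (inner_eq_one_iff_of_norm_eq_one (norm_sphereMap hr h0 hne) (hf.norm_eq_one z hz)).1 h5
  have h7 := hx.frameN
  have h8 : lightVec (f z) = ((liftFactor f z : ℝ) : ℂ)⁻¹ • WillmoreAdjoint.lift f z := by
    rw [lift_eq, smul_smul, inv_mul_cancel₀ (Complex.ofReal_ne_zero.2 hl), one_smul]
  rw [h2, h6, h8, mink_smul_left, mink_smul_left, mink_comm, mink_frameN_lift hΩ hf hz] at h7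
  simp [h1, hl] at h7

/-- The Euler-Lagrange equation of Willmore surfaces. -/
theorem IsWillmore.mink_willmoreVec (hΩ : IsOpen Ω) (hW : IsWillmore Ω f) (hz : z ∈ Ω) {x : Mink n}
    (hx : IsNormal f z x) : mink (willmoreVec f z) x = 0 := by
  have hf := hW.immersion
  -- A real normal field. By the Codazzi equation it pairs with normal vectors as twice
  -- `willmoreVec` does.
  set Q : ℂ → Mink n := fun w => normalProj f w (willmoreVec f w + cconj (willmoreVec f w)) with hQ
  have hQs : ContDiffOn ℝ ∞ Q Ω := contDiffOn_normalProj hΩ hf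
    (contDiffOn_fun_add (contDiffOn_willmoreVec hΩ hf)
      (contDiffOn_cconj (contDiffOn_willmoreVec hΩ hf)))
  have hQn : ∀ w ∈ Ω, IsNormal f w (Q w) := fun w hw => isNormal_normalProj hΩ hf hw _
  have hQr : ∀ w ∈ Ω, cconj (Q w) = Q w := fun w hw => by
    simp only [hQ]
    rw [cconj_normalProj hΩ hf hw, cconj_add, cconj_cconj, add_comm]
  have hQx : ∀ w ∈ Ω, ∀ y, IsNormal f w y → mink (Q w) y = 2 * mink (willmoreVec f w) y :=
    fun w hw y hy => by
      simp only [hQ]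
      rw [hy.mink_normalProj, mink_add_left, mink_cconj_willmoreVec hΩ hf hw hy, two_mul]
  have hq : ContinuousOn (fun w => (mink (Q w) (Q w)).re) Ω :=
    Complex.continuous_re.comp_continuousOn (contDiffOn_mink hQs hQs).continuousOn
  have hae : ∀ᵐ w, w ∈ Ω → (mink (Q w) (Q w)).re = 0 := by
    refine hΩ.ae_eq_zero_of_integral_contDiff_smul_eq_zero
      (hq.locallyIntegrableOn hΩ.measurableSet) fun χ hχ hχc hχΩ => ?_
    -- With the test field χ Q, the integrand 2 Re⟨W, χ Q⟩ of the first variation becomes χ Re⟨Q,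
    -- Q⟩.
    have hψ : ContDiff ℝ ∞ fun w => χ w • Q w := contDiff_smul_of_tsupport_subset hΩ hχ hχΩ hQs
    have hψn : ∀ w ∈ Ω, IsNormal f w (χ w • Q w) := fun w hw => by
      rw [← Complex.coe_smul]; exact (hQn w hw).smul _
    have hψr : ∀ w ∈ Ω, cconj (χ w • Q w) = χ w • Q w := fun w hw => by
      rw [← Complex.coe_smul, cconj_smul, Complex.conj_ofReal, hQr w hw]
    have hψ0 : ∀ w, w ∉ tsupport χ → χ w • Q w = 0 := fun w hw => by
      rw [image_eq_zero_of_notMem_tsupport hw, zero_smul]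
    have h1 := hW.critical 1 (tsupport χ) _ (isVariation_liftFamily hΩ hf hψ.contDiffOn hψn hψr
      hχc hχΩ fun w hw => hψ0 w hw.2)
    have h2 := hasDerivAt_willmoreFunctional hΩ hf hψ.contDiffOn hψn hψr hχc hχΩ
    rw [integral_first_variation hΩ hf hψ.contDiffOn hχc hχΩ hψ0] at h2
    have h3 := h2.unique h1
    rw [← setIntegral_eq_integral_of_forall_compl_eq_zero (s := tsupport χ)]
    · rw [← h3]
      refine setIntegral_congr_fun hχc.measurableSet fun w hw => ?_
      have hw' := hχΩ hw
      simp only [mink_real_smul_right, Complex.re_ofReal_mul, smul_eq_mul]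
      rw [hQx w hw' _ (hQn w hw')]
      simp
      ring
    · intro w hw
      rw [image_eq_zero_of_notMem_tsupport hw, zero_smul]
  have hzero : ∀ w ∈ Ω, (mink (Q w) (Q w)).re = 0 := by
    have h1 := Measure.eqOn_open_of_ae_eq (μ := volume) (f := fun w => (mink (Q w) (Q w)).re)
      (g := fun _ => 0) ((ae_restrict_iff' hΩ.measurableSet).2 hae) hΩ hq continuousOn_const
    exact fun w hw => h1 hw
  have hreal : mink (Q z) (Q z) = 0 := by
    have h1 : conj (mink (Q z) (Q z)) = mink (Q z) (Q z) := by rw [← mink_cconj, hQr z hz]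
    rw [← Complex.conj_eq_iff_re.1 h1, hzero z hz, Complex.ofReal_zero]
  have h0 := (hQn z hz).eq_zero hΩ hf hz (hQr z hz) hreal
  have h1 := hQx z hz x hx
  rw [h0, mink_zero_left] at h1
  simpa using h1.symm

end EulerLagrange

/-! ### Adjoint transforms -/

section Adjoint

variable {n : ℕ} {f : ℂ → EuclideanSpace ℝ (Fin (n + 1))} {Ω U : Set ℂ} {z : ℂ}

theorem mink_eta_eta (f : ℂ → EuclideanSpace ℝ (Fin (n + 1))) (m z : ℂ) :
    mink (eta f m z) (eta f m z) = mink (dbarHopf f z) (dbarHopf f z)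
      + conj m * mink (hopf f z) (dbarHopf f z) + conj m ^ 2 / 4 * mink (hopf f z) (hopf f z) := by
  simp only [eta, mink_add_left, mink_add_right, mink_smul_left, mink_smul_right,
    mink_comm (dbarHopf f z) (hopf f z)]
  ring

/-- Completing the square: where ⟨κ, κ⟩ ≠ 0, conformality means that b + (μ̄/2) a is a square root
of Δ. -/
theorem sq_eq_discr_add (f : ℂ → EuclideanSpace ℝ (Fin (n + 1))) (m z : ℂ) :
    (mink (hopf f z) (dbarHopf f z) + conj m / 2 * mink (hopf f z) (hopf f z)) ^ 2
      = discr f z + mink (hopf f z) (hopf f z) * mink (eta f m z) (eta f m z) := by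
  rw [mink_eta_eta, discr]
  ring

/-- Used with r = 1/4 for the conformality polynomial and with r = 1/2 for its derivative in μ̄. -/
theorem dzbar_add_mul {a b ν : ℂ → ℂ} (ha : DifferentiableAt ℝ a z) (hb : DifferentiableAt ℝ b z)
    (hν : DifferentiableAt ℝ ν z) (r : ℂ) : dzbar (fun w => b w + ν w * (r • a w)) z
      = dzbar b z + (dzbar ν z * (r * a z) + ν z * (r * dzbar a z)) := by
  have h1 : DifferentiableAt ℝ (fun w => r • a w) z := ha.const_smul r
  have h2 : DifferentiableAt ℝ (fun w => ν w * (r • a w)) z := hν.mul h1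
  rw [dzbar_add hb h2, dzbar_mul hν h1, dzbar_const_smul _ ha, smul_eq_mul, smul_eq_mul]

/-! ### Adjoint vectors, and conformality against co-touching. -/

section Immersion

variable (hΩ : IsOpen Ω) (hf : IsConformalImmersion Ω f)
include hΩ hf

theorem cconj_adjointVec (m : ℂ) (hz : z ∈ Ω) : cconj (adjointVec f m z) = adjointVec f m z := by
  simp only [adjointVec, cconj_add, cconj_smul, cconj_lift, cconj_dz_lift hΩ hf hz,
    cconj_dzbar_lift hΩ hf hz, cconj_frameN hΩ hf hz, Complex.conj_ofReal, Complex.conj_conj]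
  abel

theorem mink_adjointVec_lift (m : ℂ) (hz : z ∈ Ω) : mink (adjointVec f m z) (lift f z) = -1 := by
  simp [adjointVec, mink_lift_lift hf hz, mink_dz_lift hΩ hf hz, mink_dzbar_lift hΩ hf hz,
    mink_frameN_lift hΩ hf hz]

theorem mink_adjointVec_self (m : ℂ) (hz : z ∈ Ω) :
    mink (adjointVec f m z) (adjointVec f m z) = 0 := by
  have h : conj m * m = ((‖m‖ ^ 2 : ℝ) : ℂ) := by
    rw [Complex.conj_mul']
    norm_cast
  simp only [adjointVec, mink_add_left, mink_add_right, mink_smul_left, mink_smul_right,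
    mink_comm (lift f z) (dz (lift f) z), mink_comm (lift f z) (dzbar (lift f) z),
    mink_comm (lift f z) (frameN f z), mink_comm (dz (lift f) z) (frameN f z),
    mink_comm (dzbar (lift f) z) (frameN f z), mink_lift_lift hf hz, mink_dz_lift hΩ hf hz,
    mink_dzbar_lift hΩ hf hz, mink_frameN_lift hΩ hf hz, mink_frameN_dz hΩ hf hz,
    mink_frameN_dzbar hΩ hf hz, mink_frameN_frameN hΩ hf hz, mink_dz_dz hΩ hf hz,
    mink_dzbar_dzbar hΩ hf hz, mink_dz_dzbar hΩ hf hz, mink_dzbar_dz hΩ hf hz]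
  push_cast at h ⊢
  linear_combination h

/-- For any value of μ the adjoint vector is real, null and has product -1 with Y. So it represents
a point of the sphere, and an adjoint transform reduces to its two equations on μ. -/
theorem exists_isAdjointTransform (hU : U ⊆ Ω) {μ : ℂ → ℂ} (hμ : ContDiffOn ℝ ∞ μ U)
    (h1 : ∀ z ∈ U, dz μ z - μ z ^ 2 / 2 - schwarzian f z = 0)
    (h2 : ∀ z ∈ U, mink (eta f (μ z) z) (eta f (μ z) z) = 0) :
    ∃ g, IsAdjointTransform f U μ g := by
  have hne : ∀ z ∈ Ω, adjointVec f (μ z) z ≠ 0 := fun z hz h => by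
    have := mink_adjointVec_lift hΩ hf (μ z) hz
    rw [h, mink_zero_left] at this
    norm_num at this
  refine ⟨fun z => sphereMap (adjointVec f (μ z) z), hμ, h1, h2, fun z hz => ?_, fun z hz => ?_⟩
  · exact norm_sphereMap (cconj_adjointVec hΩ hf _ (hU hz)) (mink_adjointVec_self hΩ hf _ (hU hz))
      (hne z (hU hz))
  · exact ⟨_, (re_zero_ne_zero (cconj_adjointVec hΩ hf (μ z) (hU hz))
      (mink_adjointVec_self hΩ hf _ (hU hz)) (hne z (hU hz))).1,
      eq_smul_lightVec_sphereMap (cconj_adjointVec hΩ hf _ (hU hz))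
        (mink_adjointVec_self hΩ hf _ (hU hz)) (hne z (hU hz))⟩

variable (hW : ∀ z ∈ Ω, ∀ x, IsNormal f z x → mink (willmoreVec f z) x = 0)
include hW

/-- Where `⟨κ, κ⟩ ≠ 0`, conformality implies the co-touching equation. -/
theorem cotouching_of_conformality (hUo : IsOpen U) (hU : U ⊆ Ω)
    (ha : ∀ z ∈ U, mink (hopf f z) (hopf f z) ≠ 0) {μ : ℂ → ℂ} (hμ : ContDiffOn ℝ ∞ μ U)
    (h : ∀ z ∈ U, mink (eta f (μ z) z) (eta f (μ z) z) = 0) :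
    ∀ z ∈ U, dz μ z - μ z ^ 2 / 2 - schwarzian f z = 0 := by
  have hκ := (contDiffOn_hopf hΩ hf).mono hU
  have hκ' := (contDiffOn_dbarHopf hΩ hf).mono hU
  have hν : ContDiffOn ℝ ∞ (fun w => conj (μ w)) U :=
    Complex.conjCLE.contDiff.comp_contDiffOn hμ
  have dν := fun z (hz : z ∈ U) => differentiableAt_of_contDiffOn hUo hν hz
  have da := fun z (hz : z ∈ U) => differentiableAt_of_contDiffOn hUo (contDiffOn_mink hκ hκ) hz
  have db := fun z (hz : z ∈ U) => differentiableAt_of_contDiffOn hUo (contDiffOn_mink hκ hκ') hz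
  have dc := fun z (hz : z ∈ U) => differentiableAt_of_contDiffOn hUo (contDiffOn_mink hκ' hκ') hz
  have ea := fun z (hz : z ∈ U) => dzbar_mink_hopf_hopf hΩ hf (hU hz)
  have eb := fun z (hz : z ∈ U) => dzbar_mink_hopf_dbarHopf hΩ hf hW (hU hz)
  have ec := fun z (hz : z ∈ U) => dzbar_mink_dbarHopf_dbarHopf hΩ hf hW (hU hz)
  have hP : ∀ z ∈ U, mink (dbarHopf f z) (dbarHopf f z)
      + conj (μ z) * mink (hopf f z) (dbarHopf f z)
      + conj (μ z) * conj (μ z) * ((1 / 4 : ℂ) • mink (hopf f z) (hopf f z)) = 0 := fun z hz => by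
    have := h z hz
    rw [mink_eta_eta] at this
    rw [smul_eq_mul]
    linear_combination this
  set e : ℂ → ℂ := fun w => dzbar (fun w => conj (μ w)) w - conj (μ w) ^ 2 / 2
    - conj (schwarzian f w) with he
  set w : ℂ → ℂ := fun z => mink (hopf f z) (dbarHopf f z)
    + conj (μ z) * ((1 / 2 : ℂ) • mink (hopf f z) (hopf f z)) with hw
  -- The identity P_z̄ = w e + μ̄ P for the conformality polynomial P, with P = 0 on U.
  have hmul : ∀ z ∈ U, w z * e z = 0 := fun z hz => by
    have d1 : DifferentiableAt ℝ (fun w => conj (μ w) * mink (hopf f w) (dbarHopf f w)) z :=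
      (dν z hz).mul (db z hz)
    have d2 : DifferentiableAt ℝ (fun w => mink (dbarHopf f w) (dbarHopf f w)
        + conj (μ w) * mink (hopf f w) (dbarHopf f w)) z := (dc z hz).add d1
    have d3 : DifferentiableAt ℝ (fun w => conj (μ w) * conj (μ w)) z := (dν z hz).mul (dν z hz)
    have h1 := dzbar_congr hUo hP hz
    rw [dzbar_const, dzbar_add_mul (da z hz) d2 d3, dzbar_add (dc z hz) d1,
      dzbar_mul (dν z hz) (db z hz), dzbar_mul (dν z hz) (dν z hz), ea z hz, eb z hz, ec z hz] at h1
    have h2 := hP z hz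
    simp only [smul_eq_mul] at h1 h2
    simp only [hw, he, smul_eq_mul]
    linear_combination h1 - conj (μ z) * h2
  have hec : ContinuousOn e U := by
    have h1 : ContDiffOn ℝ ∞ (fun w => conj (schwarzian f w)) U :=
      Complex.conjCLE.contDiff.comp_contDiffOn ((contDiffOn_schwarzian hΩ hf).mono hU)
    exact (((contDiffOn_dzbar hUo hν).sub ((hν.pow 2).div_const 2)).sub h1).continuousOn
  -- Where e ≠ 0, an open condition, w vanishes and can be differentiated again: w_z̄ = P + (a/2) e
  -- gives a e = 0. This covers double roots, where w = 0 makes `hmul` empty.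
  have he0 : ∀ z ∈ U, e z = 0 := by
    by_contra! hcon
    obtain ⟨p, hp, hpe⟩ := hcon
    have hT : IsOpen (U ∩ e ⁻¹' {0}ᶜ) := hec.isOpen_inter_preimage hUo isOpen_compl_singleton
    have hpT : p ∈ U ∩ e ⁻¹' {0}ᶜ := ⟨hp, hpe⟩
    have hw0 : ∀ z ∈ U ∩ e ⁻¹' {0}ᶜ, w z = 0 := fun z hz =>
      (mul_eq_zero.1 (hmul z hz.1)).resolve_right hz.2
    have h1 := dzbar_congr hT hw0 hpT
    rw [dzbar_const, hw, dzbar_add_mul (da p hp) (db p hp) (dν p hp), ea p hp, eb p hp] at h1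
    have h2 := hP p hp
    simp only [smul_eq_mul] at h1 h2
    have h3 : mink (hopf f p) (hopf f p) * e p = 0 := by
      simp only [he]
      linear_combination 2 * h1 - 2 * h2
    exact hpe ((mul_eq_zero.1 h3).resolve_left (ha p hp))
  intro z hz
  have h1 := congrArg conj (he0 z hz)
  simp only [he, dzbar_conj, map_sub, map_div₀, map_pow, Complex.conj_conj, conj_two,
    map_zero] at h1
  exact h1

theorem exists_isAdjointTransform_of_conformality (hUo : IsOpen U) (hU : U ⊆ Ω)
    (ha : ∀ z ∈ U, mink (hopf f z) (hopf f z) ≠ 0) {μ : ℂ → ℂ} (hμ : ContDiffOn ℝ ∞ μ U)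
    (h : ∀ z ∈ U, mink (eta f (μ z) z) (eta f (μ z) z) = 0) :
    ∃ g, IsAdjointTransform f U μ g :=
  exists_isAdjointTransform hΩ hf hU hμ (cotouching_of_conformality hΩ hf hW hUo hU ha hμ h) h

/-- Where `⟨κ, κ⟩` vanishes identically, the conformality equation is trivial. -/
theorem conformality_of_mink_hopf_hopf_eq_zero (hUo : IsOpen U) (hU : U ⊆ Ω)
    (ha : ∀ z ∈ U, mink (hopf f z) (hopf f z) = 0) (m : ℂ) (hz : z ∈ U) :
    mink (eta f m z) (eta f m z) = 0 := by
  -- From a = 0 the system gives b = a_z̄/2 = 0 and then c = b_z̄ + (s̄/2) a = 0, so every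
  -- coefficient of the quadratic vanishes.
  have hb : ∀ z ∈ U, mink (hopf f z) (dbarHopf f z) = 0 := fun z hz => by
    have h1 := dzbar_congr hUo ha hz
    rw [dzbar_const, dzbar_mink_hopf_hopf hΩ hf (hU hz)] at h1
    simpa using h1
  have h1 := dzbar_congr hUo hb hz
  rw [dzbar_const, dzbar_mink_hopf_dbarHopf hΩ hf hW (hU hz), ha z hz] at h1
  rw [mink_eta_eta, ha z hz, hb z hz]
  linear_combination h1

end Immersion

/-- A holomorphic function without zero of odd order has a holomorphic square root. -/
theorem exists_sq_eq_of_not_odd {F : ℂ → ℂ} {p : ℂ} (hF : AnalyticAt ℂ F p)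
    (ho : ¬ Odd (analyticOrderNatAt F p)) :
    ∃ h : ℂ → ℂ, AnalyticAt ℂ h p ∧ ∀ᶠ z in nhds p, h z ^ 2 = F z := by
  -- `analyticOrderNatAt` is 0 at infinite order, so the hypothesis also admits F vanishing near p.
  by_cases htop : analyticOrderAt F p = ⊤
  · refine ⟨fun _ => 0, analyticAt_const, ?_⟩
    filter_upwards [analyticOrderAt_eq_top.1 htop] with z hz
    rw [hz, zero_pow two_ne_zero]
  · obtain ⟨g, hg, hg0, hFg⟩ := (hF.analyticOrderAt_ne_top).1 htop
    obtain ⟨k, hk⟩ := Nat.not_odd_iff_even.1 ho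
    obtain ⟨c, hc⟩ := IsAlgClosed.exists_pow_nat_eq (g p) (n := 2) two_pos
    -- Dividing by g(p) puts the value at p at 1, inside the slit plane, where the principal square
    -- root is analytic.
    have h1 : AnalyticAt ℂ (fun z => (g z / g p) ^ (((2 : ℕ) : ℂ)⁻¹)) p := by
      refine (hg.div analyticAt_const hg0).cpow analyticAt_const ?_
      simp [div_self hg0]
    refine ⟨fun z => (z - p) ^ k * (c * (g z / g p) ^ (((2 : ℕ) : ℂ)⁻¹)), ?_, ?_⟩
    · exact ((analyticAt_id.sub analyticAt_const).pow k).mul (analyticAt_const.mul h1)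
    · filter_upwards [hFg] with z hz
      rw [hz, hk, mul_pow, mul_pow, Complex.cpow_nat_inv_pow _ two_ne_zero, hc,
        mul_div_cancel₀ _ hg0, smul_eq_mul]
      ring

end Adjoint

/-! ### Local existence of adjoint transforms -/

section Existence

variable {n : ℕ} {f : ℂ → EuclideanSpace ℝ (Fin (n + 1))} {Ω : Set ℂ} {p : ℂ}
  (hΩ : IsOpen Ω) (hf : IsConformalImmersion Ω f)
  (hW : ∀ z ∈ Ω, ∀ x, IsNormal f z x → mink (willmoreVec f z) x = 0)

include hΩ hf hW

/-- For a square root h of Δ, solving b + (μ̄/2) a = ±h gives the smooth root μ̄ = 2(±h - b)/a, and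
conformality already implies co-touching. -/
theorem exists_isAdjointTransform_of_not_odd (hp : p ∈ Ω) (ha : mink (hopf f p) (hopf f p) ≠ 0)
    (ho : ¬ Odd (analyticOrderNatAt (discr f) p)) (m : ℂ) (hm : mink (eta f m p) (eta f m p) = 0) :
    ∃ U : Set ℂ, IsOpen U ∧ p ∈ U ∧ U ⊆ Ω ∧ ∃ μ g, IsAdjointTransform f U μ g ∧ μ p = m := by
  have hκ := contDiffOn_hopf hΩ hf
  have hκ' := contDiffOn_dbarHopf hΩ hf
  have hA := contDiffOn_mink hκ hκ
  have hB := contDiffOn_mink hκ hκ'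
  have hD := (differentiableOn_discr hΩ hf hW).analyticAt (hΩ.mem_nhds hp)
  obtain ⟨h, hh, hsq⟩ := exists_sq_eq_of_not_odd hD ho
  -- The sign is fixed by the prescribed root m at p. If Δ(p) = 0, either sign works.
  obtain ⟨σ, hσ, hσp⟩ : ∃ σ : ℂ, σ ^ 2 = 1 ∧ mink (hopf f p) (dbarHopf f p)
      + conj m / 2 * mink (hopf f p) (hopf f p) = σ * h p := by
    have h1 := sq_eq_discr_add f m p
    rw [hm, mul_zero, add_zero, ← hsq.self_of_nhds, sq_eq_sq_iff_eq_or_eq_neg] at h1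
    rcases h1 with h1 | h1
    · exact ⟨1, by norm_num, by rw [h1, one_mul]⟩
    · exact ⟨-1, by norm_num, by rw [h1, neg_one_mul]⟩
  have hev : ∀ᶠ z in nhds p, z ∈ Ω ∧ mink (hopf f z) (hopf f z) ≠ 0 ∧ h z ^ 2 = discr f z ∧
      AnalyticAt ℂ h z := by
    filter_upwards [hΩ.mem_nhds hp, (hA.continuousOn.continuousAt (hΩ.mem_nhds hp)).eventually_ne ha,
      hsq, hh.eventually_analyticAt] with z h1 h2 h3 h4 using ⟨h1, h2, h3, h4⟩
  obtain ⟨U, hU, hUo, hpU⟩ := eventually_nhds_iff.1 hev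
  have hUΩ : U ⊆ Ω := fun z hz => (hU z hz).1
  set ν : ℂ → ℂ := fun z => 2 * (σ * h z - mink (hopf f z) (dbarHopf f z))
    * (mink (hopf f z) (hopf f z))⁻¹ with hν
  have hνs : ContDiffOn ℝ ∞ ν U := by
    have hhs : ContDiffOn ℝ ∞ h U := fun z hz =>
      ((hU z hz).2.2.2.contDiffAt.restrict_scalars ℝ).contDiffWithinAt
    exact (contDiffOn_const.mul ((contDiffOn_const.mul hhs).sub (hB.mono hUΩ))).mul
      ((hA.mono hUΩ).inv fun z hz => (hU z hz).2.1)
  have hνe : ∀ z ∈ U, mink (hopf f z) (dbarHopf f z) + ν z / 2 * mink (hopf f z) (hopf f z)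
      = σ * h z := fun z hz => by
    have := (hU z hz).2.1
    simp only [hν]
    field_simp
    ring
  have hμs : ContDiffOn ℝ ∞ (fun z => conj (ν z)) U :=
    Complex.conjCLE.contDiff.comp_contDiffOn hνs
  obtain ⟨g, hg⟩ := exists_isAdjointTransform_of_conformality hΩ hf hW hUo hUΩ
    (fun z hz => (hU z hz).2.1) hμs fun z hz => by
      have h1 := sq_eq_discr_add f (conj (ν z)) z
      rw [Complex.conj_conj, hνe z hz, mul_pow, hσ, one_mul, (hU z hz).2.2.1] at h1
      have h2 : mink (hopf f z) (hopf f z)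
        * mink (eta f (conj (ν z)) z) (eta f (conj (ν z)) z) = 0 := by linear_combination -h1
      exact (mul_eq_zero.1 h2).resolve_left (hU z hz).2.1
  refine ⟨U, hUo, hpU, hUΩ, _, g, hg, ?_⟩
  have h1 := (hνe p hpU).trans hσp.symm
  have h2 : mink (hopf f p) (hopf f p) * (ν p - conj m) = 0 := by linear_combination 2 * h1
  rw [sub_eq_zero.1 ((mul_eq_zero.1 h2).resolve_left ha), Complex.conj_conj]

omit hΩ hf hW in
theorem exists_mink_eta_eq_zero (f : ℂ → EuclideanSpace ℝ (Fin (n + 1)))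
    (ha : mink (hopf f p) (hopf f p) ≠ 0) : ∃ m : ℂ, mink (eta f m p) (eta f m p) = 0 := by
  obtain ⟨r, hr⟩ := IsAlgClosed.exists_pow_nat_eq (discr f p) (n := 2) two_pos
  refine ⟨conj (2 * (r - mink (hopf f p) (dbarHopf f p)) / mink (hopf f p) (hopf f p)), ?_⟩
  have h1 := sq_eq_discr_add f
    (conj (2 * (r - mink (hopf f p) (dbarHopf f p)) / mink (hopf f p) (hopf f p))) p
  rw [Complex.conj_conj] at h1
  have h2 : mink (hopf f p) (dbarHopf f p) + 2 * (r - mink (hopf f p) (dbarHopf f p))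
      / mink (hopf f p) (hopf f p) / 2 * mink (hopf f p) (hopf f p) = r := by
    field_simp
    ring
  rw [h2, hr, left_eq_add, mul_eq_zero] at h1
  exact h1.resolve_left ha

theorem infinite_adjointTransforms {U : Set ℂ} (hUo : IsOpen U) (hU : U ⊆ Ω)
    (ha : ∀ z ∈ U, mink (hopf f z) (hopf f z) = 0) (hp : p ∈ U) :
    ∃ V : Set ℂ, IsOpen V ∧ p ∈ V ∧ V ⊆ U ∧
      {m : ℂ | ∃ μ g, IsAdjointTransform f V μ g ∧ μ p = m}.Infinite := by
  obtain ⟨V, hV, hpV, hVU, hinf⟩ := exists_riccati hUo ((contDiffOn_schwarzian hΩ hf).mono hU) hp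
  refine ⟨V, hV, hpV, hVU, hinf.mono ?_⟩
  rintro m ⟨μ, hμ, h1, h2⟩
  obtain ⟨g, hg⟩ := exists_isAdjointTransform hΩ hf (hVU.trans hU) hμ h1 fun z hz =>
    conformality_of_mink_hopf_hopf_eq_zero hΩ hf hW hUo hU ha _ (hVU hz)
  exact ⟨μ, g, hg, h2⟩

/-- The set of all points with an adjoint transform nearby is open by construction. It meets every
neighbourhood O of p: either ⟨κ, κ⟩ is zero on O ∩ Ω, or it is non-zero at some q there, and the odd
zeros of Δ can be avoided close to q. -/
theorem exists_dense_adjointTransform :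
    ∃ Ω₀ : Set ℂ, IsOpen Ω₀ ∧ Ω₀ ⊆ Ω ∧ Ω ⊆ closure Ω₀ ∧
      ∀ p ∈ Ω₀, ∃ U : Set ℂ, IsOpen U ∧ p ∈ U ∧ U ⊆ Ω ∧ ∃ μ g, IsAdjointTransform f U μ g := by
  refine ⟨{p | ∃ U : Set ℂ, IsOpen U ∧ p ∈ U ∧ U ⊆ Ω ∧ ∃ μ g, IsAdjointTransform f U μ g},
    ?_, ?_, ?_, fun p hp => hp⟩
  · rw [isOpen_iff_mem_nhds]
    rintro p ⟨U, hU, hpU, h⟩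
    filter_upwards [hU.mem_nhds hpU] with q hq using ⟨U, hU, hq, h⟩
  · rintro p ⟨U, -, hpU, hU, -⟩
    exact hU hpU
  · intro p hp
    rw [mem_closure_iff]
    intro O hO hpO
    have hreg : ∀ q ∈ Ω, mink (hopf f q) (hopf f q) ≠ 0 →
        ¬ Odd (analyticOrderNatAt (discr f) q) →
        ∃ U : Set ℂ, IsOpen U ∧ q ∈ U ∧ U ⊆ Ω ∧ ∃ μ g, IsAdjointTransform f U μ g := by
      intro q hq haq ho
      obtain ⟨m, hm⟩ := exists_mink_eta_eq_zero f haq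
      obtain ⟨U, h1, h2, h3, μ, g, h4, -⟩ :=
        exists_isAdjointTransform_of_not_odd hΩ hf hW hq haq ho m hm
      exact ⟨U, h1, h2, h3, μ, g, h4⟩
    by_cases hall : ∀ z ∈ O ∩ Ω, mink (hopf f z) (hopf f z) = 0
    · obtain ⟨V, hV, hpV, hVO, hinf⟩ := infinite_adjointTransforms hΩ hf hW (hO.inter hΩ)
        Set.inter_subset_right hall ⟨hpO, hp⟩
      obtain ⟨-, μ, g, hg, -⟩ := hinf.nonempty
      exact ⟨p, hpO, V, hV, hpV, hVO.trans Set.inter_subset_right, μ, g, hg⟩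
    · push Not at hall
      obtain ⟨q, ⟨hqO, hq⟩, haq⟩ := hall
      have hD := (differentiableOn_discr hΩ hf hW).analyticAt (hΩ.mem_nhds hq)
      rcases hD.eventually_eq_zero_or_eventually_ne_zero with h0 | h0
      -- Δ vanishes near q: the infinite order is recorded as 0, which is not odd.
      · refine ⟨q, hqO, hreg q hq haq ?_⟩
        rw [analyticOrderNatAt, analyticOrderAt_eq_top.2 h0]
        simp
      -- The zeros of Δ are isolated near q, so q is replaced by a nearby r with Δ(r) ≠ 0, still in
      -- O and with ⟨κ, κ⟩ ≠ 0.
      · have hκ := contDiffOn_hopf hΩ hf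
        have hev := (contDiffOn_mink hκ hκ).continuousOn.continuousAt (hΩ.mem_nhds hq)
          |>.eventually_ne haq
        have hev2 : ∀ᶠ r in nhds q, r ∈ O ∧ r ∈ Ω ∧ mink (hopf f r) (hopf f r) ≠ 0 := by
          filter_upwards [hO.mem_nhds hqO, hΩ.mem_nhds hq, hev] with r h1 h2 h3 using ⟨h1, h2, h3⟩
        obtain ⟨r, hr, hrO, hrΩ, har⟩ := (h0.and (hev2.filter_mono nhdsWithin_le_nhds)).exists
        refine ⟨r, hrO, hreg r hrΩ har ?_⟩
        have hDr := (differentiableOn_discr hΩ hf hW).analyticAt (hΩ.mem_nhds hrΩ)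
        rw [analyticOrderNatAt, hDr.analyticOrderAt_eq_zero.2 hr]
        simp

end Existence

end

end WillmoreAdjoint

theorem mainTheorem3 (n : ℕ) (hn : 3 ≤ n) (Ω : Set ℂ) (hΩ : IsOpen Ω)
    (f : ℂ → EuclideanSpace ℝ (Fin (n + 1))) (hf : WillmoreAdjoint.IsWillmore Ω f) :
    -- adjoint transforms exist near every point of an open dense subset of `Ω`
    (∃ Ω₀ : Set ℂ, IsOpen Ω₀ ∧ Ω₀ ⊆ Ω ∧ Ω ⊆ closure Ω₀ ∧
      ∀ p ∈ Ω₀, ∃ U : Set ℂ, IsOpen U ∧ p ∈ U ∧ U ⊆ Ω ∧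
        ∃ μ g, WillmoreAdjoint.IsAdjointTransform f U μ g) ∧
    -- where `⟨κ, κ⟩ ≠ 0`, every smooth root of the conformality equation is a solution
    (∀ U : Set ℂ, IsOpen U → U ⊆ Ω →
      (∀ z ∈ U, WillmoreAdjoint.mink (WillmoreAdjoint.hopf f z) (WillmoreAdjoint.hopf f z) ≠ 0) →
      ∀ μ : ℂ → ℂ, ContDiffOn ℝ ∞ μ U →
        (∀ z ∈ U, WillmoreAdjoint.mink (WillmoreAdjoint.eta f (μ z) z)
          (WillmoreAdjoint.eta f (μ z) z) = 0) →
        ∃ g, WillmoreAdjoint.IsAdjointTransform f U μ g) ∧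
    -- the discriminant is holomorphic, and unless it has a zero of odd order at `p`, both roots
    -- at `p` extend to smooth solutions near `p`
    DifferentiableOn ℂ (WillmoreAdjoint.discr f) Ω ∧
    (∀ p ∈ Ω, WillmoreAdjoint.mink (WillmoreAdjoint.hopf f p) (WillmoreAdjoint.hopf f p) ≠ 0 →
      ¬ Odd (analyticOrderNatAt (WillmoreAdjoint.discr f) p) →
      ∀ m : ℂ, WillmoreAdjoint.mink (WillmoreAdjoint.eta f m p) (WillmoreAdjoint.eta f m p) = 0 →
        ∃ U : Set ℂ, IsOpen U ∧ p ∈ U ∧ U ⊆ Ω ∧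
          ∃ μ g, WillmoreAdjoint.IsAdjointTransform f U μ g ∧ μ p = m) ∧
    -- where `⟨κ, κ⟩` vanishes identically, the solutions are those of the Riccati equation alone,
    -- and locally there are infinitely many
    (∀ U : Set ℂ, IsOpen U → U ⊆ Ω →
      (∀ z ∈ U, WillmoreAdjoint.mink (WillmoreAdjoint.hopf f z) (WillmoreAdjoint.hopf f z) = 0) →
      (∀ μ : ℂ → ℂ, ContDiffOn ℝ ∞ μ U →
        (∀ z ∈ U, WillmoreAdjoint.dz μ z - μ z ^ 2 / 2 - WillmoreAdjoint.schwarzian f z = 0) →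
        ∃ g, WillmoreAdjoint.IsAdjointTransform f U μ g) ∧
      ∀ p ∈ U, ∃ V : Set ℂ, IsOpen V ∧ p ∈ V ∧ V ⊆ U ∧
        {m : ℂ | ∃ μ g, WillmoreAdjoint.IsAdjointTransform f V μ g ∧ μ p = m}.Infinite) := by
  have him := hf.immersion
  have hW : ∀ z ∈ Ω, ∀ x, WillmoreAdjoint.IsNormal f z x →
      WillmoreAdjoint.mink (WillmoreAdjoint.willmoreVec f z) x = 0 :=
    fun z hz x hx => hf.mink_willmoreVec hΩ hz hx
  refine ⟨WillmoreAdjoint.exists_dense_adjointTransform hΩ him hW,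
    fun U hUo hU ha μ hμ h =>
      WillmoreAdjoint.exists_isAdjointTransform_of_conformality hΩ him hW hUo hU ha hμ h,
    WillmoreAdjoint.differentiableOn_discr hΩ him hW,
    fun p hp ha ho m hm =>
      WillmoreAdjoint.exists_isAdjointTransform_of_not_odd hΩ him hW hp ha ho m hm,
    fun U hUo hU ha => ⟨fun μ hμ h => ?_, fun p hp =>
      WillmoreAdjoint.infinite_adjointTransforms hΩ him hW hUo hU ha hp⟩⟩
  exact WillmoreAdjoint.exists_isAdjointTransform hΩ him hU hμ h fun z hz =>
    WillmoreAdjoint.conformality_of_mink_hopf_hopf_eq_zero hΩ him hW hUo hU ha _ hz
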